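/- Let $\nu\ge 0$ and $\delta\in\mathbb{R}$, put $\mu=4\nu^2$, and for $x>0$ let $j_{\nu,\delta}(x)=x^{-\delta}J_\nu(x)$ and $y_{\nu,\delta}(x)=x^{-\delta}Y_\nu(x)$, where $J_\nu,Y_\nu$ are the Bessel functions of the first and second kind. For $k\ge 1$ let $a'_{\nu,\delta,k}$ and $b'_{\nu,\delta,k}$ be the $k$-th positive zeros, in ascending order, of the derivatives $j'_{\nu,\delta}$ and $y'_{\nu,\delta}$, where for $j'_{\nu,\delta}$ the point $x=0$ is counted as the first zero when $\nu\le\delta$ (all these zeros exist). Let $m=m_{\nu,\delta}$ be the number of positive zeros of $y'_{\nu,\delta}$ that are smaller than the first positive zero of $Y_\nu$. Then $m=0$ whenever $\delta\ge 0$, and there is a sequence of real numbers $c_0,c_1,c_2,\dots$, depending only on $\nu$ and $\delta$, with $$c_0=-(\mu+3+8\delta),\qquad c_1=-\tfrac43\left(7\mu^2+(82+144\delta)\mu-9+144\delta+192\delta^2-128\delta^3\right),$$ \begin{align*} c_2=C_{\nu,\delta}=-\tfrac{32}{15}\Big(&83\mu^3+(2075+2920\delta)\mu^2-(3039-9040\delta-10560\delta^2+4480\delta^3)\mu\\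 &+3537+1800\delta+8640\delta^2+1920\delta^3-12800\delta^4+3072\delta^5\Big), \end{align*} \begin{align*} c_3=\tilde C_{\nu,\delta}=-\tfrac{64}{105}\Big(&6949\mu^4+(296492+356832\delta)\mu^3-(1248002-2194080\delta-2298240\delta^2+743680\delta^3)\mu^2\\ &+(7414380+696864\delta+5295360\delta^2+1917440\delta^3-4945920\delta^4+946176\delta^5)\mu\\ &-5853627+913248\delta+1330560\delta^2+2338560\delta^3-3225600\delta^4\\ &-4902912\delta^5+3555328\delta^6-491520\delta^7\Big), \end{align*} such that, as $k\to\infty$, $$a'_{\nu,\delta,k}\sim\beta'+\sum_{i=0}^{\infty}\frac{c_i}{(8\beta')^{2i+1}}\quad\text{with }\beta'=\Big(k+\frac{\nu}{2}-\frac34\Big)\pi,$$ $$b'_{\nu,\delta,k+m}\sim\beta'+\sum_{i=0}^{\infty}\frac{c_i}{(8\beta')^{2i+1}}\quad\text{with }\beta'=\Big(k+\frac{\nu}{2}-\frac14\Big)\pi.$$ Here $\sim$ means that for every $n\ge 0$ the difference between the left side and $\beta'+\sum_{i<n}c_i(8\beta')^{-2i-1}$ is $O\big((8\beta')^{-2n-1}\big)$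 as $k\to\infty$, with an implied constant that may depend on $\nu,\delta,n$. In particular, for $\delta\ge 0$ the second expansion is that of the $k$-th positive zero $b'_{\nu,\delta,k}$ itself. -/

import Mathlib

open Filter Topology Asymptotics
open scoped Nat

noncomputable section

/-- The Bessel function of the first kind `J_ν(x)` of real order `ν`, for `x > 0`, by its power
series.  `Real.Gamma` takes the value `0` at its poles, so the terms with `m + ν + 1` a
nonpositive integer vanish, in agreement with the convention `1 / Γ(-n) = 0`. -/
def besselJ (ν x : ℝ) : ℝ :=
  ∑' m : ℕ, (-1 : ℝ) ^ m / ((m ! : ℝ) * Real.Gamma ((m : ℝ) + ν + 1)) *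
    (x / 2) ^ (2 * (m : ℝ) + ν)

/-- The quotient `(J_ν(x) cos νπ - J_{-ν}(x)) / sin νπ`. -/
def besselYQuot (ν x : ℝ) : ℝ :=
  (besselJ ν x * Real.cos (ν * Real.pi) - besselJ (-ν) x) / Real.sin (ν * Real.pi)

open Classical in
/-- The Bessel function of the second kind `Y_ν(x)`, for `x > 0`: the above quotient if `ν` is not
an integer, and its limit as the order tends to `ν` if `ν` is an integer. -/
def besselY (ν x : ℝ) : ℝ :=
  if ∃ n : ℤ, ν = n then limUnder (𝓝[≠] ν) (fun s : ℝ => besselYQuot s x)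
  else besselYQuot ν x

/-- The ultraspherical Bessel function `j_{ν,δ}(x) = x^{-δ} J_ν(x)`. -/
def ultraJ (ν δ x : ℝ) : ℝ := x ^ (-δ) * besselJ ν x

/-- The ultraspherical Bessel function `y_{ν,δ}(x) = x^{-δ} Y_ν(x)`. -/
def ultraY (ν δ x : ℝ) : ℝ := x ^ (-δ) * besselY ν x

/-- The positive zeros of `j'_{ν,δ}`, together with `0` if `ν ≤ δ` (`0` is then counted as the
first zero). -/
def zerosJ' (ν δ : ℝ) : Set ℝ :=
  {x | 0 < x ∧ deriv (ultraJ ν δ) x = 0} ∪ {x | x = 0 ∧ ν ≤ δ}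

/-- The positive zeros of `y'_{ν,δ}`. -/
def zerosY' (ν δ : ℝ) : Set ℝ :=
  {x | 0 < x ∧ deriv (ultraY ν δ) x = 0}

/-- The number of positive zeros of `y'_{ν,δ}` that lie below the first positive zero of `Y_ν`. -/
def earlyZerosY' (ν δ : ℝ) : ℕ :=
  {x | x ∈ zerosY' ν δ ∧ ∀ t, 0 < t → t ≤ x → besselY ν t ≠ 0}.ncard

/-- `x` is the `k`-th element of `Z`, in ascending order, counted from `k = 1`. -/
def IsKth (Z : Set ℝ) (k : ℕ) (x : ℝ) : Prop :=
  x ∈ Z ∧ {t | t ∈ Z ∧ t < x}.Finite ∧ {t | t ∈ Z ∧ t < x}.ncard + 1 = k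

/-- The asymptotic expansion `x_k ∼ β_k + ∑ i, c_i / (8 β_k)^(2 i + 1)` as `k → ∞`, to all
orders. -/
def HasMcMahonExpansion (x β c : ℕ → ℝ) : Prop :=
  ∀ n : ℕ,
    (fun k : ℕ => x k - (β k + ∑ i ∈ Finset.range n, c i / (8 * β k) ^ (2 * i + 1)))
      =O[atTop] (fun k : ℕ => 1 / (8 * β k) ^ (2 * n + 1))

/-- The coefficient `C_{ν,δ}`, with `μ = 4 ν ^ 2`. -/
def coeffC (μ δ : ℝ) : ℝ :=
  -(32 / 15) * (83 * μ ^ 3 + (2075 + 2920 * δ) * μ ^ 2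
    - (3039 - 9040 * δ - 10560 * δ ^ 2 + 4480 * δ ^ 3) * μ
    + 3537 + 1800 * δ + 8640 * δ ^ 2 + 1920 * δ ^ 3 - 12800 * δ ^ 4 + 3072 * δ ^ 5)

/-- The coefficient `C̃_{ν,δ}`, with `μ = 4 ν ^ 2`. -/
def coeffCTilde (μ δ : ℝ) : ℝ :=
  -(64 / 105) * (6949 * μ ^ 4 + (296492 + 356832 * δ) * μ ^ 3
    - (1248002 - 2194080 * δ - 2298240 * δ ^ 2 + 743680 * δ ^ 3) * μ ^ 2
    + (7414380 + 696864 * δ + 5295360 * δ ^ 2 + 1917440 * δ ^ 3 - 4945920 * δ ^ 4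
      + 946176 * δ ^ 5) * μ
    - 5853627 + 913248 * δ + 1330560 * δ ^ 2 + 2338560 * δ ^ 3 - 3225600 * δ ^ 4
    - 4902912 * δ ^ 5 + 3555328 * δ ^ 6 - 491520 * δ ^ 7)

end

open MeasureTheory Set

/-! Put H = J_ν + iY_ν and W = xH' − δH. Up to the positive factor x^(δ+1), the real and imaginary
parts of W are j'_{ν,δ} and y'_{ν,δ}. So their positive zeros are the points where a continuous
argument ψ of W is an odd multiple of π/2, respectively a multiple of π. The theorem follows from a
monotonicity analysis of ψ, its normalisation, and its asymptotic expansion.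

H is built as a Laplace integral ∫ e^(-xv) v^a (1+iv/2)^a dv with a = ν − 1/2. Poisson's integral,
deformed to vertical half-lines, gives J = Re H for large order. Leading asymptotics and Wronskians
extend this to order > −1/2 and to J_{-ν}, whence Y = Im H (`besselJ_eq_re_mul_hankelH`,
`besselY_eq_im_hankelH`).

The Wronskian x·Im(H'·conj H) = 2/π makes the argument θ of H increasing, keeps ψ strictly between θ
and θ + π, and gives ψ' the sign of x² − (ν² − δ²). The essential global fact is that one branch of
θ lies in (−π/2, 0) near 0 and satisfies θ − x → −(νπ/2 + π/4) at infinity (`exists_hankelPhase`):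
sectors of the integrand settle ν < 1, and the ratio H_{ν+1}/H_ν raises the order. Counting
crossings then gives ψ(a'_k) = (k − 1/2)π for k ≥ 2 and ψ(b'_{k+m}) = kπ, where the m early zeros
are exactly the solutions of ψ = 0.

Watson's lemma expands W·e^(-ix) in powers of i/x with real coefficients, up to an elementary
factor. The imaginary part of its logarithm therefore has only odd powers of 1/x, and ψ = x − νπ/2 +
π/4 + Σ e_j x^(-2j-1) asymptotically (`IsHankelPhase.ultraPhase_expansion`). Both families of zeros
thus solve x + Σ e_j x^(-2j-1) = β', and one reversion of this series (`isBigO_reversion`) gives the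
common c_i. The first four come from a finite computation.

For m = 0 when δ ≥ 0 it suffices that the phase of xH' is positive at its minimum x = ν. Otherwise a
Sturm comparison with sin ζ, ζ = ∫ √(x² − ν²) dx/x, would contradict the limits of ζ and ψ at
infinity (`IsHankelPhase.ultraPhase_self_pos`). -/

/-! ### Power series of J_s: convergence, derivative and recurrence -/

/-- Coefficients of the entire function `E_s` with `J_s(x) = (x/2)^s E_s(x^2/4)`. -/
noncomputable def besselCoeff (s : ℝ) (m : ℕ) : ℝ :=
  (-1 : ℝ) ^ m / ((m ! : ℝ) * Real.Gamma ((m : ℝ) + s + 1))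

/-- The entire function `E_s` with `J_s(x) = (x/2)^s E_s(x^2/4)`. -/
noncomputable def besselE (s z : ℝ) : ℝ := ∑' m : ℕ, besselCoeff s m * z ^ m

/-- Holds at the poles as well, where `Real.Gamma` is 0 and so is its inverse. This is what makes
the recurrences below valid for every real order, negative integers included. -/
theorem inv_Gamma_eq_mul_inv_Gamma_add_one (s : ℝ) :
    (Real.Gamma s)⁻¹ = s * (Real.Gamma (s + 1))⁻¹ := by
  have h := Complex.one_div_Gamma_eq_self_mul_one_div_Gamma_add_one (s : ℂ)
  rw [Complex.Gamma_ofReal, ← Complex.ofReal_one, ← Complex.ofReal_add, Complex.Gamma_ofReal] at h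
  exact_mod_cast h

theorem besselCoeff_succ_mul (s : ℝ) (m : ℕ) :
    besselCoeff s (m + 1) * ((m : ℝ) + 1) = -besselCoeff (s + 1) m := by
  have h1 : ((m : ℝ) + 1) ≠ 0 := by positivity
  have h2 : ((m ! : ℕ) : ℝ) ≠ 0 := by exact_mod_cast Nat.factorial_ne_zero m
  unfold besselCoeff
  rw [Nat.factorial_succ]
  push_cast
  rw [show (m : ℝ) + 1 + s + 1 = m + (s + 1) + 1 by ring]
  rw [div_mul_eq_div_div, div_mul_eq_div_div]
  field_simp
  ring

theorem besselCoeff_eq_mul (s : ℝ) (m : ℕ) :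
    besselCoeff s m = ((m : ℝ) + s + 1) * besselCoeff (s + 1) m := by
  unfold besselCoeff
  rw [div_eq_mul_inv, mul_inv, inv_Gamma_eq_mul_inv_Gamma_add_one, div_eq_mul_inv, mul_inv,
    show (m : ℝ) + (s + 1) + 1 = m + s + 1 + 1 by ring]
  ring

theorem summable_besselCoeff (s z : ℝ) : Summable fun m : ℕ => ‖besselCoeff s m * z ^ m‖ := by
  apply summable_of_ratio_norm_eventually_le (r := 1 / 2) (by norm_num)
  -- From this index on (m + 1)(m + s + 1) ≥ 2|z|, so each term is at most half the preceding one.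
  filter_upwards [eventually_ge_atTop ⌈|z| + |z| + |s|⌉₊] with m hm
  have hm' : |z| + |z| + |s| ≤ m := Nat.ceil_le.mp hm
  have hs : -|s| ≤ s := neg_abs_le s
  have hz : 0 ≤ |z| := abs_nonneg z
  have h1 : besselCoeff s (m + 1) * ((m + 1 : ℝ) * (m + s + 1)) = -besselCoeff s m := by
    rw [← mul_assoc, besselCoeff_succ_mul, besselCoeff_eq_mul s m]; ring
  have hp : (1 : ℝ) ≤ m + s + 1 := by linarith
  have hq : 2 * |z| ≤ (m + 1 : ℝ) * (m + s + 1) := by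
    nlinarith [abs_nonneg s]
  rw [norm_norm, norm_norm, norm_mul, norm_mul, pow_succ, norm_mul]
  have h2 : ‖besselCoeff s m‖ = ‖besselCoeff s (m + 1)‖ * ((m + 1 : ℝ) * (m + s + 1)) := by
    rw [← norm_neg, ← h1, norm_mul]
    congr 1
    rw [Real.norm_of_nonneg]
    positivity
  rw [h2, Real.norm_eq_abs z]
  have : 0 ≤ ‖besselCoeff s (m + 1)‖ * ‖z ^ m‖ := by positivity
  nlinarith

theorem summable_besselCoeff' (s z : ℝ) : Summable fun m : ℕ => besselCoeff s m * z ^ m :=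
  (summable_besselCoeff s z).of_norm

theorem hasDerivAt_besselE (s z : ℝ) : HasDerivAt (besselE s) (-besselE (s + 1) z) z := by
  set R : ℝ := |z| + 1
  have hu : Summable fun m : ℕ => ‖besselCoeff s m * (m * R ^ (m - 1))‖ := by
    rw [← summable_nat_add_iff 1]
    refine (summable_besselCoeff (s + 1) R).congr fun m => ?_
    simp only [Nat.add_sub_cancel, Nat.cast_add, Nat.cast_one]
    rw [← mul_assoc, besselCoeff_succ_mul, neg_mul, norm_neg]
  have key := hasDerivAt_tsum_of_isPreconnected (t := Metric.ball (0 : ℝ) R)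
    (g := fun (m : ℕ) (y : ℝ) => besselCoeff s m * y ^ m)
    (g' := fun (m : ℕ) (y : ℝ) => besselCoeff s m * (m * y ^ (m - 1)))
    (y₀ := 0) (y := z) hu Metric.isOpen_ball (convex_ball _ _).isPreconnected
    (fun m y _ => (hasDerivAt_pow m y).const_mul _)
    (fun m y hy => by
      rw [Metric.mem_ball, dist_zero_right] at hy
      rw [norm_mul, norm_mul, norm_mul, norm_mul]
      gcongr
      rw [norm_pow, norm_pow]
      exact pow_le_pow_left₀ (norm_nonneg _) (hy.le.trans (le_abs_self R)) _)
    (Metric.mem_ball_self (by positivity)) (summable_besselCoeff' s 0)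
    (by rw [Metric.mem_ball, dist_zero_right, Real.norm_eq_abs]; exact lt_add_one _)
  have hsum : ∑' m : ℕ, besselCoeff s m * (m * z ^ (m - 1)) = -besselE (s + 1) z := by
    have hs : Summable fun m : ℕ => besselCoeff s m * (m * z ^ (m - 1)) := by
      rw [← summable_nat_add_iff 1]
      refine (summable_besselCoeff' (s + 1) z).neg.congr fun m => ?_
      simp only [Nat.add_sub_cancel, Nat.cast_add, Nat.cast_one]
      rw [← mul_assoc, besselCoeff_succ_mul, neg_mul]
    rw [hs.tsum_eq_zero_add]
    simp only [Nat.add_sub_cancel, Nat.cast_add, Nat.cast_one, Nat.cast_zero, zero_mul, mul_zero,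
      zero_add]
    rw [besselE, ← tsum_neg]
    congr 1; ext m
    rw [← mul_assoc, besselCoeff_succ_mul, neg_mul]
  rw [hsum] at key
  exact key

theorem besselE_recurrence (s z : ℝ) :
    besselE s z = (s + 1) * besselE (s + 1) z - z * besselE (s + 2) z := by
  have h0 := summable_besselCoeff' (s + 1) z
  have h2 := summable_besselCoeff' (s + 2) z
  have hm : Summable fun m : ℕ => (m : ℝ) * (besselCoeff (s + 1) m * z ^ m) := by
    rw [← summable_nat_add_iff 1]
    refine (h2.mul_left (-z)).congr fun m => ?_
    have := besselCoeff_succ_mul (s + 1) m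
    rw [show s + 1 + 1 = s + 2 by ring] at this
    push_cast
    rw [pow_succ]
    linear_combination (-z * z ^ m) * this
  have e : ∑' m : ℕ, (m : ℝ) * (besselCoeff (s + 1) m * z ^ m) = -z * besselE (s + 2) z := by
    rw [hm.tsum_eq_zero_add, besselE, ← tsum_mul_left]
    simp only [Nat.cast_zero, zero_mul, zero_add]
    congr 1; ext m
    have := besselCoeff_succ_mul (s + 1) m
    rw [show s + 1 + 1 = s + 2 by ring] at this
    push_cast
    rw [pow_succ]
    linear_combination (z * z ^ m) * this
  have : besselE s z = ∑' m : ℕ, ((m : ℝ) * (besselCoeff (s + 1) m * z ^ m) +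
      (s + 1) * (besselCoeff (s + 1) m * z ^ m)) := by
    unfold besselE
    congr 1; ext m
    rw [besselCoeff_eq_mul]; ring
  rw [this, hm.tsum_add (h0.mul_left _), e, tsum_mul_left]
  unfold besselE
  ring

theorem besselE_zero (s : ℝ) : besselE s 0 = (Real.Gamma (s + 1))⁻¹ := by
  unfold besselE
  rw [tsum_eq_single 0]
  · simp [besselCoeff]
  · intro m hm; simp [hm]

theorem continuous_besselE (s : ℝ) : Continuous (besselE s) :=
  continuous_iff_continuousAt.mpr fun z => (hasDerivAt_besselE s z).continuousAt

theorem besselJ_eq {s x : ℝ} (hx : 0 < x) :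
    besselJ s x = (x / 2) ^ s * besselE s ((x / 2) ^ 2) := by
  unfold besselJ besselE
  rw [← tsum_mul_left]
  congr 1; ext m
  rw [show (2 * (m : ℝ) + s) = s + ((2 * m : ℕ) : ℝ) by push_cast; ring,
    Real.rpow_add_natCast (by positivity), pow_mul]
  unfold besselCoeff
  ring

theorem besselJ_recurrence {s x : ℝ} (hx : 0 < x) :
    besselJ s x = 2 * (s + 1) / x * besselJ (s + 1) x - besselJ (s + 2) x := by
  have h := besselE_recurrence s ((x / 2) ^ 2)
  have h2 : (0 : ℝ) < x / 2 := by positivity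
  rw [besselJ_eq hx, besselJ_eq hx, besselJ_eq hx, h, Real.rpow_add h2, Real.rpow_add h2,
    Real.rpow_one, Real.rpow_two]
  field_simp

theorem hasDerivAt_besselJ {s x : ℝ} (hx : 0 < x) :
    HasDerivAt (besselJ s) (s / x * besselJ s x - besselJ (s + 1) x) x := by
  have h2 : (0 : ℝ) < x / 2 := by positivity
  have e : besselJ s =ᶠ[𝓝 x] fun x => (x / 2) ^ s * besselE s ((x / 2) ^ 2) := by
    filter_upwards [lt_mem_nhds hx] with y hy using besselJ_eq hy
  refine HasDerivAt.congr_of_eventuallyEq ?_ e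
  have d1 : HasDerivAt (fun x : ℝ => x / 2) (1 / 2) x := (hasDerivAt_id x).div_const 2
  have d2 : HasDerivAt (fun x : ℝ => (x / 2) ^ s) (1 / 2 * s * (x / 2) ^ (s - 1)) x :=
    d1.rpow_const (Or.inl h2.ne')
  have d3 : HasDerivAt (fun x : ℝ => besselE s ((x / 2) ^ 2))
      (-besselE (s + 1) ((x / 2) ^ 2) * (2 * (x / 2) * (1 / 2))) x := by
    have d4 : HasDerivAt (fun x : ℝ => (x / 2) ^ 2) (2 * (x / 2) * (1 / 2)) x := by
      simpa using d1.fun_pow 2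
    exact HasDerivAt.comp x (hasDerivAt_besselE s ((x / 2) ^ 2)) d4
  refine (d2.mul d3).congr_deriv ?_
  rw [besselJ_eq hx, besselJ_eq hx, Real.rpow_add h2, Real.rpow_sub h2, Real.rpow_one]
  field_simp
  ring

theorem hasDerivAt_besselJ' {s x : ℝ} (hx : 0 < x) :
    HasDerivAt (besselJ (s + 1)) (besselJ s x - (s + 1) / x * besselJ (s + 1) x) x := by
  refine (hasDerivAt_besselJ (s := s + 1) hx).congr_deriv ?_
  rw [besselJ_recurrence (s := s) hx, show s + 1 + 1 = s + 2 by ring]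
  ring

theorem besselJ_pos_near_zero {s : ℝ} (hs : 0 ≤ s) : ∀ᶠ x in 𝓝[>] (0 : ℝ), 0 < besselJ s x := by
  have hc : ContinuousAt (fun x : ℝ => besselE s ((x / 2) ^ 2)) 0 :=
    ((continuous_besselE s).comp (by fun_prop)).continuousAt
  have h0 : 0 < besselE s (((0 : ℝ) / 2) ^ 2) := by
    simp only [zero_div, ne_eq, OfNat.ofNat_ne_zero, not_false_eq_true, zero_pow, besselE_zero]
    exact inv_pos.mpr (Real.Gamma_pos_of_pos (by linarith))
  have h1 : ∀ᶠ x in 𝓝[>] (0 : ℝ), 0 < besselE s ((x / 2) ^ 2) :=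
    nhdsWithin_le_nhds (hc.eventually (lt_mem_nhds h0))
  filter_upwards [h1, self_mem_nhdsWithin] with x hx hx0
  rw [besselJ_eq hx0]
  have : (0 : ℝ) < x := hx0
  positivity

/-! ### Laplace integrals and the Hankel function -/

theorem one_add_mul_I_mem_slitPlane (v : ℝ) : (1 + v / 2 * Complex.I : ℂ) ∈ Complex.slitPlane := by
  left; simp

theorem one_le_norm_one_add_mul_I (v : ℝ) : 1 ≤ ‖(1 + v / 2 * Complex.I : ℂ)‖ := by
  have := Complex.abs_re_le_norm (1 + v / 2 * Complex.I : ℂ)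
  simpa using this

theorem norm_one_add_mul_I_le {v : ℝ} (hv : 0 ≤ v) : ‖(1 + v / 2 * Complex.I : ℂ)‖ ≤ 1 + v := by
  refine (norm_add_le _ _).trans ?_
  simp only [norm_one, norm_mul, Complex.norm_I, mul_one]
  rw [show (v / 2 : ℂ) = ((v / 2 : ℝ) : ℂ) by push_cast; ring, Complex.norm_real,
    Real.norm_of_nonneg (by positivity)]
  linarith

theorem norm_cpow_one_add_mul_I_le {a : ℝ} {N : ℕ} (haN : a ≤ N) {v : ℝ} (hv : 0 ≤ v) :
    ‖(1 + v / 2 * Complex.I : ℂ) ^ (a : ℂ)‖ ≤ (1 + v) ^ N := by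
  rw [Complex.norm_cpow_real]
  calc _ ≤ ‖(1 + v / 2 * Complex.I : ℂ)‖ ^ (N : ℝ) :=
        Real.rpow_le_rpow_of_exponent_le (one_le_norm_one_add_mul_I v) haN
    _ ≤ (1 + v) ^ (N : ℝ) :=
        Real.rpow_le_rpow (norm_nonneg _) (norm_one_add_mul_I_le hv) (by positivity)
    _ = (1 + v) ^ N := Real.rpow_natCast _ _

/-- The factor e^(εv) can be absorbed into e^(-xv). The constant is uniform in a ≤ N because the
order is later varied under the integral sign. -/
theorem exists_norm_cpow_le_exp (N : ℕ) {ε : ℝ} (hε : 0 < ε) :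
    ∃ C : ℝ, 0 < C ∧ ∀ a : ℝ, a ≤ N → ∀ v : ℝ, 0 ≤ v →
      ‖(1 + v / 2 * Complex.I : ℂ) ^ (a : ℂ)‖ ≤ C * Real.exp (ε * v) := by
  refine ⟨N ! / ε ^ N * Real.exp ε, by positivity, fun a ha v hv => ?_⟩
  refine (norm_cpow_one_add_mul_I_le ha hv).trans ?_
  have h := Real.pow_div_factorial_le_exp (ε * (1 + v)) (by positivity) N
  rw [mul_pow, div_le_iff₀ (by positivity)] at h
  have e : Real.exp (ε * (1 + v)) = Real.exp ε * Real.exp (ε * v) := by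
    rw [← Real.exp_add]; ring_nf
  rw [e] at h
  calc (1 + v) ^ N = (ε ^ N * (1 + v) ^ N) / ε ^ N := by field_simp
    _ ≤ (Real.exp ε * Real.exp (ε * v) * N !) / ε ^ N := by gcongr
    _ = _ := by ring

/-- The integrand `e^{-xv} v^b (1 + iv/2)^a`. -/
noncomputable def laplaceIntegrand (a b x v : ℝ) : ℂ :=
  ((Real.exp (-(x * v)) * v ^ b : ℝ) : ℂ) * (1 + v / 2 * Complex.I : ℂ) ^ (a : ℂ)

/-- The Laplace integral `∫_0^∞ e^{-xv} v^b (1 + iv/2)^a dv`. -/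
noncomputable def laplaceInt (a b x : ℝ) : ℂ := ∫ v in Ioi (0 : ℝ), laplaceIntegrand a b x v

theorem continuous_cpow_one_add_mul_I (a : ℝ) :
    Continuous fun v : ℝ => (1 + v / 2 * Complex.I : ℂ) ^ (a : ℂ) :=
  Continuous.cpow (by fun_prop) continuous_const fun v => one_add_mul_I_mem_slitPlane v

theorem aestronglyMeasurable_laplaceIntegrand (a b x : ℝ) :
    AEStronglyMeasurable (laplaceIntegrand a b x) (volume.restrict (Ioi 0)) := by
  apply Measurable.aestronglyMeasurable
  unfold laplaceIntegrand
  refine Measurable.mul ?_ (continuous_cpow_one_add_mul_I a).measurable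
  fun_prop

theorem integrableOn_exp_neg_mul_rpow {b c : ℝ} (hb : -1 < b) (hc : 0 < c) :
    IntegrableOn (fun v : ℝ => Real.exp (-(c * v)) * v ^ b) (Ioi 0) := by
  have := integrableOn_rpow_mul_exp_neg_mul_rpow hb zero_lt_one hc
  refine this.congr_fun (fun v _ => ?_) measurableSet_Ioi
  simp [mul_comm]

theorem norm_laplaceIntegrand_le {N : ℕ} {ε C : ℝ}
    (hC : ∀ a : ℝ, a ≤ N → ∀ v : ℝ, 0 ≤ v →
      ‖(1 + v / 2 * Complex.I : ℂ) ^ (a : ℂ)‖ ≤ C * Real.exp (ε * v))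
    {a b x y v : ℝ} (ha : a ≤ N) (hx : y + ε ≤ x) (hv : 0 ≤ v) :
    ‖laplaceIntegrand a b x v‖ ≤ C * (Real.exp (-(y * v)) * v ^ b) := by
  have hvb : 0 ≤ v ^ b := Real.rpow_nonneg hv b
  unfold laplaceIntegrand
  rw [norm_mul, Complex.norm_real, Real.norm_of_nonneg (by positivity)]
  have h1 := hC a ha v hv
  calc _ ≤ Real.exp (-(x * v)) * v ^ b * (C * Real.exp (ε * v)) := by gcongr
    _ = C * (Real.exp (-(x * v) + ε * v) * v ^ b) := by rw [Real.exp_add]; ring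
    _ ≤ _ := by
      have : 0 ≤ C := by
        have := (norm_nonneg _).trans (hC a ha 0 le_rfl)
        simpa using this
      gcongr
      nlinarith

theorem integrableOn_laplaceIntegrand (a : ℝ) {b x : ℝ} (hb : -1 < b) (hx : 0 < x) :
    IntegrableOn (laplaceIntegrand a b x) (Ioi 0) := by
  obtain ⟨C, -, hC⟩ := exists_norm_cpow_le_exp ⌈a⌉₊ (half_pos hx)
  refine Integrable.mono' ((integrableOn_exp_neg_mul_rpow hb (half_pos hx)).const_mul C)
    (aestronglyMeasurable_laplaceIntegrand a b x) ?_
  filter_upwards [ae_restrict_mem measurableSet_Ioi] with v hv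
  exact norm_laplaceIntegrand_le hC (Nat.le_ceil a) (by linarith) (le_of_lt hv)

theorem hasDerivAt_laplaceInt (a : ℝ) {b x : ℝ} (hb : -1 < b) (hx : 0 < x) :
    HasDerivAt (laplaceInt a b) (-laplaceInt a (b + 1) x) x := by
  obtain ⟨C, -, hC⟩ := exists_norm_cpow_le_exp ⌈a⌉₊ (show 0 < x / 4 by positivity)
  have hx4 : 0 < x / 4 := by positivity
  have := hasDerivAt_integral_of_dominated_loc_of_deriv_le (𝕜 := ℝ)
    (μ := volume.restrict (Ioi (0 : ℝ))) (F := fun y v => laplaceIntegrand a b y v)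
    (F' := fun y v => -laplaceIntegrand a (b + 1) y v)
    (bound := fun v => C * (Real.exp (-(x / 4 * v)) * v ^ (b + 1)))
    (Ioi_mem_nhds (show x / 2 < x by linarith))
    (Eventually.of_forall fun y => aestronglyMeasurable_laplaceIntegrand a b y)
    (integrableOn_laplaceIntegrand a hb hx)
    (aestronglyMeasurable_laplaceIntegrand a (b + 1) x).neg
    (by
      filter_upwards [ae_restrict_mem measurableSet_Ioi] with v hv y hy
      rw [norm_neg]
      refine norm_laplaceIntegrand_le hC (Nat.le_ceil a) ?_ (le_of_lt hv)
      have : x / 2 < y := hy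
      linarith)
    ((integrableOn_exp_neg_mul_rpow (by linarith) hx4).const_mul C)
    (by
      filter_upwards [ae_restrict_mem measurableSet_Ioi] with v hv y _
      have hv0 : (0 : ℝ) < v := hv
      unfold laplaceIntegrand
      have d : HasDerivAt (fun y : ℝ => Real.exp (-(y * v)) * v ^ b)
          (Real.exp (-(y * v)) * (-(1 * v)) * v ^ b) y :=
        (((hasDerivAt_id y).mul_const v).neg.exp).mul_const _
      refine (d.ofReal_comp.mul_const _).congr_deriv ?_
      rw [Real.rpow_add hv0, Real.rpow_one]
      push_cast
      ring)
  have h2 := this.2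
  rw [integral_neg] at h2
  exact h2

theorem laplaceInt_add_one_left (a : ℝ) {b x : ℝ} (hb : -1 < b) (hx : 0 < x) :
    laplaceInt (a + 1) b x = laplaceInt a b x + Complex.I / 2 * laplaceInt a (b + 1) x := by
  unfold laplaceInt
  rw [← integral_const_mul, ← integral_add (integrableOn_laplaceIntegrand a hb hx)
    ((integrableOn_laplaceIntegrand a (by linarith) hx).const_mul _)]
  refine setIntegral_congr_fun measurableSet_Ioi fun v hv => ?_
  have hv0 : (0 : ℝ) < v := hv
  have h0 : (1 + v / 2 * Complex.I : ℂ) ≠ 0 :=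
    Complex.slitPlane_ne_zero (one_add_mul_I_mem_slitPlane v)
  simp only [laplaceIntegrand]
  rw [Complex.ofReal_add, Complex.cpow_add _ _ h0, Real.rpow_add hv0, Real.rpow_one]
  push_cast
  rw [Complex.cpow_one]
  ring

theorem hasDerivAt_cpow_one_add_mul_I (a v : ℝ) :
    HasDerivAt (fun v : ℝ => (1 + v / 2 * Complex.I : ℂ) ^ (a : ℂ))
      (a * (Complex.I / 2) * (1 + v / 2 * Complex.I : ℂ) ^ ((a - 1 : ℝ) : ℂ)) v := by
  have d1 : HasDerivAt (fun z : ℂ => 1 + z / 2 * Complex.I) (1 / 2 * Complex.I) (v : ℂ) :=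
    (((hasDerivAt_id (v : ℂ)).div_const 2).mul_const _).const_add _
  have d2 := (d1.cpow_const (c := (a : ℂ)) (one_add_mul_I_mem_slitPlane v)).comp_ofReal
  refine d2.congr_deriv ?_
  push_cast
  ring

theorem laplaceInt_by_parts (a : ℝ) {b x : ℝ} (hb : 0 < b) (hx : 0 < x) :
    x * laplaceInt a b x =
      b * laplaceInt a (b - 1) x + a * (Complex.I / 2) * laplaceInt (a - 1) b x := by
  have i1 := (integrableOn_laplaceIntegrand a (b := b) (by linarith) hx).const_mul (-(x : ℂ))
  have i2 := (integrableOn_laplaceIntegrand a (b := b - 1) (by linarith) hx).const_mul (b : ℂ)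
  have i3 := (integrableOn_laplaceIntegrand (a - 1) (b := b) (by linarith) hx).const_mul
    (a * (Complex.I / 2) : ℂ)
  have hd : ∀ v ∈ Ioi (0 : ℝ), HasDerivAt (laplaceIntegrand a b x)
      (-(x : ℂ) * laplaceIntegrand a b x v + b * laplaceIntegrand a (b - 1) x v +
        a * (Complex.I / 2) * laplaceIntegrand (a - 1) b x v) v := by
    intro v hv
    have hv0 : (0 : ℝ) < v := hv
    have d1 : HasDerivAt (fun v : ℝ => Real.exp (-(x * v)) * v ^ b)
        (Real.exp (-(x * v)) * (-(x * 1)) * v ^ b +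
          Real.exp (-(x * v)) * (b * v ^ (b - 1))) v :=
      (((hasDerivAt_id v).const_mul x).neg.exp).mul (Real.hasDerivAt_rpow_const (Or.inl hv0.ne'))
    refine (d1.ofReal_comp.mul (hasDerivAt_cpow_one_add_mul_I a v)).congr_deriv ?_
    unfold laplaceIntegrand
    push_cast
    ring
  have hc : ContinuousWithinAt (laplaceIntegrand a b x) (Ici 0) 0 := by
    apply Continuous.continuousWithinAt
    unfold laplaceIntegrand
    refine Continuous.mul ?_ (continuous_cpow_one_add_mul_I a)
    refine Complex.continuous_ofReal.comp ?_
    exact (by fun_prop : Continuous fun v : ℝ => Real.exp (-(x * v))).mul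
      (Real.continuous_rpow_const hb.le)
  have ht : Tendsto (laplaceIntegrand a b x) atTop (𝓝 0) := by
    obtain ⟨C, -, hC⟩ := exists_norm_cpow_le_exp ⌈a⌉₊ (half_pos hx)
    rw [tendsto_zero_iff_norm_tendsto_zero]
    have h0 : Tendsto (fun v : ℝ => C * (Real.exp (-(x / 2 * v)) * v ^ b)) atTop (𝓝 0) := by
      have := (tendsto_rpow_mul_exp_neg_mul_atTop_nhds_zero b (x / 2) (half_pos hx)).const_mul C
      simpa [mul_comm] using this
    refine squeeze_zero' (Eventually.of_forall fun v => norm_nonneg _) ?_ h0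
    filter_upwards [eventually_ge_atTop 0] with v hv
    exact norm_laplaceIntegrand_le hC (Nat.le_ceil a) (by linarith) hv
  have := integral_Ioi_of_hasDerivAt_of_tendsto hc hd ((i1.add i2).add i3) ht
  have h00 : laplaceIntegrand a b x 0 = 0 := by simp [laplaceIntegrand, Real.zero_rpow hb.ne']
  rw [h00, sub_zero] at this
  have e : ∫ v in Ioi (0 : ℝ), (-(x : ℂ) * laplaceIntegrand a b x v +
      b * laplaceIntegrand a (b - 1) x v +
        a * (Complex.I / 2) * laplaceIntegrand (a - 1) b x v) =
      -(x : ℂ) * laplaceInt a b x + b * laplaceInt a (b - 1) x +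
        a * (Complex.I / 2) * laplaceInt (a - 1) b x := by
    have i12 : IntegrableOn (fun v => -(x : ℂ) * laplaceIntegrand a b x v +
      b * laplaceIntegrand a (b - 1) x v) (Ioi 0) := i1.add i2
    rw [integral_add i12 i3, integral_add i1 i2]
    simp only [integral_const_mul]
    rfl
  rw [e] at this
  linear_combination -this

/-- Integration by parts with both exponents equal to a + 1. This single identity carries both
Bessel's equation and the order-raising relation for the Hankel function. -/
theorem laplaceInt_relation {a x : ℝ} (ha : -1 < a) (hx : 0 < x) :
    x * (laplaceInt a (a + 1) x + Complex.I / 2 * laplaceInt a (a + 2) x) =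
      (a + 1) * (laplaceInt a a x + Complex.I * laplaceInt a (a + 1) x) := by
  have h1 := laplaceInt_by_parts (a + 1) (b := a + 1) (by linarith) hx
  rw [laplaceInt_add_one_left a (by linarith) hx, add_sub_cancel_right,
    laplaceInt_add_one_left a ha hx, show a + 1 + 1 = a + 2 by ring] at h1
  push_cast at h1
  linear_combination h1

/-- The normalising constant of the Hankel function. -/
noncomputable def hankelConst (s : ℝ) : ℂ :=
  ((√(2 / Real.pi) / Real.Gamma (s + 1 / 2) : ℝ) : ℂ) *
    Complex.exp (-((s * Real.pi / 2 + Real.pi / 4 : ℝ) : ℂ) * Complex.I)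

/-- The Hankel function `H_s(x)`, `x > 0`, of order `s > -1/2`. -/
noncomputable def hankelH (s x : ℝ) : ℂ :=
  hankelConst s * ((x ^ s : ℝ) : ℂ) * Complex.exp (x * Complex.I) *
    laplaceInt (s - 1 / 2) (s - 1 / 2) x

/-- The derivative of `hankelH s`. -/
noncomputable def hankelD (s x : ℝ) : ℂ :=
  (s / x + Complex.I) * hankelH s x - hankelConst s * ((x ^ s : ℝ) : ℂ) *
    Complex.exp (x * Complex.I) * laplaceInt (s - 1 / 2) (s + 1 / 2) x

theorem hasDerivAt_hankel_aux (s : ℝ) {a b x : ℝ} (hb : -1 < b) (hx : 0 < x) :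
    HasDerivAt (fun x : ℝ => hankelConst s * ((x ^ s : ℝ) : ℂ) * Complex.exp (x * Complex.I) *
      laplaceInt a b x)
      ((s / x + Complex.I) * (hankelConst s * ((x ^ s : ℝ) : ℂ) * Complex.exp (x * Complex.I) *
        laplaceInt a b x) - hankelConst s * ((x ^ s : ℝ) : ℂ) * Complex.exp (x * Complex.I) *
        laplaceInt a (b + 1) x) x := by
  have d1 : HasDerivAt (fun x : ℝ => ((x ^ s : ℝ) : ℂ)) ((s * x ^ (s - 1) : ℝ) : ℂ) x :=
    (Real.hasDerivAt_rpow_const (Or.inl hx.ne')).ofReal_comp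
  have d2 : HasDerivAt (fun x : ℝ => Complex.exp (x * Complex.I))
      (Complex.exp (x * Complex.I) * (1 * Complex.I)) x :=
    ((hasDerivAt_id (x : ℂ)).mul_const Complex.I).cexp.comp_ofReal
  refine (((d1.const_mul (hankelConst s)).fun_mul d2).fun_mul (hasDerivAt_laplaceInt a hb hx)).congr_deriv
    ?_
  rw [Real.rpow_sub hx, Real.rpow_one]
  push_cast
  have : (x : ℂ) ≠ 0 := by exact_mod_cast hx.ne'
  field_simp
  ring

theorem hasDerivAt_hankelH {s x : ℝ} (hs : -(1 / 2) < s) (hx : 0 < x) :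
    HasDerivAt (hankelH s) (hankelD s x) x := by
  have := hasDerivAt_hankel_aux s (a := s - 1 / 2) (b := s - 1 / 2) (by linarith) hx
  rw [show s - 1 / 2 + 1 = s + 1 / 2 by ring] at this
  exact this

/-- Once the common factors are removed, this is `laplaceInt_relation`. It is Bessel's equation in
self-adjoint form, for which x times the Wronskian of two solutions is constant. -/
theorem hasDerivAt_mul_hankelD {s x : ℝ} (hs : -(1 / 2) < s) (hx : 0 < x) :
    HasDerivAt (fun x : ℝ => x * hankelD s x) ((s ^ 2 - x ^ 2) / x * hankelH s x) x := by
  have d0 := hasDerivAt_hankelH hs hx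
  have d1 := hasDerivAt_hankel_aux s (a := s - 1 / 2) (b := s + 1 / 2) (by linarith) hx
  have dx : HasDerivAt (fun x : ℝ => (x : ℂ)) 1 x := (hasDerivAt_id x).ofReal_comp
  have hx0 : (x : ℂ) ≠ 0 := by exact_mod_cast hx.ne'
  have e : (fun x : ℝ => x * hankelD s x) =ᶠ[𝓝 x] fun x : ℝ =>
      (s + x * Complex.I) * hankelH s x - x * (hankelConst s * ((x ^ s : ℝ) : ℂ) *
    Complex.exp (x * Complex.I) * laplaceInt (s - 1 / 2) (s + 1 / 2) x) := by
    filter_upwards [lt_mem_nhds hx] with y hy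
    have hy0 : (y : ℂ) ≠ 0 := by exact_mod_cast hy.ne'
    unfold hankelD
    field_simp
  refine HasDerivAt.congr_of_eventuallyEq ?_ e
  refine ((((dx.mul_const Complex.I).const_add (s : ℂ)).mul d0).sub (dx.mul d1)).congr_deriv ?_
  have rel := laplaceInt_relation (a := s - 1 / 2) (by linarith) hx
  rw [show s - 1 / 2 + 1 = s + 1 / 2 by ring, show s - 1 / 2 + 2 = s + 1 / 2 + 1 by ring] at rel
  unfold hankelD hankelH
  push_cast at rel ⊢
  generalize laplaceInt (s - 1 / 2) (s - 1 / 2) x = A at *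
  generalize laplaceInt (s - 1 / 2) (s + 1 / 2) x = B at *
  generalize laplaceInt (s - 1 / 2) (s + 1 / 2 + 1) x = D at *
  generalize Complex.exp (x * Complex.I) = E at *
  generalize ((x ^ s : ℝ) : ℂ) = X at *
  have hI : Complex.I ^ 2 = -1 := Complex.I_sq
  field_simp
  linear_combination (-2 * Complex.I * hankelConst s * X * E * x) * rel +
    (hankelConst s * X * E * (A * x ^ 2 - 2 * x * s * B - x * B + x ^ 2 * D)) * hI

theorem hankelConst_add_one {s : ℝ} (hs : -(1 / 2) < s) :
    hankelConst (s + 1) * (s + 1 / 2) = -Complex.I * hankelConst s := by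
  unfold hankelConst
  have h : Real.Gamma (s + 1 + 1 / 2) = (s + 1 / 2) * Real.Gamma (s + 1 / 2) := by
    rw [← Real.Gamma_add_one (by linarith)]; ring_nf
  have h0 : (s + 1 / 2 : ℂ) ≠ 0 := by
    have : ((s + 1 / 2 : ℝ) : ℂ) ≠ 0 := Complex.ofReal_ne_zero.mpr (by linarith)
    simpa using this
  have e : Complex.exp (-(((s + 1) * Real.pi / 2 + Real.pi / 4 : ℝ) : ℂ) * Complex.I) =
      -Complex.I * Complex.exp (-((s * Real.pi / 2 + Real.pi / 4 : ℝ) : ℂ) * Complex.I) := by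
    rw [← Complex.exp_neg_pi_div_two_mul_I, ← Complex.exp_add]
    congr 1; push_cast; ring
  rw [h, e]
  have h1 : (Real.Gamma (s + 1 / 2) : ℂ) ≠ 0 := by
    exact_mod_cast (Real.Gamma_pos_of_pos (by linarith)).ne'
  push_cast
  generalize (Real.Gamma (s + 1 / 2) : ℂ) = G at *
  generalize (s + 1 / 2 : ℂ) = c at *
  field_simp

theorem hankelH_add_one {s x : ℝ} (hs : -(1 / 2) < s) (hx : 0 < x) :
    hankelH (s + 1) x = s / x * hankelH s x - hankelD s x := by
  have rel := laplaceInt_relation (a := s - 1 / 2) (by linarith) hx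
  have hx0 : (x : ℂ) ≠ 0 := by exact_mod_cast hx.ne'
  have hC := hankelConst_add_one hs
  have h0 : (s + 1 / 2 : ℂ) ≠ 0 := by
    have : ((s + 1 / 2 : ℝ) : ℂ) ≠ 0 := Complex.ofReal_ne_zero.mpr (by linarith)
    simpa using this
  have e : laplaceInt (s + 1 - 1 / 2) (s + 1 - 1 / 2) x = laplaceInt (s - 1 / 2) (s + 1 / 2) x +
      Complex.I / 2 * laplaceInt (s - 1 / 2) (s + 1 / 2 + 1) x := by
    rw [← laplaceInt_add_one_left _ (by linarith) hx]; ring_nf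
  rw [show s - 1 / 2 + 1 = s + 1 / 2 by ring, show s - 1 / 2 + 2 = s + 1 / 2 + 1 by ring,
    ← e] at rel
  push_cast at rel
  unfold hankelD hankelH
  rw [Real.rpow_add hx, Real.rpow_one]
  push_cast
  set A := laplaceInt (s - 1 / 2) (s - 1 / 2) x
  set B := laplaceInt (s - 1 / 2) (s + 1 / 2) x
  have rel' : (x : ℂ) * laplaceInt (s + 1 - 1 / 2) (s + 1 - 1 / 2) x =
      (s + 1 / 2) * (A + Complex.I * B) := by linear_combination rel
  have hI : Complex.I ^ 2 = -1 := Complex.I_sq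
  linear_combination (hankelConst (s + 1) * ((x ^ s : ℝ) : ℂ) * Complex.exp (x * Complex.I)) * rel'
    + ((x ^ s : ℝ) : ℂ) * Complex.exp (x * Complex.I) * (A + Complex.I * B) * hC
    - hankelConst s * ((x ^ s : ℝ) : ℂ) * Complex.exp (x * Complex.I) * B * hI

/-- Needed because Y of integer order is defined as a limit in the order. -/
theorem continuousAt_hankelH_order {s x : ℝ} (hs : -(1 / 2) < s) (hx : 0 < x) :
    ContinuousAt (fun s => hankelH s x) s := by
  have hG : ContinuousAt (fun s : ℝ => Real.Gamma (s + 1 / 2)) s := by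
    refine ContinuousAt.comp (f := fun s : ℝ => s + 1 / 2) (g := Real.Gamma) ?_ (by fun_prop)
    refine (Real.differentiableAt_Gamma fun m => ?_).continuousAt
    have : (0 : ℝ) ≤ m := by positivity
    linarith
  have hG0 : Real.Gamma (s + 1 / 2) ≠ 0 := (Real.Gamma_pos_of_pos (by linarith)).ne'
  have h1 : ContinuousAt hankelConst s := by
    unfold hankelConst
    refine ContinuousAt.mul ?_ (by fun_prop)
    exact Complex.continuous_ofReal.continuousAt.comp (continuousAt_const.div hG hG0)
  have h2 : ContinuousAt (fun s : ℝ => ((x ^ s : ℝ) : ℂ)) s :=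
    Complex.continuous_ofReal.continuousAt.comp (Real.continuousAt_const_rpow hx.ne')
  have h3 : ContinuousAt (fun s : ℝ => laplaceInt (s - 1 / 2) (s - 1 / 2) x) s := by
    -- Half the distance from s to −1/2, so that every order within d of s gives an exponent above
    -- −1. The sum of the two extreme powers dominates v^(t − 1/2): the lower one for v ≤ 1, the
    -- upper one for v ≥ 1.
    set d : ℝ := (s + 1 / 2) / 2
    have hd : 0 < d := by simp only [d]; linarith
    obtain ⟨C, hC0, hC⟩ := exists_norm_cpow_le_exp ⌈s + d - 1 / 2⌉₊ (half_pos hx)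
    have hb1 := (integrableOn_exp_neg_mul_rpow (b := s - d - 1 / 2) (by simp only [d]; linarith)
      (half_pos hx)).const_mul C
    have hb2 := (integrableOn_exp_neg_mul_rpow (b := s + d - 1 / 2) (by simp only [d]; linarith)
      (half_pos hx)).const_mul C
    refine continuousAt_of_dominated (Eventually.of_forall fun t =>
      aestronglyMeasurable_laplaceIntegrand _ _ x) ?_ (hb1.add hb2) ?_
    · filter_upwards [Ioo_mem_nhds (show s - d < s by linarith) (show s < s + d by linarith)]
        with t ht
      filter_upwards [ae_restrict_mem measurableSet_Ioi] with v hv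
      have hv0 : (0 : ℝ) < v := hv
      refine (norm_laplaceIntegrand_le hC (y := x / 2)
        (le_trans (by linarith [ht.2]) (Nat.le_ceil _)) (by linarith) hv0.le).trans ?_
      simp only [Pi.add_apply]
      rw [← mul_add, ← mul_add]
      gcongr
      rcases le_total v 1 with h | h
      · have := Real.rpow_le_rpow_of_exponent_ge hv0 h (show s - d - 1 / 2 ≤ t - 1 / 2 by
          linarith [ht.1])
        have := Real.rpow_nonneg hv0.le (s + d - 1 / 2)
        linarith
      · have := Real.rpow_le_rpow_of_exponent_le h (show t - 1 / 2 ≤ s + d - 1 / 2 by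
          linarith [ht.2])
        have := Real.rpow_nonneg hv0.le (s - d - 1 / 2)
        linarith
    · filter_upwards [ae_restrict_mem measurableSet_Ioi] with v hv
      have hv0 : (0 : ℝ) < v := hv
      unfold laplaceIntegrand
      refine ContinuousAt.mul (Complex.continuous_ofReal.continuousAt.comp
        (continuousAt_const.mul ?_)) ?_
      · exact (Real.continuousAt_const_rpow hv0.ne').comp (f := fun t : ℝ => t - 1 / 2)
          (by fun_prop)
      · exact ContinuousAt.const_cpow (by fun_prop)
          (Or.inl (Complex.slitPlane_ne_zero (one_add_mul_I_mem_slitPlane v)))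
  unfold hankelH
  exact ((h1.mul h2).mul continuousAt_const).mul h3

/-! ### Complete asymptotic expansion of the Laplace integrals (Watson's lemma) -/

/-- The generalized binomial coefficient `a choose k`. -/
noncomputable def binomCoeff : ℕ → ℝ → ℝ
  | 0 => fun _ => 1
  | k + 1 => fun a => a / ((k : ℝ) + 1) * binomCoeff k (a - 1)

/-- The Taylor polynomial with `N` terms of `(1 + iv/2)^a`. -/
noncomputable def binomTaylor (N : ℕ) (a v : ℝ) : ℂ :=
  ∑ k ∈ Finset.range N, (binomCoeff k a : ℂ) * (v / 2 * Complex.I) ^ k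

theorem hasDerivAt_binomTaylor_succ (N : ℕ) (a v : ℝ) :
    HasDerivAt (binomTaylor (N + 1) a) (a * (Complex.I / 2) * binomTaylor N (a - 1) v) v := by
  have d0 : ∀ k : ℕ, HasDerivAt (fun v : ℝ => (binomCoeff k a : ℂ) * (v / 2 * Complex.I) ^ k)
      ((binomCoeff k a : ℂ) * (k * (v / 2 * Complex.I) ^ (k - 1) * (1 / 2 * Complex.I))) v := by
    intro k
    have d1 : HasDerivAt (fun z : ℂ => (z / 2 * Complex.I)) (1 / 2 * Complex.I) (v : ℂ) :=
      ((hasDerivAt_id (v : ℂ)).div_const 2).mul_const _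
    exact ((d1.fun_pow k).const_mul _).comp_ofReal
  have h := HasDerivAt.fun_sum (u := Finset.range (N + 1)) fun k _ => d0 k
  refine h.congr_deriv ?_
  rw [Finset.sum_range_succ', binomTaylor, Finset.mul_sum]
  simp only [Nat.cast_zero, zero_mul, mul_zero, add_zero, Nat.add_sub_cancel]
  refine Finset.sum_congr rfl fun k _ => ?_
  simp only [binomCoeff]
  have : ((k : ℂ) + 1) ≠ 0 := by exact_mod_cast Nat.succ_ne_zero k
  push_cast
  field_simp

/-- Differentiation turns the remainder for (N + 1, a) into a multiple of the one for (N, a − 1),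
and at N = 0 the power is bounded by 1 since a ≤ 0. The condition a ≤ N thus yields a bound on the
whole half-line, not only near 0. -/
theorem exists_norm_cpow_sub_binomTaylor_le (N : ℕ) : ∀ a : ℝ, a ≤ N → ∃ C : ℝ, 0 ≤ C ∧
    ∀ v : ℝ, 0 ≤ v → ‖(1 + v / 2 * Complex.I : ℂ) ^ (a : ℂ) - binomTaylor N a v‖ ≤ C * v ^ N := by
  induction N with
  | zero =>
    intro a ha
    refine ⟨1, zero_le_one, fun v hv => ?_⟩
    have := norm_cpow_one_add_mul_I_le ha hv
    simpa [binomTaylor] using this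
  | succ N ih =>
    intro a ha
    push_cast at ha
    obtain ⟨C, hC0, hC⟩ := ih (a - 1) (by linarith)
    refine ⟨|a| * C, by positivity, fun v hv => ?_⟩
    have hd : ∀ t : ℝ, HasDerivAt
        (fun v : ℝ => (1 + v / 2 * Complex.I : ℂ) ^ (a : ℂ) - binomTaylor (N + 1) a v)
        (a * (Complex.I / 2) * ((1 + t / 2 * Complex.I : ℂ) ^ ((a - 1 : ℝ) : ℂ) -
          binomTaylor N (a - 1) t)) t := by
      intro t
      refine ((hasDerivAt_cpow_one_add_mul_I a t).sub
        (hasDerivAt_binomTaylor_succ N a t)).congr_deriv ?_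
      ring
    have key := norm_image_sub_le_of_norm_deriv_le_segment' (a := 0) (b := v)
      (C := |a| * C * v ^ N) (fun t _ => (hd t).hasDerivWithinAt)
      (fun t ht => by
        rw [norm_mul, norm_mul, Complex.norm_real, Real.norm_eq_abs, norm_div, Complex.norm_I]
        have h1 := hC t ht.1
        have h2 : t ^ N ≤ v ^ N := pow_le_pow_left₀ ht.1 ht.2.le N
        calc |a| * (1 / ‖(2 : ℂ)‖) * ‖(1 + t / 2 * Complex.I : ℂ) ^ ((a - 1 : ℝ) : ℂ) -
          binomTaylor N (a - 1) t‖ ≤ |a| * 1 * (C * v ^ N) := by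
              gcongr
              · norm_num
              · exact h1.trans (by gcongr)
          _ = _ := by ring) v ⟨hv, le_rfl⟩
    have h0 : ((1 + ((0 : ℝ) : ℂ) / 2 * Complex.I : ℂ) ^ (a : ℂ) -
        binomTaylor (N + 1) a 0) = 0 := by
      simp [binomTaylor, Finset.sum_range_succ', binomCoeff]
    rw [h0, sub_zero, sub_zero] at key
    rw [pow_succ, ← mul_assoc]
    exact key

/-- The coefficients in the expansion of `x^{b+1} ∫_0^∞ e^{-xv} v^b (1+iv/2)^a dv`. -/
noncomputable def laplaceCoeff (a b : ℝ) (k : ℕ) : ℝ :=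
  binomCoeff k a * Real.Gamma (b + k + 1) / 2 ^ k

theorem integral_exp_neg_mul_mul_rpow {b x : ℝ} (hb : -1 < b) (hx : 0 < x) :
    ∫ v in Ioi (0 : ℝ), Real.exp (-(x * v)) * v ^ b = Real.Gamma (b + 1) * x ^ (-(b + 1)) := by
  have := Real.integral_rpow_mul_exp_neg_mul_Ioi (a := b + 1) (r := x) (by linarith) hx
  rw [add_sub_cancel_right] at this
  rw [Real.rpow_neg hx.le, ← Real.inv_rpow hx.le, ← one_div, mul_comm, ← this]
  congr 1; ext v; ring

theorem norm_laplaceInt_sub_le {a b : ℝ} (hb : -1 < b) {N : ℕ} (hN : a ≤ N) :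
    ∃ C : ℝ, ∀ x : ℝ, 0 < x → ‖((x ^ (b + 1) : ℝ) : ℂ) * laplaceInt a b x -
      ∑ k ∈ Finset.range N, (laplaceCoeff a b k : ℂ) * (Complex.I / x) ^ k‖ ≤ C * (x⁻¹) ^ N := by
  obtain ⟨C, hC0, hC⟩ := exists_norm_cpow_sub_binomTaylor_le N a hN
  refine ⟨C * Real.Gamma (b + N + 1), fun x hx => ?_⟩
  have hx0 : (x : ℂ) ≠ 0 := by exact_mod_cast hx.ne'
  have hbk : ∀ k : ℕ, -1 < b + k := fun k => by
    have : (0 : ℝ) ≤ k := by positivity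
    linarith
  have hterm : ∀ k : ℕ, ∀ v ∈ Ioi (0 : ℝ),
      ((Real.exp (-(x * v)) * v ^ b : ℝ) : ℂ) * ((binomCoeff k a : ℂ) * (v / 2 * Complex.I) ^ k) =
      ((Real.exp (-(x * v)) * v ^ (b + k) : ℝ) : ℂ) *
        ((binomCoeff k a : ℂ) * (Complex.I / 2) ^ k) := by
    intro k v hv
    have hv0 : (0 : ℝ) < v := hv
    rw [Real.rpow_add_natCast hv0.ne']
    push_cast
    rw [show (v / 2 * Complex.I : ℂ) = v * (Complex.I / 2) by ring, mul_pow]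
    ring
  have hint : ∀ k : ℕ, IntegrableOn (fun v : ℝ => ((Real.exp (-(x * v)) * v ^ b : ℝ) : ℂ) *
      ((binomCoeff k a : ℂ) * (v / 2 * Complex.I) ^ k)) (Ioi 0) := by
    intro k
    refine IntegrableOn.congr_fun ?_ (fun v hv => (hterm k v hv).symm) measurableSet_Ioi
    exact (integrableOn_exp_neg_mul_rpow (hbk k) hx).ofReal.mul_const _
  have hval : ∀ k : ℕ, ∫ v in Ioi (0 : ℝ), ((Real.exp (-(x * v)) * v ^ b : ℝ) : ℂ) *
      ((binomCoeff k a : ℂ) * (v / 2 * Complex.I) ^ k) =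
      ((x ^ (-(b + 1)) : ℝ) : ℂ) * ((laplaceCoeff a b k : ℂ) * (Complex.I / x) ^ k) := by
    intro k
    rw [setIntegral_congr_fun measurableSet_Ioi (hterm k), integral_mul_const,
      integral_complex_ofReal, integral_exp_neg_mul_mul_rpow (hbk k) hx, laplaceCoeff,
      show -(b + k + 1) = -(b + 1) - (k : ℝ) by ring, Real.rpow_sub_natCast hx.ne']
    push_cast
    rw [div_pow, div_pow]
    field_simp
  have hpow : ((x ^ (b + 1) : ℝ) : ℂ) * ((x ^ (-(b + 1)) : ℝ) : ℂ) = 1 := by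
    rw [← Complex.ofReal_mul, ← Real.rpow_add hx]; simp
  have hsum : ((x ^ (b + 1) : ℝ) : ℂ) * laplaceInt a b x -
      ∑ k ∈ Finset.range N, (laplaceCoeff a b k : ℂ) * (Complex.I / x) ^ k =
      ((x ^ (b + 1) : ℝ) : ℂ) * ∫ v in Ioi (0 : ℝ), ((Real.exp (-(x * v)) * v ^ b : ℝ) : ℂ) *
        ((1 + v / 2 * Complex.I : ℂ) ^ (a : ℂ) - binomTaylor N a v) := by
    have e : ∫ v in Ioi (0 : ℝ), ((Real.exp (-(x * v)) * v ^ b : ℝ) : ℂ) *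
        ((1 + v / 2 * Complex.I : ℂ) ^ (a : ℂ) - binomTaylor N a v) =
        laplaceInt a b x - ((x ^ (-(b + 1)) : ℝ) : ℂ) *
          ∑ k ∈ Finset.range N, (laplaceCoeff a b k : ℂ) * (Complex.I / x) ^ k := by
      rw [Finset.mul_sum]
      simp_rw [← hval]
      rw [← integral_finsetSum _ fun k _ => hint k, laplaceInt,
        ← integral_sub (integrableOn_laplaceIntegrand a hb hx)
          (integrable_finsetSum _ fun k _ => hint k)]
      refine setIntegral_congr_fun measurableSet_Ioi fun v _ => ?_
      simp only [laplaceIntegrand, binomTaylor]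
      rw [mul_sub, Finset.mul_sum]
    rw [e, mul_sub, ← mul_assoc, hpow, one_mul]
  rw [hsum, norm_mul, Complex.norm_real, Real.norm_of_nonneg (by positivity)]
  have hb2 : ‖∫ v in Ioi (0 : ℝ), ((Real.exp (-(x * v)) * v ^ b : ℝ) : ℂ) *
        ((1 + v / 2 * Complex.I : ℂ) ^ (a : ℂ) - binomTaylor N a v)‖ ≤
      ∫ v in Ioi (0 : ℝ), C * (Real.exp (-(x * v)) * v ^ (b + N)) := by
    refine norm_integral_le_of_norm_le
      ((integrableOn_exp_neg_mul_rpow (hbk N) hx).const_mul C) ?_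
    filter_upwards [ae_restrict_mem measurableSet_Ioi] with v hv
    have hv0 : (0 : ℝ) < v := hv
    rw [norm_mul, Complex.norm_real, Real.norm_of_nonneg (by positivity),
      Real.rpow_add_natCast hv0.ne']
    calc _ ≤ Real.exp (-(x * v)) * v ^ b * (C * v ^ N) := by
          gcongr
          exact hC v hv0.le
      _ = _ := by ring
  rw [integral_const_mul, integral_exp_neg_mul_mul_rpow (hbk N) hx,
    show -(b + N + 1) = -(b + 1) - (N : ℝ) by ring, Real.rpow_sub_natCast hx.ne'] at hb2
  have hpow' : x ^ (b + 1) * x ^ (-(b + 1)) = 1 := by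
    rw [← Real.rpow_add hx]; simp
  calc _ ≤ x ^ (b + 1) * (C * (Real.Gamma (b + N + 1) * (x ^ (-(b + 1)) / x ^ N))) := by gcongr
    _ = C * Real.Gamma (b + N + 1) * (x ^ (b + 1) * x ^ (-(b + 1))) * (x⁻¹) ^ N := by
        rw [inv_pow]; ring
    _ = _ := by rw [hpow', mul_one]

/-- The remainder bound requires at least a terms. For smaller N more terms are taken, and the
surplus ones are themselves of the order of the error. -/
theorem laplaceInt_expansion (a : ℝ) {b : ℝ} (hb : -1 < b) (N : ℕ) :
    (fun x : ℝ => ((x ^ (b + 1) : ℝ) : ℂ) * laplaceInt a b x -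
      ∑ k ∈ Finset.range N, (laplaceCoeff a b k : ℂ) * (Complex.I / x) ^ k)
      =O[atTop] fun x : ℝ => (x⁻¹) ^ N := by
  set M := N + ⌈a⌉₊
  obtain ⟨C, hC⟩ := norm_laplaceInt_sub_le (a := a) hb (N := M)
    ((Nat.le_ceil a).trans (by exact_mod_cast Nat.le_add_left _ _))
  have hle : ∀ k : ℕ, N ≤ k → (fun x : ℝ => (x⁻¹) ^ k) =O[atTop] fun x : ℝ => (x⁻¹) ^ N := by
    intro k hk
    refine IsBigO.of_bound 1 ?_
    filter_upwards [eventually_ge_atTop 1] with x hx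
    have hx0 : 0 < x := by linarith
    rw [Real.norm_of_nonneg (by positivity), Real.norm_of_nonneg (by positivity), one_mul]
    exact pow_le_pow_of_le_one (by positivity) (inv_le_one_of_one_le₀ hx) hk
  have h1 : (fun x : ℝ => ((x ^ (b + 1) : ℝ) : ℂ) * laplaceInt a b x -
      ∑ k ∈ Finset.range M, (laplaceCoeff a b k : ℂ) * (Complex.I / x) ^ k)
      =O[atTop] fun x : ℝ => (x⁻¹) ^ N := by
    refine IsBigO.trans ?_ (hle M (Nat.le_add_right _ _))
    refine IsBigO.of_bound C ?_
    filter_upwards [eventually_gt_atTop 0] with x hx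
    rw [Real.norm_of_nonneg (show 0 ≤ (x⁻¹) ^ M by positivity)]
    exact hC x hx
  have h2 : (fun x : ℝ => ∑ k ∈ Finset.Ico N M, (laplaceCoeff a b k : ℂ) * (Complex.I / x) ^ k)
      =O[atTop] fun x : ℝ => (x⁻¹) ^ N := by
    refine IsBigO.fun_sum fun k hk => ?_
    refine IsBigO.trans ?_ (hle k (Finset.mem_Ico.mp hk).1)
    refine IsBigO.of_bound |laplaceCoeff a b k| ?_
    filter_upwards with x
    simp [inv_pow]
  refine (h1.add h2).congr_left fun x => ?_
  rw [← Finset.sum_range_add_sum_Ico _ (Nat.le_add_right N ⌈a⌉₊)]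
  ring

/-! ### Poisson's integral and its contour deformation -/

/-- The even moments of the weight `(1 - t^2)^a` on `[-1, 1]`. -/
noncomputable def gegenbauerMoment (a : ℝ) (m : ℕ) : ℝ :=
  ∫ t in (-1 : ℝ)..1, t ^ (2 * m) * (1 - t ^ 2) ^ a

theorem continuous_one_sub_sq_rpow {a : ℝ} (ha : 0 ≤ a) :
    Continuous fun t : ℝ => (1 - t ^ 2) ^ a :=
  (Real.continuous_rpow_const ha).comp (by fun_prop)

/-- Integrates the derivative of t^(2m+1) (1 − t²)^(a+1), which vanishes at both ends. -/
theorem gegenbauerMoment_succ {a : ℝ} (ha : 0 < a) (m : ℕ) :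
    gegenbauerMoment a (m + 1) * (2 * m + 2 * a + 3) = (2 * m + 1) * gegenbauerMoment a m := by
  have hd : ∀ t : ℝ, HasDerivAt (fun t : ℝ => t ^ (2 * m + 1) * (1 - t ^ 2) ^ (a + 1))
      ((2 * m + 1) * (t ^ (2 * m) * (1 - t ^ 2) ^ a) -
        (2 * m + 2 * a + 3) * (t ^ (2 * (m + 1)) * (1 - t ^ 2) ^ a)) t := by
    intro t
    have d1 : HasDerivAt (fun t : ℝ => 1 - t ^ 2) (-(2 * t)) t := by
      simpa using (hasDerivAt_pow 2 t).const_sub 1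
    have d2 := d1.rpow_const (p := a + 1) (Or.inr (by linarith))
    have d3 := hasDerivAt_pow (2 * m + 1) t
    refine (d3.mul d2).congr_deriv ?_
    have h : (1 - t ^ 2) ^ (a + 1) = (1 - t ^ 2) ^ a * (1 - t ^ 2) := by
      by_cases h0 : 1 - t ^ 2 = 0
      · rw [h0, Real.zero_rpow (by linarith), mul_zero]
      · rw [Real.rpow_add_one h0]
    rw [h, add_sub_cancel_right]
    push_cast
    ring
  have c0 : ∀ k : ℕ, Continuous fun t : ℝ => t ^ k * (1 - t ^ 2) ^ a := fun k =>
    (continuous_pow k).mul (continuous_one_sub_sq_rpow ha.le)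
  have i0 : ∀ (c : ℝ) (k : ℕ), IntervalIntegrable (fun t : ℝ => c * (t ^ k * (1 - t ^ 2) ^ a))
      volume (-1) 1 := fun c k => (continuous_const.mul (c0 k)).intervalIntegrable _ _
  have := intervalIntegral.integral_eq_sub_of_hasDerivAt (a := -1) (b := 1) (fun t _ => hd t)
    ((i0 _ _).sub (i0 _ _))
  rw [intervalIntegral.integral_sub (i0 _ _) (i0 _ _),
    intervalIntegral.integral_const_mul, intervalIntegral.integral_const_mul] at this
  have hz : (0 : ℝ) ^ (a + 1) = 0 := Real.zero_rpow (by linarith)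
  norm_num [hz] at this
  unfold gegenbauerMoment
  linarith

/-- The substitution t = 2u − 1 gives the Beta integral B(a + 1, a + 1), and the duplication formula
simplifies its value. -/
theorem gegenbauerMoment_zero {a : ℝ} (ha : 0 < a) :
    gegenbauerMoment a 0 * Real.Gamma (a + 3 / 2) = √Real.pi * Real.Gamma (a + 1) := by
  have hB := ProbabilityTheory.beta_eq_betaIntegralReal (a + 1) (a + 1) (by linarith) (by linarith)
  have hI : gegenbauerMoment a 0 = 2 * 4 ^ a * ∫ u in (0 : ℝ)..1, u ^ a * (1 - u) ^ a := by
    unfold gegenbauerMoment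
    have := intervalIntegral.integral_comp_mul_sub (a := 0) (b := 1) (c := 2)
      (fun t : ℝ => (1 - t ^ 2) ^ a) (by norm_num) 1
    norm_num at this
    have e : ∫ u in (0 : ℝ)..1, (1 - (2 * u - 1) ^ 2) ^ a =
        4 ^ a * ∫ u in (0 : ℝ)..1, u ^ a * (1 - u) ^ a := by
      rw [← intervalIntegral.integral_const_mul]
      refine intervalIntegral.integral_congr fun u hu => ?_
      rw [uIcc_of_le zero_le_one] at hu
      rw [show 1 - (2 * u - 1) ^ 2 = 4 * (u * (1 - u)) by ring,
        Real.mul_rpow (by norm_num) (mul_nonneg hu.1 (by linarith [hu.2])),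
        Real.mul_rpow hu.1 (by linarith [hu.2])]
    rw [e] at this
    simp only [mul_zero, pow_zero, one_mul]
    linarith
  have hbeta : (Complex.betaIntegral ((a + 1 : ℝ) : ℂ) ((a + 1 : ℝ) : ℂ)).re =
      ∫ u in (0 : ℝ)..1, u ^ a * (1 - u) ^ a := by
    rw [Complex.betaIntegral]
    have : ∫ x in (0 : ℝ)..1, (x : ℂ) ^ (((a + 1 : ℝ) : ℂ) - 1) *
        (1 - (x : ℂ)) ^ (((a + 1 : ℝ) : ℂ) - 1) =
        ∫ x in (0 : ℝ)..1, ((x ^ a * (1 - x) ^ a : ℝ) : ℂ) := by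
      refine intervalIntegral.integral_congr fun u hu => ?_
      rw [uIcc_of_le zero_le_one] at hu
      push_cast
      rw [add_sub_cancel_right, Complex.ofReal_cpow hu.1, Complex.ofReal_cpow (by linarith [hu.2])]
      push_cast
      rfl
    rw [this, intervalIntegral.integral_ofReal, Complex.ofReal_re]
  rw [hbeta, ProbabilityTheory.beta] at hB
  have dup := Real.Gamma_mul_Gamma_add_half (a + 1)
  rw [hI, ← hB]
  have g1 : Real.Gamma (a + 1) ≠ 0 := (Real.Gamma_pos_of_pos (by linarith)).ne'
  have g2 : Real.Gamma (2 * (a + 1)) ≠ 0 := (Real.Gamma_pos_of_pos (by linarith)).ne'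
  rw [show a + 1 + 1 / 2 = a + 3 / 2 by ring] at dup
  rw [show a + 1 + (a + 1) = 2 * (a + 1) by ring]
  have hp : (4 : ℝ) ^ a * 2 ^ (1 - 2 * (a + 1)) = 1 / 2 := by
    rw [show (4 : ℝ) = 2 ^ (2 : ℝ) by norm_num, ← Real.rpow_mul (by norm_num),
      ← Real.rpow_add (by norm_num), show 2 * a + (1 - 2 * (a + 1)) = -1 by ring,
      Real.rpow_neg_one]
    norm_num
  generalize Real.Gamma (a + 1) = G1 at *
  generalize Real.Gamma (2 * (a + 1)) = G2 at *
  generalize Real.Gamma (a + 3 / 2) = G3 at *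
  field_simp
  linear_combination (2 * 4 ^ a) * dup +
    2 * G2 * √Real.pi * hp

theorem gegenbauerMoment_eq {a : ℝ} (ha : 0 < a) (m : ℕ) :
    gegenbauerMoment a m * (m ! * Real.Gamma (m + a + 3 / 2) * 4 ^ m) =
      √Real.pi * Real.Gamma (a + 1) * (2 * m) ! := by
  induction m with
  | zero => simpa using gegenbauerMoment_zero ha
  | succ m ih =>
    have h := gegenbauerMoment_succ ha m
    have hpos : (0 : ℝ) < m + a + 3 / 2 := by positivity
    rw [show 2 * (m + 1) = (2 * m + 1) + 1 by ring, Nat.factorial_succ, Nat.factorial_succ,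
      Nat.factorial_succ]
    push_cast
    rw [show (m : ℝ) + 1 + a + 3 / 2 = m + a + 3 / 2 + 1 by ring, Real.Gamma_add_one hpos.ne']
    linear_combination (2 * (2 * (m : ℝ) + 1) * (m + 1)) * ih +
      (2 * (m + 1) * (m ! : ℝ) * Real.Gamma (m + a + 3 / 2) * 4 ^ m) * h

theorem hasSum_integral_cos {a : ℝ} (ha : 0 < a) (x : ℝ) :
    HasSum (fun m : ℕ => (-1) ^ m * x ^ (2 * m) / (2 * m) ! * gegenbauerMoment a m)
      (∫ t in (-1 : ℝ)..1, Real.cos (x * t) * (1 - t ^ 2) ^ a) := by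
  have hsum : Summable fun m : ℕ => |x| ^ (2 * m) / ((2 * m) ! : ℝ) :=
    (Real.summable_pow_div_factorial |x|).comp_injective
      (mul_right_injective₀ (two_ne_zero : (2 : ℕ) ≠ 0))
  have := intervalIntegral.hasSum_integral_of_dominated_convergence (μ := volume)
    (a := (-1 : ℝ)) (b := 1)
    (F := fun (m : ℕ) (t : ℝ) => (-1) ^ m * (x * t) ^ (2 * m) / ((2 * m) ! : ℝ) * (1 - t ^ 2) ^ a)
    (f := fun t => Real.cos (x * t) * (1 - t ^ 2) ^ a)
    (fun m _ => |x| ^ (2 * m) / ((2 * m) ! : ℝ))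
    (fun m => by
      refine Continuous.aestronglyMeasurable ?_
      exact (by fun_prop : Continuous fun t : ℝ => (-1) ^ m * (x * t) ^ (2 * m) /
        ((2 * m) ! : ℝ)).mul (continuous_one_sub_sq_rpow ha.le))
    (fun m => Eventually.of_forall fun t ht => by
      rw [uIoc_of_le (by norm_num)] at ht
      have h1 : 0 ≤ 1 - t ^ 2 := by nlinarith [ht.1, ht.2]
      have h2 : |t| ≤ 1 := abs_le.mpr ⟨ht.1.le, ht.2⟩
      have h3 : (1 - t ^ 2) ^ a ≤ 1 := Real.rpow_le_one h1 (by nlinarith) ha.le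
      have h4 : 0 ≤ (1 - t ^ 2) ^ a := Real.rpow_nonneg h1 a
      rw [norm_mul, norm_div, norm_mul, norm_pow, norm_pow, norm_neg, norm_one, one_pow, one_mul,
        norm_mul, Real.norm_of_nonneg h4, Real.norm_eq_abs, Real.norm_eq_abs, mul_pow,
        Real.norm_of_nonneg (by positivity : (0 : ℝ) ≤ ((2 * m) ! : ℕ))]
      have h5 : |t| ^ (2 * m) ≤ 1 := pow_le_one₀ (abs_nonneg t) h2
      calc |x| ^ (2 * m) * |t| ^ (2 * m) / ((2 * m) ! : ℝ) * (1 - t ^ 2) ^ a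
          ≤ |x| ^ (2 * m) * 1 / ((2 * m) ! : ℝ) * 1 := by gcongr
        _ = _ := by ring)
    (Eventually.of_forall fun t _ => hsum)
    (by simp)
    (Eventually.of_forall fun t _ => (Real.hasSum_cos (x * t)).mul_right _)
  have e : ∀ m : ℕ, ∫ t in (-1 : ℝ)..1, (-1) ^ m * (x * t) ^ (2 * m) / ((2 * m) ! : ℝ) *
      (1 - t ^ 2) ^ a = (-1) ^ m * x ^ (2 * m) / (2 * m) ! * gegenbauerMoment a m := by
    intro m
    rw [gegenbauerMoment, ← intervalIntegral.integral_const_mul]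
    congr 1; ext t
    rw [mul_pow]; ring
  simpa only [e] using this

theorem poisson_integral {s x : ℝ} (hs : 1 / 2 < s) (hx : 0 < x) :
    besselJ s x = (x / 2) ^ s / (√Real.pi * Real.Gamma (s + 1 / 2)) *
      ∫ t in (-1 : ℝ)..1, Real.cos (x * t) * (1 - t ^ 2) ^ (s - 1 / 2) := by
  rw [besselJ_eq hx, ← (hasSum_integral_cos (a := s - 1 / 2) (by linarith) x).tsum_eq, besselE,
    div_mul_eq_mul_div, mul_div_assoc]
  congr 1
  rw [← tsum_div_const]
  congr 1; ext m
  have h := gegenbauerMoment_eq (a := s - 1 / 2) (by linarith) m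
  have g1 : 0 < Real.Gamma (s + 1 / 2) := Real.Gamma_pos_of_pos (by linarith)
  have g2 : 0 < Real.Gamma (m + s + 1) := Real.Gamma_pos_of_pos (by positivity)
  have g3 : (0 : ℝ) < √Real.pi := Real.sqrt_pos.mpr Real.pi_pos
  rw [show (m : ℝ) + (s - 1 / 2) + 3 / 2 = m + s + 1 by ring,
    show s - 1 / 2 + 1 = s + 1 / 2 by ring] at h
  have f1 : ((m ! : ℕ) : ℝ) ≠ 0 := by exact_mod_cast Nat.factorial_ne_zero m
  have f2 : (((2 * m) ! : ℕ) : ℝ) ≠ 0 := by exact_mod_cast Nat.factorial_ne_zero (2 * m)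
  unfold besselCoeff
  rw [← pow_mul, div_pow, pow_mul 2 2 m, show (2 : ℝ) ^ 2 = 4 by norm_num]
  generalize gegenbauerMoment (s - 1 / 2) m = M at *
  generalize Real.Gamma (s + 1 / 2) = G1 at *
  generalize Real.Gamma (m + s + 1) = G2 at *
  field_simp
  linear_combination (-1) * h

/-- The integrand `e^{ixz} (1 - z^2)^a` of the contour integrals for Bessel functions. -/
noncomputable def gegenbauerKernel (a x : ℝ) (z : ℂ) : ℂ :=
  Complex.exp (Complex.I * x * z) * (1 - z ^ 2) ^ (a : ℂ)

/-- 1 − (1 + iy)² = −2iy(1 + iy/2). The arguments −π/2 and arg(1 + iy/2) ≥ 0 add up inside (−π, π],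
so principal logarithms add and principal powers multiply. -/
theorem cpow_vertical (a : ℝ) {y : ℝ} (hy : 0 < y) :
    (1 - (1 + y * Complex.I) ^ 2 : ℂ) ^ (a : ℂ) = (((2 * y) ^ a : ℝ) : ℂ) *
      Complex.exp (-(a * Real.pi / 2 : ℝ) * Complex.I) * (1 + y / 2 * Complex.I) ^ (a : ℂ) := by
  have hI : Complex.I ^ 2 = -1 := Complex.I_sq
  have h0 : (1 + y / 2 * Complex.I : ℂ) ≠ 0 :=
    Complex.slitPlane_ne_zero (one_add_mul_I_mem_slitPlane y)
  have h2y : ((2 * y : ℝ) : ℂ) ≠ 0 := by exact_mod_cast (by positivity : 2 * y ≠ 0)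
  have harg : 0 ≤ (1 + y / 2 * Complex.I : ℂ).arg := by
    rw [Complex.arg_nonneg_iff]; simp; positivity
  have harg2 := Complex.arg_le_pi (1 + y / 2 * Complex.I : ℂ)
  have e1 : (1 - (1 + y * Complex.I) ^ 2 : ℂ) = Complex.exp ((Real.log (2 * y) : ℝ) +
      (-(Real.pi / 2 : ℝ) * Complex.I) + Complex.log (1 + y / 2 * Complex.I)) := by
    rw [Complex.exp_add, Complex.exp_add, Complex.exp_log h0, ← Complex.ofReal_exp,
      Real.exp_log (by positivity)]
    have : Complex.exp (-((Real.pi / 2 : ℝ) : ℂ) * Complex.I) = -Complex.I := by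
      rw [← Complex.exp_neg_pi_div_two_mul_I]; congr 1; push_cast; ring
    rw [this]
    push_cast
    linear_combination (-(y : ℂ) ^ 2 + (y : ℂ) ^ 2) * hI
  have e2 : Complex.log (1 - (1 + y * Complex.I) ^ 2 : ℂ) = (Real.log (2 * y) : ℝ) +
      (-(Real.pi / 2 : ℝ) * Complex.I) + Complex.log (1 + y / 2 * Complex.I) := by
    rw [e1, Complex.log_exp]
    · simp [Complex.log_im]; linarith [Real.pi_pos]
    · simp [Complex.log_im]; linarith [Real.pi_pos]
  have hne : (1 - (1 + y * Complex.I) ^ 2 : ℂ) ≠ 0 := by rw [e1]; exact Complex.exp_ne_zero _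
  rw [Complex.cpow_def_of_ne_zero hne, Complex.cpow_def_of_ne_zero h0, e2,
    Real.rpow_def_of_pos (by positivity), Complex.ofReal_exp, ← Complex.exp_add, ← Complex.exp_add]
  congr 1
  push_cast
  ring

theorem gegenbauerKernel_vertical (a x : ℝ) {y : ℝ} (hy : 0 < y) :
    gegenbauerKernel a x (1 + y * Complex.I) = Complex.exp (x * Complex.I) * ((2 ^ a : ℝ) : ℂ) *
      Complex.exp (-(a * Real.pi / 2 : ℝ) * Complex.I) * laplaceIntegrand a a x y := by
  have hI : Complex.I ^ 2 = -1 := Complex.I_sq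
  rw [gegenbauerKernel, cpow_vertical a hy, laplaceIntegrand, Real.mul_rpow (by norm_num) hy.le,
    show Complex.I * x * (1 + y * Complex.I) = x * Complex.I + ((-(x * y) : ℝ) : ℂ) by
      push_cast; linear_combination (x * y : ℂ) * hI, Complex.exp_add, ← Complex.ofReal_exp]
  push_cast
  ring

theorem gegenbauerKernel_neg_conj (a x : ℝ) {y : ℝ} (hy : 0 < y) :
    gegenbauerKernel a x (-1 + y * Complex.I) =
      (starRingEnd ℂ) (gegenbauerKernel a x (1 + y * Complex.I)) := by
  have h1 : (1 - (-1 + y * Complex.I) ^ 2 : ℂ) =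
      (starRingEnd ℂ) (1 - (1 + y * Complex.I) ^ 2 : ℂ) := by
    simp only [map_sub, map_pow, map_add, map_mul, map_one, Complex.conj_I, Complex.conj_ofReal]
    ring
  have h2 : (1 - (1 + y * Complex.I) ^ 2 : ℂ).arg ≠ Real.pi := by
    intro h
    rw [Complex.arg_eq_pi_iff] at h
    have := h.2
    simp [pow_two] at this
    exact hy.ne' this
  unfold gegenbauerKernel
  rw [h1, Complex.conj_cpow _ _ h2, map_mul, ← Complex.exp_conj, Complex.conj_ofReal]
  congr 2
  simp only [map_mul, map_add, map_one, Complex.conj_I, Complex.conj_ofReal]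
  ring

theorem re_one_sub_sq (x y : ℝ) : (1 - (x + y * Complex.I) ^ 2 : ℂ).re = 1 - x ^ 2 + y ^ 2 := by
  simp [pow_two]; ring

theorem norm_gegenbauerKernel_le {a x : ℝ} (ha : 0 ≤ a) {t R : ℝ} (ht : |t| ≤ 1) :
    ‖gegenbauerKernel a x (t + R * Complex.I)‖ ≤ Real.exp (-(x * R)) * (2 + R ^ 2) ^ a := by
  unfold gegenbauerKernel
  rw [norm_mul, Complex.norm_exp, Complex.norm_cpow_real]
  have h1 : (Complex.I * x * (t + R * Complex.I)).re = -(x * R) := by simp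
  rw [h1]
  have ht2 : t ^ 2 ≤ 1 := by rw [← sq_abs]; exact pow_le_one₀ (abs_nonneg t) ht
  have h2 : ‖(1 - (t + R * Complex.I) ^ 2 : ℂ)‖ ≤ 2 + R ^ 2 := by
    refine (norm_sub_le _ _).trans ?_
    rw [norm_one, norm_pow, ← Complex.normSq_eq_norm_sq, Complex.normSq_add_mul_I]
    linarith
  gcongr

/-- Cauchy's theorem on the rectangle over [−1, 1] of height R. Inside the strip Re(1 − z²) > 0, so
the principal power is holomorphic; at the corners ±1 it is continuous because a > 0. The top side
decays, and the two vertical sides carry conjugate values, which is why the result is real. -/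
theorem integral_gegenbauerKernel {a x : ℝ} (ha : 0 < a) (hx : 0 < x) :
    ∫ t in (-1 : ℝ)..1, gegenbauerKernel a x t = ((2 * (-Complex.I * (Complex.exp (x * Complex.I) *
      ((2 ^ a : ℝ) : ℂ) * Complex.exp (-(a * Real.pi / 2 : ℝ) * Complex.I) *
      laplaceInt a a x)).re : ℝ) : ℂ) := by
  set c : ℂ := Complex.exp (x * Complex.I) * ((2 ^ a : ℝ) : ℂ) *
    Complex.exp (-(a * Real.pi / 2 : ℝ) * Complex.I)
  have hrect : ∀ R : ℝ, 0 < R → ∫ t in (-1 : ℝ)..1, gegenbauerKernel a x t =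
      (∫ t in (-1 : ℝ)..1, gegenbauerKernel a x (t + R * Complex.I)) -
      Complex.I * (∫ y in (0 : ℝ)..R, c * laplaceIntegrand a a x y) +
      Complex.I * ∫ y in (0 : ℝ)..R, (starRingEnd ℂ) (c * laplaceIntegrand a a x y) := by
    intro R hR
    have H := Complex.integral_boundary_rect_eq_zero_of_continuousOn_of_differentiableOn
      (gegenbauerKernel a x) (-1) (1 + R * Complex.I)
      (by
        intro z hz
        have hz1 : z.re ∈ uIcc (-1 : ℝ) 1 := by simpa using hz.1
        rw [uIcc_of_le (by norm_num)] at hz1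
        refine ContinuousAt.continuousWithinAt ?_
        refine ContinuousAt.mul (by fun_prop) ?_
        refine ContinuousAt.comp (f := fun z : ℂ => 1 - z ^ 2) (g := fun w : ℂ => w ^ (a : ℂ))
          (Complex.continuousAt_cpow_const_of_re_pos (Or.inl ?_) (by simpa using ha))
          (Continuous.continuousAt (by fun_prop))
        have := re_one_sub_sq z.re z.im
        rw [Complex.re_add_im] at this
        rw [this]
        nlinarith [hz1.1, hz1.2, sq_nonneg z.im])
      (by
        intro z hz
        have hz1 : z.re ∈ Ioo (-1 : ℝ) 1 := by simpa using hz.1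
        refine DifferentiableAt.differentiableWithinAt ?_
        refine DifferentiableAt.mul (by fun_prop) ?_
        refine DifferentiableAt.cpow_const (by fun_prop) (Or.inl ?_)
        have := re_one_sub_sq z.re z.im
        rw [Complex.re_add_im] at this
        rw [this]
        nlinarith [hz1.1, hz1.2, sq_nonneg z.im])
    simp at H
    have e1 : ∫ y in (0 : ℝ)..R, gegenbauerKernel a x (1 + y * Complex.I) =
        ∫ y in (0 : ℝ)..R, c * laplaceIntegrand a a x y := by
      refine intervalIntegral.integral_congr_ae (Eventually.of_forall fun y hy => ?_)
      rw [uIoc_of_le hR.le] at hy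
      exact gegenbauerKernel_vertical a x hy.1
    have e2 : ∫ y in (0 : ℝ)..R, gegenbauerKernel a x (-1 + y * Complex.I) =
        ∫ y in (0 : ℝ)..R, (starRingEnd ℂ) (c * laplaceIntegrand a a x y) := by
      refine intervalIntegral.integral_congr_ae (Eventually.of_forall fun y hy => ?_)
      rw [uIoc_of_le hR.le] at hy
      rw [gegenbauerKernel_neg_conj a x hy.1, gegenbauerKernel_vertical a x hy.1]
    rw [e1, e2] at H
    linear_combination H
  have hi := (integrableOn_laplaceIntegrand a (b := a) (by linarith) hx).const_mul c
  have t1 := intervalIntegral_tendsto_integral_Ioi 0 hi tendsto_id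
  have hi2 : IntegrableOn (fun y => (starRingEnd ℂ) (c * laplaceIntegrand a a x y)) (Ioi 0) := by
    refine (Complex.conjLIE.toContinuousLinearEquiv.toContinuousLinearMap.integrable_comp hi)
  have t2 := intervalIntegral_tendsto_integral_Ioi 0 hi2 tendsto_id
  have t0 : Tendsto (fun R : ℝ => ∫ t in (-1 : ℝ)..1, gegenbauerKernel a x (t + R * Complex.I)) atTop
      (𝓝 0) := by
    have hb : ∀ R : ℝ, ‖∫ t in (-1 : ℝ)..1, gegenbauerKernel a x (t + R * Complex.I)‖ ≤
        Real.exp (-(x * R)) * (2 + R ^ 2) ^ a * |1 - (-1)| := fun R =>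
      intervalIntegral.norm_integral_le_of_norm_le_const fun t ht => by
        rw [uIoc_of_le (by norm_num)] at ht
        exact norm_gegenbauerKernel_le ha.le (abs_le.mpr ⟨ht.1.le, ht.2⟩)
    have hlim : Tendsto (fun R : ℝ => 3 ^ a * (R ^ (2 * a) * Real.exp (-x * R)) * |(1 : ℝ) - (-1)|)
        atTop (𝓝 0) := by
      simpa using ((tendsto_rpow_mul_exp_neg_mul_atTop_nhds_zero (2 * a) x hx).const_mul
        (3 ^ a)).mul_const |(1 : ℝ) - (-1)|
    rw [tendsto_zero_iff_norm_tendsto_zero]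
    refine squeeze_zero' (Eventually.of_forall fun R => norm_nonneg _) ?_ hlim
    filter_upwards [eventually_ge_atTop 1] with R hR
    refine (hb R).trans ?_
    have h1 : (2 + R ^ 2) ^ a ≤ 3 ^ a * R ^ (2 * a) := by
      rw [Real.rpow_mul (by linarith), Real.rpow_two, ← Real.mul_rpow (by norm_num) (by positivity)]
      exact Real.rpow_le_rpow (by positivity) (by nlinarith) ha.le
    rw [neg_mul]
    have := Real.exp_pos (-(x * R))
    calc _ ≤ Real.exp (-(x * R)) * (3 ^ a * R ^ (2 * a)) * |1 - (-1)| := by gcongr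
      _ = _ := by ring
  have hlim := ((t0.sub (t1.const_mul Complex.I)).add (t2.const_mul Complex.I))
  have hc : Tendsto (fun _ : ℝ => ∫ t in (-1 : ℝ)..1, gegenbauerKernel a x t) atTop
      (𝓝 (∫ t in (-1 : ℝ)..1, gegenbauerKernel a x t)) := tendsto_const_nhds
  have hfin := tendsto_nhds_unique (hc.congr' (by
    filter_upwards [eventually_gt_atTop 0] with R hR
    exact hrect R hR)) hlim
  rw [hfin, integral_conj, integral_const_mul]
  change 0 - Complex.I * (c * laplaceInt a a x) +
    Complex.I * (starRingEnd ℂ) (c * laplaceInt a a x) = _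
  generalize c * laplaceInt a a x = w
  apply Complex.ext <;> simp
  ring

theorem besselJ_eq_re_hankelH_of_half_lt {s x : ℝ} (hs : 1 / 2 < s) (hx : 0 < x) :
    besselJ s x = (hankelH s x).re := by
  have h1 := integral_gegenbauerKernel (a := s - 1 / 2) (by linarith) hx
  have h2 : (∫ t in (-1 : ℝ)..1, gegenbauerKernel (s - 1 / 2) x t).re =
      ∫ t in (-1 : ℝ)..1, Real.cos (x * t) * (1 - t ^ 2) ^ (s - 1 / 2) := by
    have hcont : IntervalIntegrable (fun t : ℝ => gegenbauerKernel (s - 1 / 2) x t) volume (-1) 1 := by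
      refine ContinuousOn.intervalIntegrable fun t ht => ?_
      rw [uIcc_of_le (by norm_num)] at ht
      refine ContinuousAt.continuousWithinAt (ContinuousAt.mul (by fun_prop) ?_)
      refine ContinuousAt.comp (f := fun t : ℝ => (1 - t ^ 2 : ℂ))
        (g := fun w : ℂ => w ^ ((s - 1 / 2 : ℝ) : ℂ))
        (Complex.continuousAt_cpow_const_of_re_pos (Or.inl ?_)
          (by rw [Complex.ofReal_re]; linarith)) (Continuous.continuousAt (by fun_prop))
      simp [pow_two]
      nlinarith [ht.1, ht.2]
    have := Complex.reCLM.intervalIntegral_comp_comm hcont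
    simp only [Complex.reCLM_apply] at this
    rw [← this]
    refine intervalIntegral.integral_congr fun t ht => ?_
    rw [uIcc_of_le (by norm_num)] at ht
    have ht0 : 0 ≤ 1 - t ^ 2 := by nlinarith [ht.1, ht.2]
    have e : gegenbauerKernel (s - 1 / 2) x t = Complex.exp ((x * t : ℝ) * Complex.I) *
        (((1 - t ^ 2) ^ (s - 1 / 2) : ℝ) : ℂ) := by
      rw [gegenbauerKernel, Complex.ofReal_cpow ht0]
      push_cast
      ring_nf
    rw [e, Complex.re_mul_ofReal, Complex.exp_ofReal_mul_I_re]
  rw [h1, Complex.ofReal_re] at h2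
  rw [poisson_integral hs hx, ← h2, hankelH]
  have g1 : 0 < Real.Gamma (s + 1 / 2) := Real.Gamma_pos_of_pos (by linarith)
  have e : -Complex.I * Complex.exp (-((s - 1 / 2) * Real.pi / 2 : ℝ) * Complex.I) =
      Complex.exp (-((s * Real.pi / 2 + Real.pi / 4 : ℝ) : ℂ) * Complex.I) := by
    rw [← Complex.exp_neg_pi_div_two_mul_I, ← Complex.exp_add]
    congr 1; push_cast; ring
  have hc : (x / 2) ^ s / (√Real.pi * Real.Gamma (s + 1 / 2)) * 2 * 2 ^ (s - 1 / 2) =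
      √(2 / Real.pi) / Real.Gamma (s + 1 / 2) * x ^ s := by
    rw [Real.div_rpow hx.le (by norm_num), Real.rpow_sub (by norm_num), ← Real.sqrt_eq_rpow,
      Real.sqrt_div (by norm_num)]
    have h2 : √2 * √2 = (2 : ℝ) := Real.mul_self_sqrt (by norm_num)
    have h3 : (0 : ℝ) < √Real.pi := Real.sqrt_pos.mpr Real.pi_pos
    have h4 : (0 : ℝ) < √2 := Real.sqrt_pos.mpr (by norm_num)
    have h5 : (0 : ℝ) < 2 ^ s := by positivity
    generalize Real.Gamma (s + 1 / 2) = G at *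
    field_simp
    nlinarith
  have e2 : hankelConst s * ((x ^ s : ℝ) : ℂ) * Complex.exp (x * Complex.I) *
      laplaceInt (s - 1 / 2) (s - 1 / 2) x =
      (((x / 2) ^ s / (√Real.pi * Real.Gamma (s + 1 / 2)) * 2 : ℝ) : ℂ) *
      (-Complex.I * (Complex.exp (x * Complex.I) *
        ((2 ^ (s - 1 / 2) : ℝ) : ℂ) * Complex.exp (-((s - 1 / 2) * Real.pi / 2 : ℝ) * Complex.I) *
        laplaceInt (s - 1 / 2) (s - 1 / 2) x)) := by
    rw [hankelConst, ← e]
    have hc' := congrArg (fun r : ℝ => (r : ℂ)) hc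
    simp only [Complex.ofReal_mul] at hc' ⊢
    linear_combination (Complex.I * Complex.exp (-((s - 1 / 2) * Real.pi / 2 : ℝ) * Complex.I) *
      Complex.exp (x * Complex.I) * laplaceInt (s - 1 / 2) (s - 1 / 2) x) * hc'
  rw [e2, Complex.re_ofReal_mul]
  ring

/-! ### Leading asymptotics, Wronskians and the identification H = J + iY -/

/-- The amplitude and phase of the leading term of `H_s(x) e^{-ix}`. -/
noncomputable def hankelPhase (s : ℝ) : ℂ :=
  ((√(2 / Real.pi) : ℝ) : ℂ) *
    Complex.exp (-((s * Real.pi / 2 + Real.pi / 4 : ℝ) : ℂ) * Complex.I)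

theorem hankelPhase_add_one (s : ℝ) : hankelPhase (s + 1) = -Complex.I * hankelPhase s := by
  unfold hankelPhase
  rw [← Complex.exp_neg_pi_div_two_mul_I, mul_left_comm, ← Complex.exp_add]
  congr 2; push_cast; ring

theorem hankelPhase_mul_conj (s t : ℝ) : hankelPhase s * (starRingEnd ℂ) (hankelPhase t) =
    (2 / Real.pi : ℝ) * Complex.exp (((t - s) * Real.pi / 2 : ℝ) * Complex.I) := by
  unfold hankelPhase
  have h : ((√(2 / Real.pi) : ℝ) : ℂ) * ((√(2 / Real.pi) : ℝ) : ℂ) = ((2 / Real.pi : ℝ) : ℂ) := by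
    rw [← Complex.ofReal_mul, Real.mul_self_sqrt (by positivity)]
  rw [map_mul, Complex.conj_ofReal, ← Complex.exp_conj, mul_mul_mul_comm, h, ← Complex.exp_add]
  congr 2
  simp only [map_mul, map_neg, Complex.conj_ofReal, Complex.conj_I]
  push_cast; ring

theorem tendsto_laplaceInt (a : ℝ) {b : ℝ} (hb : -1 < b) :
    Tendsto (fun x : ℝ => ((x ^ (b + 1) : ℝ) : ℂ) * laplaceInt a b x) atTop
      (𝓝 (Real.Gamma (b + 1))) := by
  have h := (laplaceInt_expansion a hb 1).trans_tendsto
    (by simpa using tendsto_inv_atTop_zero (𝕜 := ℝ))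
  have := h.add_const ((Real.Gamma (b + 1) : ℝ) : ℂ)
  simpa [laplaceCoeff, binomCoeff] using this

theorem tendsto_hankelH {s : ℝ} (hs : -(1 / 2) < s) :
    Tendsto (fun x : ℝ => ((√x : ℝ) : ℂ) * (Complex.exp (-(x * Complex.I)) * hankelH s x)) atTop
      (𝓝 (hankelPhase s)) := by
  have h := (tendsto_laplaceInt (s - 1 / 2) (b := s - 1 / 2) (by linarith)).const_mul
    (hankelConst s)
  have g : (Real.Gamma (s + 1 / 2) : ℂ) ≠ 0 := by
    exact_mod_cast (Real.Gamma_pos_of_pos (by linarith)).ne'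
  have e : hankelConst s * (Real.Gamma (s - 1 / 2 + 1) : ℂ) = hankelPhase s := by
    rw [show s - 1 / 2 + 1 = s + 1 / 2 by ring, hankelConst, hankelPhase, Complex.ofReal_div]
    generalize (Real.Gamma (s + 1 / 2) : ℂ) = G at *
    field_simp
  rw [e] at h
  refine h.congr' ?_
  filter_upwards [eventually_gt_atTop 0] with x hx
  have hE : Complex.exp (-(x * Complex.I)) * Complex.exp (x * Complex.I) = 1 := by
    rw [← Complex.exp_add]; simp
  rw [show s - 1 / 2 + 1 = 1 / 2 + s by ring, Real.rpow_add hx, ← Real.sqrt_eq_rpow, hankelH]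
  push_cast
  linear_combination (-(√x : ℂ) * hankelConst s * ((x ^ s : ℝ) : ℂ) *
    laplaceInt (s - 1 / 2) (s - 1 / 2) x) * hE

theorem tendsto_hankelD {s : ℝ} (hs : -(1 / 2) < s) :
    Tendsto (fun x : ℝ => ((√x : ℝ) : ℂ) * (Complex.exp (-(x * Complex.I)) * hankelD s x)) atTop
      (𝓝 (Complex.I * hankelPhase s)) := by
  have h1 := tendsto_hankelH hs
  have h2 := tendsto_hankelH (s := s + 1) (by linarith)
  have h3 : Tendsto (fun x : ℝ => (s / x : ℂ)) atTop (𝓝 0) := by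
    have : Tendsto (fun x : ℝ => s / x) atTop (𝓝 0) := tendsto_const_nhds.div_atTop tendsto_id
    have := (Complex.continuous_ofReal.tendsto 0).comp this
    simpa [Function.comp_def] using this
  have := (h3.mul h1).sub h2
  rw [zero_mul, zero_sub, hankelPhase_add_one, neg_mul, neg_neg] at this
  refine this.congr' ?_
  filter_upwards [eventually_gt_atTop 0] with x hx
  rw [hankelH_add_one hs hx]
  ring

/-- The device that evaluates Wronskians: they are constant, so their value is read off at infinity.
-/
theorem eq_of_hasDerivAt_zero_Ioi {E : Type*} [NormedAddCommGroup E] [NormedSpace ℝ E]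
    {f : ℝ → E} (hf : ∀ x : ℝ, 0 < x → HasDerivAt f 0 x) {c : E} (hc : Tendsto f atTop (𝓝 c))
    {x : ℝ} (hx : 0 < x) : f x = c := by
  refine tendsto_nhds_unique (tendsto_const_nhds.congr' ?_) hc
  filter_upwards [eventually_gt_atTop 0] with y hy
  exact isOpen_Ioi.is_const_of_deriv_eq_zero isPreconnected_Ioi
    (fun z hz => (hf z hz).differentiableAt.differentiableWithinAt)
    (fun z hz => (hf z hz).deriv) hx hy

theorem hankel_wronskian {s x : ℝ} (hs : -(1 / 2) < s) (hx : 0 < x) :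
    x * (hankelD s x * (starRingEnd ℂ) (hankelH s x) -
      (starRingEnd ℂ) (hankelD s x) * hankelH s x) = 4 / Real.pi * Complex.I := by
  have hd : ∀ x : ℝ, 0 < x → HasDerivAt (fun x : ℝ =>
      x * hankelD s x * (starRingEnd ℂ) (hankelH s x) -
      (starRingEnd ℂ) (x * hankelD s x) * hankelH s x) 0 x := by
    intro x hx
    have hH := hasDerivAt_hankelH hs hx
    have hD := hasDerivAt_mul_hankelD hs hx
    have hH' : HasDerivAt (fun x => (starRingEnd ℂ) (hankelH s x))
      ((starRingEnd ℂ) (hankelD s x)) x := hH.star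
    have hD' : HasDerivAt (fun x : ℝ => (starRingEnd ℂ) (x * hankelD s x))
      ((starRingEnd ℂ) ((s ^ 2 - x ^ 2) / x * hankelH s x)) x := hD.star
    refine ((hD.fun_mul hH').fun_sub (hD'.fun_mul hH)).congr_deriv ?_
    simp only [map_mul, map_div₀, map_sub, map_pow, Complex.conj_ofReal]
    ring
  have hl : Tendsto (fun x : ℝ => x * hankelD s x * (starRingEnd ℂ) (hankelH s x) -
      (starRingEnd ℂ) (x * hankelD s x) * hankelH s x) atTop (𝓝 (4 / Real.pi * Complex.I)) := by
    have h1 := tendsto_hankelH hs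
    have h2 := tendsto_hankelD hs
    have c1 := (Complex.continuous_conj.tendsto _).comp h1
    have c2 := (Complex.continuous_conj.tendsto _).comp h2
    have h := (h2.mul c1).sub (c2.mul h1)
    have e : Complex.I * hankelPhase s * (starRingEnd ℂ) (hankelPhase s) -
        (starRingEnd ℂ) (Complex.I * hankelPhase s) * hankelPhase s = 4 / Real.pi * Complex.I := by
      have := hankelPhase_mul_conj s s
      rw [sub_self, zero_mul, zero_div, Complex.ofReal_zero, zero_mul, Complex.exp_zero] at this
      rw [map_mul, Complex.conj_I]
      push_cast at this
      linear_combination (2 * Complex.I) * this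
    rw [e] at h
    refine h.congr' ?_
    filter_upwards [eventually_gt_atTop 0] with x hx
    have hq : ((√x : ℝ) : ℂ) * ((√x : ℝ) : ℂ) = x := by
      rw [← Complex.ofReal_mul, Real.mul_self_sqrt hx.le]
    have hE : Complex.exp (-(x * Complex.I)) * (starRingEnd ℂ) (Complex.exp (-(x * Complex.I))) =
        1 := by
      rw [← Complex.exp_conj, ← Complex.exp_add]
      simp
    simp only [Function.comp_apply, map_mul, Complex.conj_ofReal]
    set E := Complex.exp (-(x * Complex.I))
    set H := hankelH s x
    set D := hankelD s x
    linear_combination (E * (starRingEnd ℂ) E * (D * (starRingEnd ℂ) H - (starRingEnd ℂ) D * H)) *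
      hq + (x * (D * (starRingEnd ℂ) H - (starRingEnd ℂ) D * H)) * hE
  have := eq_of_hasDerivAt_zero_Ioi hd hl hx
  rw [← this, map_mul, Complex.conj_ofReal]
  ring

theorem besselJ_asymptotic_of_half_lt {s : ℝ} (hs : 1 / 2 < s) :
    Tendsto (fun x : ℝ => √x * besselJ s x - (hankelPhase s * Complex.exp (x * Complex.I)).re) atTop
      (𝓝 0) := by
  have h := (tendsto_hankelH (s := s) (by linarith)).sub_const (hankelPhase s)
  rw [sub_self, tendsto_zero_iff_norm_tendsto_zero] at h
  refine squeeze_zero_norm' ?_ h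
  filter_upwards [eventually_gt_atTop 0] with x hx
  have hE : Complex.exp (-(x * Complex.I)) * Complex.exp (x * Complex.I) = 1 := by
    rw [← Complex.exp_add]; simp
  have e : √x * besselJ s x - (hankelPhase s * Complex.exp (x * Complex.I)).re =
      ((((√x : ℝ) : ℂ) * (Complex.exp (-(x * Complex.I)) * hankelH s x) - hankelPhase s) *
        Complex.exp (x * Complex.I)).re := by
    rw [besselJ_eq_re_hankelH_of_half_lt hs hx, ← Complex.re_ofReal_mul, ← Complex.sub_re]
    congr 1
    linear_combination (-((√x : ℝ) : ℂ) * hankelH s x) * hE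
  rw [e]
  refine (Complex.abs_re_le_norm _).trans ?_
  rw [norm_mul, Complex.norm_exp_ofReal_mul_I, mul_one]

theorem isBoundedUnder_hankelPhase (s : ℝ) :
    IsBoundedUnder (· ≤ ·) atTop
      (fun x : ℝ => ‖(hankelPhase s * Complex.exp (x * Complex.I)).re‖) := by
  refine isBoundedUnder_of ⟨‖hankelPhase s‖, fun x => ?_⟩
  refine (Complex.abs_re_le_norm _).trans ?_
  rw [norm_mul, Complex.norm_exp_ofReal_mul_I, mul_one]

theorem tendsto_div_mul_besselJ {s : ℝ} (c : ℝ) (h : Tendsto (fun x : ℝ => √x * besselJ s x -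
    (hankelPhase s * Complex.exp (x * Complex.I)).re) atTop (𝓝 0)) :
    Tendsto (fun x : ℝ => c / x * (√x * besselJ s x)) atTop (𝓝 0) := by
  have h0 : Tendsto (fun x : ℝ => c / x) atTop (𝓝 0) := tendsto_const_nhds.div_atTop tendsto_id
  have h1 := h0.mul h
  have h2 := h0.zero_mul_isBoundedUnder_le (isBoundedUnder_hankelPhase s)
  have := h1.add h2
  rw [mul_zero, add_zero] at this
  refine this.congr fun x => ?_
  ring

/-- Descends from orders above 1/2 by J_s = 2(s+1)/x · J_{s+1} − J_{s+2}: the first term is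
negligible and the phase of order s + 2 is minus that of order s. Negative orders are needed for the
J_{-ν} in the definition of Y. -/
theorem besselJ_asymptotic (s : ℝ) :
    Tendsto (fun x : ℝ => √x * besselJ s x - (hankelPhase s * Complex.exp (x * Complex.I)).re) atTop
      (𝓝 0) := by
  have key : ∀ n : ℕ, ∀ s : ℝ, 1 / 2 - n < s → Tendsto (fun x : ℝ => √x * besselJ s x -
      (hankelPhase s * Complex.exp (x * Complex.I)).re) atTop (𝓝 0) := by
    intro n
    induction n with
    | zero => intro s hs; exact besselJ_asymptotic_of_half_lt (by simpa using hs)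
    | succ n ih =>
      intro s hs
      push_cast at hs
      have h1 := tendsto_div_mul_besselJ (2 * (s + 1)) (ih (s + 1) (by linarith))
      have h2 := ih (s + 2) (by linarith)
      have := h1.sub h2
      rw [sub_zero] at this
      refine this.congr' ?_
      filter_upwards [eventually_gt_atTop 0] with x hx
      have hP : hankelPhase (s + 2) = -hankelPhase s := by
        rw [show s + 2 = s + 1 + 1 by ring, hankelPhase_add_one, hankelPhase_add_one]
        linear_combination hankelPhase s * Complex.I_sq
      rw [besselJ_recurrence (s := s) hx, hP, neg_mul, Complex.neg_re]
      ring
  obtain ⟨n, hn⟩ := exists_nat_gt (1 / 2 - s)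
  exact key n s (by linarith)

/-- The derivative of `besselJ s`. -/
noncomputable def besselJD (s x : ℝ) : ℝ := s / x * besselJ s x - besselJ (s + 1) x

theorem hasDerivAt_mul_besselJD {s x : ℝ} (hx : 0 < x) :
    HasDerivAt (fun x => x * besselJD s x) ((s ^ 2 - x ^ 2) / x * besselJ s x) x := by
  have e : (fun x => x * besselJD s x) =ᶠ[𝓝 x]
      fun x => s * besselJ s x - x * besselJ (s + 1) x := by
    filter_upwards [lt_mem_nhds hx] with y hy
    have hy0 : y ≠ 0 := ne_of_gt hy
    unfold besselJD
    field_simp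
  refine HasDerivAt.congr_of_eventuallyEq ?_ e
  refine (((hasDerivAt_besselJ (s := s) hx).const_mul s).sub
    ((hasDerivAt_id x).mul (hasDerivAt_besselJ' (s := s) hx))).congr_deriv ?_
  simp only [id_eq]
  field_simp
  ring

theorem besselJD_asymptotic (s : ℝ) :
    Tendsto (fun x : ℝ => √x * besselJD s x -
      (Complex.I * hankelPhase s * Complex.exp (x * Complex.I)).re) atTop (𝓝 0) := by
  have h1 := tendsto_div_mul_besselJ s (besselJ_asymptotic s)
  have h2 := besselJ_asymptotic (s + 1)
  have := h1.sub h2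
  rw [sub_zero] at this
  refine this.congr fun x => ?_
  rw [hankelPhase_add_one, besselJD, neg_mul, neg_mul, Complex.neg_re]
  ring

theorem two_mul_re (z : ℂ) : ((z.re : ℝ) : ℂ) = (z + (starRingEnd ℂ) z) / 2 := by
  rw [Complex.add_conj]; push_cast; ring

/-- Only the square of the order enters Bessel's equation, so J_t and H_s solve the same equation
for t = ±s, and the asymptotics give the constant. -/
theorem besselJ_hankelH_wronskian {s t x : ℝ} (hs : -(1 / 2) < s) (hst : t ^ 2 = s ^ 2)
    (hx : 0 < x) : x * (besselJ t x * hankelD s x - besselJD t x * hankelH s x) =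
      Complex.I * (hankelPhase s * (starRingEnd ℂ) (hankelPhase t)) := by
  have hd : ∀ x : ℝ, 0 < x → HasDerivAt (fun x : ℝ =>
      (besselJ t x : ℂ) * (x * hankelD s x) - ((x * besselJD t x : ℝ) : ℂ) * hankelH s x) 0 x := by
    intro x hx
    have d1 := (hasDerivAt_besselJ (s := t) hx).ofReal_comp
    have d2 := (hasDerivAt_mul_besselJD (s := t) hx).ofReal_comp
    refine ((d1.fun_mul (hasDerivAt_mul_hankelD hs hx)).fun_sub
      (d2.fun_mul (hasDerivAt_hankelH hs hx))).congr_deriv ?_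
    rw [hst]
    unfold besselJD
    push_cast
    ring
  have hl : Tendsto (fun x : ℝ => (besselJ t x : ℂ) * (x * hankelD s x) -
      ((x * besselJD t x : ℝ) : ℂ) * hankelH s x) atTop
      (𝓝 (Complex.I * (hankelPhase s * (starRingEnd ℂ) (hankelPhase t)))) := by
    have h1 := tendsto_hankelH hs
    have h2 := tendsto_hankelD hs
    have j1 := (Complex.continuous_ofReal.tendsto _).comp (besselJ_asymptotic t)
    have j2 := (Complex.continuous_ofReal.tendsto _).comp (besselJD_asymptotic t)
    have hE1 : ∀ x : ℝ, ‖Complex.exp (x * Complex.I)‖ ≤ 1 := fun x =>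
      (Complex.norm_exp_ofReal_mul_I x).le
    have hbE : IsBoundedUnder (· ≤ ·) atTop (fun x : ℝ => ‖Complex.exp (x * Complex.I)‖) :=
      isBoundedUnder_of ⟨1, hE1⟩
    have k1 := (j1.zero_mul_isBoundedUnder_le hbE).mul h2
    have k2 := (j2.zero_mul_isBoundedUnder_le hbE).mul h1
    have hb1 : IsBoundedUnder (· ≤ ·) atTop (fun x : ℝ =>
        ‖(((hankelPhase t * Complex.exp (x * Complex.I)).re : ℝ) : ℂ) *
          Complex.exp (x * Complex.I)‖) := by
      refine isBoundedUnder_of ⟨‖hankelPhase t‖, fun x => ?_⟩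
      rw [norm_mul, Complex.norm_exp_ofReal_mul_I, mul_one, Complex.norm_real]
      refine (Complex.abs_re_le_norm _).trans ?_
      rw [norm_mul, Complex.norm_exp_ofReal_mul_I, mul_one]
    have hb2 : IsBoundedUnder (· ≤ ·) atTop (fun x : ℝ =>
        ‖(((Complex.I * hankelPhase t * Complex.exp (x * Complex.I)).re : ℝ) : ℂ) *
          Complex.exp (x * Complex.I)‖) := by
      refine isBoundedUnder_of ⟨‖hankelPhase t‖, fun x => ?_⟩
      rw [norm_mul, Complex.norm_exp_ofReal_mul_I, mul_one, Complex.norm_real]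
      refine (Complex.abs_re_le_norm _).trans ?_
      rw [norm_mul, norm_mul, Complex.norm_I, one_mul, Complex.norm_exp_ofReal_mul_I, mul_one]
    have h1' := h1.sub_const (hankelPhase s)
    have h2' := h2.sub_const (Complex.I * hankelPhase s)
    rw [sub_self] at h1' h2'
    have m1 := h2'.zero_mul_isBoundedUnder_le hb1
    have m2 := h1'.zero_mul_isBoundedUnder_le hb2
    have := (((k1.sub k2).add m1).sub m2).add_const
      (Complex.I * (hankelPhase s * (starRingEnd ℂ) (hankelPhase t)))
    simp only [zero_mul, sub_zero, zero_add] at this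
    refine this.congr' ?_
    filter_upwards [eventually_gt_atTop 0] with x hx
    have hq : ((√x : ℝ) : ℂ) * ((√x : ℝ) : ℂ) = x := by
      rw [← Complex.ofReal_mul, Real.mul_self_sqrt hx.le]
    have hE : Complex.exp (x * Complex.I) * (starRingEnd ℂ) (Complex.exp (x * Complex.I)) = 1 := by
      rw [← Complex.exp_conj, ← Complex.exp_add]
      simp
    have hE' : Complex.exp (-(x * Complex.I)) = (starRingEnd ℂ) (Complex.exp (x * Complex.I)) := by
      rw [← Complex.exp_conj]; simp
    simp only [Function.comp_apply]
    rw [hE']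
    push_cast
    rw [two_mul_re, two_mul_re]
    simp only [map_mul, Complex.conj_I]
    set E := Complex.exp (x * Complex.I)
    set H := hankelH s x
    set D := hankelD s x
    set P := hankelPhase s
    set Q := hankelPhase t
    linear_combination (E * (starRingEnd ℂ) E * (besselJ t x * D - besselJD t x * H)) * hq +
      (x * (besselJ t x * D - besselJD t x * H) - Complex.I * P * (starRingEnd ℂ) Q) * hE
  have := eq_of_hasDerivAt_zero_Ioi hd hl hx
  rw [← this]
  push_cast
  ring

/-- H and its conjugate are independent solutions, so a solution is determined by its Wronskians
with them. As J_t is real, the second Wronskian is the conjugate of the first. The case t = −s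
supplies the ingredient for Y. -/
theorem besselJ_eq_re_mul_hankelH {s t x : ℝ} (hs : -(1 / 2) < s) (hst : t ^ 2 = s ^ 2)
    (hx : 0 < x) :
    besselJ t x = (Complex.exp (((s - t) * Real.pi / 2 : ℝ) * Complex.I) * hankelH s x).re := by
  have h1 := besselJ_hankelH_wronskian hs hst hx
  have h2 := hankel_wronskian hs hx
  rw [hankelPhase_mul_conj] at h1
  have h1c := congrArg (starRingEnd ℂ) h1
  simp only [map_mul, map_sub, Complex.conj_ofReal, Complex.conj_I] at h1c
  rw [← Complex.exp_conj] at h1c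
  simp only [map_mul, Complex.conj_ofReal, Complex.conj_I] at h1c
  have hpi : (Real.pi : ℂ) ≠ 0 := by exact_mod_cast Real.pi_ne_zero
  have hJ : (besselJ t x : ℂ) * (4 / Real.pi * Complex.I) =
      ((Complex.exp (((s - t) * Real.pi / 2 : ℝ) * Complex.I) * hankelH s x).re : ℝ) *
        (4 / Real.pi * Complex.I) := by
    rw [two_mul_re, map_mul, ← Complex.exp_conj]
    simp only [map_mul, Complex.conj_ofReal, Complex.conj_I]
    have e1 : Complex.exp (((t - s) * Real.pi / 2 : ℝ) * -Complex.I) =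
      Complex.exp (((s - t) * Real.pi / 2 : ℝ) * Complex.I) := by
      congr 1; push_cast; ring
    have e2 : Complex.exp (((t - s) * Real.pi / 2 : ℝ) * Complex.I) =
      Complex.exp (((s - t) * Real.pi / 2 : ℝ) * -Complex.I) := by
      congr 1; push_cast; ring
    rw [e1] at h1c
    rw [e2] at h1
    push_cast at h1 h1c ⊢
    linear_combination -(besselJ t x : ℂ) * h2 + (starRingEnd ℂ) (hankelH s x) * h1 -
      hankelH s x * h1c
  have h4 : (4 / Real.pi * Complex.I : ℂ) ≠ 0 := by simp [hpi]
  exact_mod_cast mul_right_cancel₀ h4 hJ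

theorem besselJ_eq_re_hankelH {s x : ℝ} (hs : -(1 / 2) < s) (hx : 0 < x) :
    besselJ s x = (hankelH s x).re := by
  simpa using besselJ_eq_re_mul_hankelH hs rfl hx

theorem besselYQuot_eq_im_hankelH {s x : ℝ} (hs : -(1 / 2) < s) (hsin : Real.sin (s * Real.pi) ≠ 0)
    (hx : 0 < x) : besselYQuot s x = (hankelH s x).im := by
  rw [besselYQuot, besselJ_eq_re_hankelH hs hx,
    besselJ_eq_re_mul_hankelH (t := -s) hs (by ring) hx,
    show (s - -s) * Real.pi / 2 = s * Real.pi by ring, Complex.mul_re,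
    Complex.exp_ofReal_mul_I_re, Complex.exp_ofReal_mul_I_im]
  field_simp
  ring

theorem sin_mul_pi_ne_zero {s : ℝ} (h : ¬ ∃ n : ℤ, s = n) : Real.sin (s * Real.pi) ≠ 0 := by
  intro h0
  obtain ⟨n, hn⟩ := Real.sin_eq_zero_iff.mp h0
  exact h ⟨n, (mul_right_cancel₀ Real.pi_ne_zero hn).symm⟩

/-- At an integer order, nearby orders are not integers and the quotient there is Im H, which is
continuous in the order. -/
theorem besselY_eq_im_hankelH {s x : ℝ} (hs : -(1 / 2) < s) (hx : 0 < x) :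
    besselY s x = (hankelH s x).im := by
  unfold besselY
  split_ifs with h
  · refine Tendsto.limUnder_eq ?_
    have hc : Tendsto (fun s => (hankelH s x).im) (𝓝[≠] s) (𝓝 (hankelH s x).im) :=
      (Complex.continuous_im.continuousAt.comp
        (continuousAt_hankelH_order hs hx)).tendsto.mono_left nhdsWithin_le_nhds
    refine hc.congr' ?_
    obtain ⟨n, rfl⟩ := h
    have h1 : ∀ᶠ t in 𝓝[≠] (n : ℝ), t ∈ Ioo ((n : ℝ) - 1) (n + 1) :=
      nhdsWithin_le_nhds (Ioo_mem_nhds (by linarith) (by linarith))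
    have h2 : ∀ᶠ t in 𝓝[≠] (n : ℝ), -(1 / 2) < t :=
      nhdsWithin_le_nhds (lt_mem_nhds hs)
    filter_upwards [h1, h2, self_mem_nhdsWithin] with t ht1 ht2 ht3
    refine (besselYQuot_eq_im_hankelH ht2 (sin_mul_pi_ne_zero ?_) hx).symm
    rintro ⟨m, rfl⟩
    have a1 : n - 1 < m := by exact_mod_cast ht1.1
    have a2 : m < n + 1 := by exact_mod_cast ht1.2
    exact ht3 (by rw [mem_singleton_iff]; congr 1; omega)
  · exact besselYQuot_eq_im_hankelH hs (sin_mul_pi_ne_zero h) hx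

theorem hankelH_ne_zero {s x : ℝ} (hs : -(1 / 2) < s) (hx : 0 < x) : hankelH s x ≠ 0 := by
  intro h
  have := hankel_wronskian hs hx
  simp [h] at this

/-- Its positivity says that H turns counterclockwise; every monotonicity statement about phases
below rests on it. -/
theorem im_hankelD_mul_conj {s x : ℝ} (hs : -(1 / 2) < s) (hx : 0 < x) :
    x * (hankelD s x * (starRingEnd ℂ) (hankelH s x)).im = 2 / Real.pi := by
  have h := congrArg Complex.im (hankel_wronskian hs hx)
  have e : (4 / Real.pi * Complex.I : ℂ) = ((4 / Real.pi : ℝ) : ℂ) * Complex.I := by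
    push_cast; ring
  rw [e] at h
  simp only [Complex.mul_im, Complex.mul_re, Complex.sub_im, Complex.sub_re, Complex.ofReal_re,
    Complex.ofReal_im, Complex.conj_re, Complex.conj_im, Complex.I_re, Complex.I_im] at h ⊢
  linear_combination h / 2

/-! ### The continuous phase of the Hankel function -/

/-- `θ` is the continuous phase of the Hankel function `H_ν` on the positive half-line which
starts at `-π/2`. -/
structure IsHankelPhase (ν : ℝ) (θ : ℝ → ℝ) : Prop where
  eq_exp : ∀ x : ℝ, 0 < x → hankelH ν x = ‖hankelH ν x‖ * Complex.exp (θ x * Complex.I)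
  differentiableAt : ∀ x : ℝ, 0 < x → DifferentiableAt ℝ θ x
  near_zero : ∀ᶠ x in 𝓝[>] (0 : ℝ), θ x ∈ Ioo (-(Real.pi / 2)) 0
  tendsto : Tendsto (fun x => θ x - x) atTop (𝓝 (-(ν * Real.pi / 2 + Real.pi / 4)))

theorem im_mul_laplaceInt (a : ℝ) {b x : ℝ} (hb : -1 < b) (hx : 0 < x) (c : ℂ) :
    (c * laplaceInt a b x).im = ∫ v in Ioi (0 : ℝ), (Real.exp (-(x * v)) * v ^ b) *
      (c * (1 + v / 2 * Complex.I : ℂ) ^ (a : ℂ)).im := by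
  have hi := (integrableOn_laplaceIntegrand a hb hx).const_mul c
  have := Complex.imCLM.integral_comp_comm hi
  simp only [Complex.imCLM_apply] at this
  rw [laplaceInt, ← integral_const_mul, ← this]
  refine setIntegral_congr_fun measurableSet_Ioi fun v _ => ?_
  rw [← Complex.im_ofReal_mul, laplaceIntegrand]
  congr 1
  ring

theorem im_mul_laplaceInt_nonpos {a b x : ℝ} (hb : -1 < b) (hx : 0 < x) {c : ℂ}
    (h : ∀ v : ℝ, 0 < v → (c * (1 + v / 2 * Complex.I : ℂ) ^ (a : ℂ)).im ≤ 0) :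
    (c * laplaceInt a b x).im ≤ 0 := by
  rw [im_mul_laplaceInt a hb hx]
  refine setIntegral_nonpos measurableSet_Ioi fun v hv => ?_
  have hv0 : (0 : ℝ) < v := hv
  exact mul_nonpos_of_nonneg_of_nonpos (by positivity) (h v hv0)

theorem exp_mul_cpow_im (a c v : ℝ) :
    (Complex.exp (c * Complex.I) * (1 + v / 2 * Complex.I : ℂ) ^ (a : ℂ)).im =
      ‖(1 + v / 2 * Complex.I : ℂ)‖ ^ a *
        Real.sin (c + (1 + v / 2 * Complex.I : ℂ).arg * a) := by
  rw [Complex.cpow_ofReal, mul_left_comm, Complex.im_ofReal_mul]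
  congr 1
  rw [Complex.mul_im, Complex.exp_ofReal_mul_I_re,
    Complex.exp_ofReal_mul_I_im, Real.sin_add]
  simp only [Complex.add_re, Complex.add_im, Complex.mul_re, Complex.mul_im, Complex.ofReal_re,
    Complex.ofReal_im, Complex.I_re, Complex.I_im]
  ring

theorem arg_one_add_mul_I_mem {v : ℝ} (hv : 0 < v) :
    (1 + v / 2 * Complex.I : ℂ).arg ∈ Icc 0 (Real.pi / 2) := by
  constructor
  · rw [Complex.arg_nonneg_iff]; simp; positivity
  · exact (abs_le.mp (Complex.abs_arg_le_pi_div_two_iff.mpr (by simp))).2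

/-- For |a| ≤ 1 the integrand stays in the closed right half-plane; the factor −i turns its real
part into minus an imaginary part. -/
theorem laplaceInt_re_nonneg {a b x : ℝ} (ha : |a| ≤ 1) (hb : -1 < b) (hx : 0 < x) :
    0 ≤ (laplaceInt a b x).re := by
  have h : (Complex.exp ((-(Real.pi / 2) : ℝ) * Complex.I) * laplaceInt a b x).im ≤ 0 := by
    refine im_mul_laplaceInt_nonpos hb hx fun v hv => ?_
    rw [exp_mul_cpow_im]
    have ht := arg_one_add_mul_I_mem hv
    set t := (1 + v / 2 * Complex.I : ℂ).arg
    have h1 : |t * a| ≤ Real.pi / 2 := by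
      rw [abs_mul, abs_of_nonneg ht.1]
      nlinarith [ht.1, ht.2, abs_nonneg a]
    rw [abs_le] at h1
    refine mul_nonpos_of_nonneg_of_nonpos (by positivity) ?_
    exact Real.sin_nonpos_of_nonpos_of_neg_pi_le (by linarith) (by linarith)
  have e : Complex.exp ((-(Real.pi / 2) : ℝ) * Complex.I) = -Complex.I := by
    rw [← Complex.exp_neg_pi_div_two_mul_I]; congr 1; push_cast; ring
  rw [e] at h
  simpa using h

theorem laplaceInt_ne_zero {s x : ℝ} (hs : -(1 / 2) < s) (hx : 0 < x) :
    laplaceInt (s - 1 / 2) (s - 1 / 2) x ≠ 0 := by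
  intro h
  apply hankelH_ne_zero hs hx
  rw [hankelH, h, mul_zero]

theorem mem_slitPlane_of_re_nonneg {z : ℂ} (h : 0 ≤ z.re) (h0 : z ≠ 0) : z ∈ Complex.slitPlane := by
  rcases h.lt_or_eq with h | h
  · exact Or.inl h
  · right
    intro hi
    exact h0 (Complex.ext h.symm hi)

theorem laplaceInt_arg_nonpos {a x : ℝ} (ha : -1 < a) (ha1 : a ≤ 0) (hx : 0 < x) :
    (laplaceInt a a x).arg ≤ 0 := by
  have h : (Complex.exp ((0 : ℝ) * Complex.I) * laplaceInt a a x).im ≤ 0 := by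
    refine im_mul_laplaceInt_nonpos ha hx fun v hv => ?_
    rw [exp_mul_cpow_im]
    have ht := arg_one_add_mul_I_mem hv
    refine mul_nonpos_of_nonneg_of_nonpos (by positivity) ?_
    exact Real.sin_nonpos_of_nonpos_of_neg_pi_le (by nlinarith [ht.1, ht.2])
      (by nlinarith [ht.1, ht.2, Real.pi_pos])
  simp only [Complex.ofReal_zero, zero_mul, Complex.exp_zero, one_mul] at h
  have h2 := laplaceInt_re_nonneg (a := a) (abs_le.mpr ⟨by linarith, by linarith⟩) ha hx
  have h3 := abs_le.mp (Complex.abs_arg_le_pi_div_two_iff.mpr h2)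
  by_contra hpos
  push Not at hpos
  have := Complex.sin_arg (laplaceInt a a x)
  have h4 : 0 < Real.sin (laplaceInt a a x).arg :=
    Real.sin_pos_of_pos_of_lt_pi hpos (by linarith [Real.pi_pos])
  rw [this] at h4
  have := div_nonpos_of_nonpos_of_nonneg h (norm_nonneg (laplaceInt a a x))
  linarith

/-- The integrand has argument between 0 and aπ/2, and the integral inherits this sector, tested by
rotating each bounding ray onto the real axis. -/
theorem laplaceInt_arg_mem {a x : ℝ} (ha : 0 ≤ a) (ha1 : a ≤ 1) (hx : 0 < x)
    (h0 : laplaceInt a a x ≠ 0) : (laplaceInt a a x).arg ∈ Icc 0 (a * (Real.pi / 2)) := by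
  have hpi := Real.pi_pos
  have h : (Complex.exp ((Real.pi : ℝ) * Complex.I) * laplaceInt a a x).im ≤ 0 := by
    refine im_mul_laplaceInt_nonpos (by linarith) hx fun v hv => ?_
    rw [exp_mul_cpow_im]
    have ht := arg_one_add_mul_I_mem hv
    refine mul_nonpos_of_nonneg_of_nonpos (by positivity) ?_
    rw [add_comm, Real.sin_add_pi, neg_nonpos]
    exact Real.sin_nonneg_of_nonneg_of_le_pi (mul_nonneg ht.1 ha)
      (by nlinarith [ht.1, ht.2])
  rw [Complex.exp_pi_mul_I] at h
  have him : 0 ≤ (laplaceInt a a x).im := by simpa using h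
  have hg : (Complex.exp ((-(a * (Real.pi / 2)) : ℝ) * Complex.I) * laplaceInt a a x).im ≤ 0 := by
    refine im_mul_laplaceInt_nonpos (by linarith) hx fun v hv => ?_
    rw [exp_mul_cpow_im]
    have ht := arg_one_add_mul_I_mem hv
    refine mul_nonpos_of_nonneg_of_nonpos (by positivity) ?_
    exact Real.sin_nonpos_of_nonpos_of_neg_pi_le (by nlinarith [ht.1, ht.2])
      (by nlinarith [ht.1, ht.2, mul_nonneg ht.1 ha])
  have h2 := laplaceInt_re_nonneg (a := a) (abs_le.mpr ⟨by linarith, by linarith⟩)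
    (show -1 < a by linarith) hx
  have h3 := abs_le.mp (Complex.abs_arg_le_pi_div_two_iff.mpr h2)
  refine ⟨Complex.arg_nonneg_iff.mpr him, ?_⟩
  by_contra hpos
  push Not at hpos
  rw [← Complex.norm_mul_exp_arg_mul_I (laplaceInt a a x), mul_left_comm, Complex.im_ofReal_mul,
    ← Complex.exp_add, ← add_mul, ← Complex.ofReal_add, Complex.exp_ofReal_mul_I_im] at hg
  have h4 := Real.sin_pos_of_pos_of_lt_pi
    (show 0 < -(a * (Real.pi / 2)) + (laplaceInt a a x).arg by linarith)
    (by nlinarith)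
  have := mul_pos (norm_pos_iff.mpr h0) h4
  linarith

theorem besselJ_pos_cos {ν : ℝ} {θ : ℝ → ℝ} (hν : 0 ≤ ν)
    (h : ∀ x : ℝ, 0 < x → hankelH ν x = ‖hankelH ν x‖ * Complex.exp (θ x * Complex.I)) :
    ∀ᶠ x in 𝓝[>] (0 : ℝ), 0 < Real.cos (θ x) := by
  filter_upwards [besselJ_pos_near_zero hν, self_mem_nhdsWithin] with x hx hx0
  have hx0' : (0 : ℝ) < x := hx0
  rw [besselJ_eq_re_hankelH (by linarith) hx0', h x hx0', Complex.re_ofReal_mul,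
    Complex.exp_ofReal_mul_I_re] at hx
  exact pos_of_mul_pos_right hx (norm_nonneg _)

theorem mem_Ioo_of_cos_pos {t : ℝ} (h1 : -(3 * Real.pi / 2) < t) (h2 : t < 0) (h : 0 < Real.cos t) :
    t ∈ Ioo (-(Real.pi / 2)) 0 := by
  refine ⟨?_, h2⟩
  by_contra hc
  push Not at hc
  have := Real.cos_nonpos_of_pi_div_two_le_of_le (x := -t) (by linarith) (by linarith)
  rw [Real.cos_neg] at this
  linarith

/-- Here |ν − 1/2| ≤ 1, so the Laplace integral never leaves the slit plane and its principal
argument is a continuous correction to x − (νπ/2 + π/4). Sector bounds put the phase in (−3π/2, 0)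
near 0, and J > 0 there, that is cos θ > 0, narrows this to (−π/2, 0). -/
theorem exists_hankelPhase_of_lt_one {ν : ℝ} (hν : 0 ≤ ν) (hν1 : ν < 1) :
    ∃ θ, IsHankelPhase ν θ := by
  have hpi := Real.pi_pos
  set a := ν - 1 / 2
  have ha : -1 < a := by simp only [a]; linarith
  have habs : |a| ≤ 1 := abs_le.mpr ⟨by simp only [a]; linarith, by simp only [a]; linarith⟩
  have hL0 : ∀ x : ℝ, 0 < x → laplaceInt a a x ≠ 0 := fun x hx => laplaceInt_ne_zero (by linarith) hx
  have hsl : ∀ x : ℝ, 0 < x → laplaceInt a a x ∈ Complex.slitPlane := fun x hx =>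
    mem_slitPlane_of_re_nonneg (laplaceInt_re_nonneg habs ha hx) (hL0 x hx)
  have heq : ∀ x : ℝ, 0 < x → hankelH ν x = ‖hankelH ν x‖ *
      Complex.exp ((x - (ν * Real.pi / 2 + Real.pi / 4) + (laplaceInt a a x).arg : ℝ) *
        Complex.I) := by
    intro x hx
    have g : 0 < Real.Gamma (ν + 1 / 2) := Real.Gamma_pos_of_pos (by linarith)
    have e : hankelH ν x = ((√(2 / Real.pi) / Real.Gamma (ν + 1 / 2) * x ^ ν *
        ‖laplaceInt a a x‖ : ℝ) : ℂ) *
        Complex.exp ((x - (ν * Real.pi / 2 + Real.pi / 4) + (laplaceInt a a x).arg : ℝ) *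
        Complex.I) := by
      rw [hankelH, hankelConst]
      change _ * laplaceInt a a x = _
      conv_lhs => rw [← Complex.norm_mul_exp_arg_mul_I (laplaceInt a a x)]
      rw [show ((x - (ν * Real.pi / 2 + Real.pi / 4) + (laplaceInt a a x).arg : ℝ) : ℂ) * Complex.I
        = -((ν * Real.pi / 2 + Real.pi / 4 : ℝ) : ℂ) * Complex.I + x * Complex.I +
          (laplaceInt a a x).arg * Complex.I by push_cast; ring, Complex.exp_add, Complex.exp_add]
      push_cast
      ring
    have hn : ‖hankelH ν x‖ = √(2 / Real.pi) / Real.Gamma (ν + 1 / 2) * x ^ ν *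
        ‖laplaceInt a a x‖ := by
      rw [e, norm_mul, Complex.norm_exp_ofReal_mul_I, mul_one, Complex.norm_real,
        Real.norm_of_nonneg (by positivity)]
    rw [hn]
    exact e
  refine ⟨fun x => x - (ν * Real.pi / 2 + Real.pi / 4) + (laplaceInt a a x).arg, heq, ?_, ?_, ?_⟩
  · intro x hx
    have d := (hasDerivAt_laplaceInt a ha hx).clog_real (hsl x hx)
    have d2 : DifferentiableAt ℝ (fun x => (Complex.log (laplaceInt a a x)).im) x :=
      Complex.imCLM.differentiableAt.comp x d.differentiableAt
    simp only [Complex.log_im] at d2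
    exact (differentiableAt_id.sub_const _).add d2
  · have h4 : ∀ᶠ x in 𝓝[>] (0 : ℝ), x < Real.pi / 4 :=
      nhdsWithin_le_nhds (gt_mem_nhds (by linarith))
    filter_upwards [besselJ_pos_cos hν heq, self_mem_nhdsWithin, h4] with x hx hx0 hx4
    have hx0' : (0 : ℝ) < x := hx0
    have h3 := abs_le.mp (Complex.abs_arg_le_pi_div_two_iff.mpr (laplaceInt_re_nonneg habs ha hx0'))
    refine mem_Ioo_of_cos_pos ?_ ?_ hx
    · nlinarith
    -- Negativity for x < π/4: if a ≤ 0 the correction is nonpositive; if a ≥ 0 it is at most aπ/2 =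
    -- νπ/2 − π/4, which leaves at most x − π/2.
    · rcases le_total a 0 with h | h
      · have := laplaceInt_arg_nonpos ha h hx0'
        nlinarith
      · have := (laplaceInt_arg_mem h (by linarith [(abs_le.mp habs).2]) hx0' (hL0 x hx0')).2
        simp only [a] at this ⊢
        nlinarith
  · have hG : (0 : ℝ) < Real.Gamma (a + 1) := Real.Gamma_pos_of_pos (by linarith)
    have t := tendsto_laplaceInt a ha
    have hsG : ((Real.Gamma (a + 1) : ℝ) : ℂ) ∈ Complex.slitPlane := by left; simpa using hG
    have t2 := (Complex.continuousAt_arg hsG).tendsto.comp t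
    rw [Complex.arg_ofReal_of_nonneg hG.le] at t2
    have t3 := t2.add_const (-(ν * Real.pi / 2 + Real.pi / 4))
    rw [zero_add] at t3
    refine t3.congr' ?_
    filter_upwards [eventually_gt_atTop 0] with x hx
    simp only [Function.comp_apply]
    rw [Complex.arg_real_mul _ (by positivity)]
    ring

/-- H_{ν+1}/H_ν = ν/x − H_ν'/H_ν, and the Wronskian makes the imaginary part of H_ν'/H_ν positive.
-/
theorem hankelH_div_im_neg {ν x : ℝ} (hν : -(1 / 2) < ν) (hx : 0 < x) :
    (hankelH (ν + 1) x / hankelH ν x).im < 0 := by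
  have h0 := hankelH_ne_zero hν hx
  have h := im_hankelD_mul_conj hν hx
  have hx0 : (x : ℂ) ≠ 0 := by exact_mod_cast hx.ne'
  have e : hankelH (ν + 1) x / hankelH ν x = ((ν / x : ℝ) : ℂ) -
      ((‖hankelH ν x‖ ^ 2)⁻¹ : ℝ) * (hankelD ν x * (starRingEnd ℂ) (hankelH ν x)) := by
    rw [hankelH_add_one hν hx, ← Complex.normSq_eq_norm_sq, sub_div, Complex.ofReal_inv,
      ← Complex.mul_conj]
    have h1 : (starRingEnd ℂ) (hankelH ν x) ≠ 0 := by simpa using h0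
    push_cast
    field_simp
  rw [e, Complex.sub_im, Complex.ofReal_im, Complex.im_ofReal_mul, zero_sub, neg_neg_iff_pos]
  have hp : 0 < x * (hankelD ν x * (starRingEnd ℂ) (hankelH ν x)).im := by
    rw [h]; have := Real.pi_pos; positivity
  have := pos_of_mul_pos_right hp hx.le
  have h2 : 0 < ‖hankelH ν x‖ := norm_pos_iff.mpr h0
  positivity

/-- The added argument lies in (−π, 0) and tends to −π/2 at infinity, exactly the shift of the
limit. Near 0 the new phase is in (−3π/2, 0), and positivity of J_{ν+1} leaves only (−π/2, 0), so no
multiple of 2π is lost. -/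
theorem IsHankelPhase.succ {ν : ℝ} {θ : ℝ → ℝ} (hν : 0 ≤ ν) (h : IsHankelPhase ν θ) :
    IsHankelPhase (ν + 1) (fun x => θ x + (hankelH (ν + 1) x / hankelH ν x).arg) := by
  have hpi := Real.pi_pos
  have hν' : -(1 / 2) < ν := by linarith
  have hν1 : -(1 / 2) < ν + 1 := by linarith
  have heq : ∀ x : ℝ, 0 < x → hankelH (ν + 1) x = ‖hankelH (ν + 1) x‖ *
      Complex.exp ((θ x + (hankelH (ν + 1) x / hankelH ν x).arg : ℝ) * Complex.I) := by
    intro x hx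
    have h0 := hankelH_ne_zero hν' hx
    have e := Complex.norm_mul_exp_arg_mul_I (hankelH (ν + 1) x / hankelH ν x)
    have hn : ((‖hankelH ν x‖ : ℝ) : ℂ) ≠ 0 := by simpa using h0
    have e2 : hankelH (ν + 1) x = hankelH (ν + 1) x / hankelH ν x * hankelH ν x := by
      field_simp
    calc hankelH (ν + 1) x = hankelH (ν + 1) x / hankelH ν x * hankelH ν x := e2
      _ = (‖hankelH (ν + 1) x / hankelH ν x‖ *
          Complex.exp ((hankelH (ν + 1) x / hankelH ν x).arg * Complex.I)) *
          (‖hankelH ν x‖ * Complex.exp (θ x * Complex.I)) := by rw [e, ← h.eq_exp x hx]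
      _ = _ := by
        rw [norm_div, Complex.ofReal_add, add_mul, Complex.exp_add, Complex.ofReal_div]
        field_simp
  refine ⟨heq, ?_, ?_, ?_⟩
  · intro x hx
    have d := ((hasDerivAt_hankelH hν1 hx).fun_div (hasDerivAt_hankelH hν' hx)
      (hankelH_ne_zero hν' hx)).clog_real (Or.inr (hankelH_div_im_neg hν' hx).ne)
    have d2 : DifferentiableAt ℝ
        (fun x => (Complex.log (hankelH (ν + 1) x / hankelH ν x)).im) x :=
      Complex.imCLM.differentiableAt.comp x d.differentiableAt
    simp only [Complex.log_im] at d2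
    exact (h.differentiableAt x hx).add d2
  · filter_upwards [besselJ_pos_cos (by linarith : (0 : ℝ) ≤ ν + 1) heq, self_mem_nhdsWithin,
      h.near_zero] with x hx hx0 hθ
    have hx0' : (0 : ℝ) < x := hx0
    have h1 := Complex.neg_pi_lt_arg (hankelH (ν + 1) x / hankelH ν x)
    have h2 := Complex.arg_neg_iff.mpr (hankelH_div_im_neg hν' hx0')
    exact mem_Ioo_of_cos_pos (by linarith [hθ.1]) (by linarith [hθ.2]) hx
  · have hP : hankelPhase ν ≠ 0 := by
      unfold hankelPhase
      refine mul_ne_zero ?_ (Complex.exp_ne_zero _)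
      exact_mod_cast (Real.sqrt_pos.mpr (by positivity)).ne'
    have t1 := (tendsto_hankelH hν1).div (tendsto_hankelH hν') hP
    have e : hankelPhase (ν + 1) / hankelPhase ν = -Complex.I := by
      rw [hankelPhase_add_one]; field_simp
    rw [e] at t1
    have hsl : -Complex.I ∈ Complex.slitPlane := by right; simp
    have t2 := (Complex.continuousAt_arg hsl).tendsto.comp t1
    rw [Complex.arg_neg_I] at t2
    have t3 := h.tendsto.add t2
    rw [show -(ν * Real.pi / 2 + Real.pi / 4) + -(Real.pi / 2) =
      -((ν + 1) * Real.pi / 2 + Real.pi / 4) by ring] at t3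
    refine t3.congr' ?_
    filter_upwards [eventually_gt_atTop 0] with x hx
    have hq : ((√x : ℝ) : ℂ) ≠ 0 := by exact_mod_cast (Real.sqrt_pos.mpr hx).ne'
    simp only [Function.comp_apply, Pi.div_apply]
    rw [mul_div_mul_left _ _ hq, mul_div_mul_left _ _ (Complex.exp_ne_zero _)]
    ring

theorem exists_hankelPhase {ν : ℝ} (hν : 0 ≤ ν) : ∃ θ, IsHankelPhase ν θ := by
  have key : ∀ n : ℕ, ∀ t : ℝ, 0 ≤ t → t < 1 → ∃ θ, IsHankelPhase (t + n) θ := by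
    intro n
    induction n with
    | zero => intro t h0 h1; simpa using exists_hankelPhase_of_lt_one h0 h1
    | succ n ih =>
      intro t h0 h1
      obtain ⟨θ, h⟩ := ih t h0 h1
      refine ⟨fun x => θ x + (hankelH (t + n + 1) x / hankelH (t + n) x).arg, ?_⟩
      have := h.succ (by positivity)
      push_cast
      rw [← add_assoc]
      exact this
  have := key ⌊ν⌋₊ (ν - ⌊ν⌋₊) (by linarith [Nat.floor_le hν]) (by linarith [Nat.lt_floor_add_one ν])
  simpa using this

/-- W·e^(-iψ) is real, so the derivative of its imaginary part vanishes; this is solved for ψ'. -/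
theorem deriv_phase {W : ℝ → ℂ} {ψ : ℝ → ℝ} {W' : ℂ} {x : ℝ} (hW : HasDerivAt W W' x)
    (h0 : W x ≠ 0) (heq : ∀ᶠ y in 𝓝 x, W y = ‖W y‖ * Complex.exp (ψ y * Complex.I))
    (hψ : DifferentiableAt ℝ ψ x) :
    deriv ψ x = (W' * (starRingEnd ℂ) (W x)).im / ‖W x‖ ^ 2 := by
  have hd := hψ.hasDerivAt
  have hE : HasDerivAt (fun y : ℝ => Complex.exp (-(ψ y * Complex.I)))
      (Complex.exp (-(ψ x * Complex.I)) * -((deriv ψ x : ℝ) * Complex.I)) x :=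
    ((hd.ofReal_comp.mul_const Complex.I).fun_neg).cexp
  have h1 := hW.fun_mul hE
  have him : HasDerivAt (fun y : ℝ => (W y * Complex.exp (-(ψ y * Complex.I))).im)
      (W' * Complex.exp (-(ψ x * Complex.I)) + W x *
        (Complex.exp (-(ψ x * Complex.I)) * -((deriv ψ x : ℝ) * Complex.I))).im x :=
    Complex.imCLM.hasFDerivAt.comp_hasDerivAt x h1
  have hz : HasDerivAt (fun y : ℝ => (W y * Complex.exp (-(ψ y * Complex.I))).im) 0 x := by
    refine (hasDerivAt_const x (0 : ℝ)).congr_of_eventuallyEq ?_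
    filter_upwards [heq] with y hy
    rw [hy, mul_assoc, ← Complex.exp_add]
    simp
  have e := him.unique hz
  have hEE : Complex.exp (ψ x * Complex.I) * Complex.exp (-(ψ x * Complex.I)) = 1 := by
    rw [← Complex.exp_add]; simp
  have hr : 0 < ‖W x‖ := norm_pos_iff.mpr h0
  have hH := heq.self_of_nhds
  have hc : (starRingEnd ℂ) (W x) = (‖W x‖ : ℝ) * Complex.exp (-(ψ x * Complex.I)) := by
    conv_lhs => rw [hH, map_mul, Complex.conj_ofReal, ← Complex.exp_conj]
    simp
  have e2 : W' * Complex.exp (-(ψ x * Complex.I)) + W x *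
        (Complex.exp (-(ψ x * Complex.I)) * -((deriv ψ x : ℝ) * Complex.I)) =
        W' * Complex.exp (-(ψ x * Complex.I)) -
          ((‖W x‖ * deriv ψ x : ℝ) : ℂ) * Complex.I := by
    push_cast
    linear_combination (-(‖W x‖ : ℂ) * ((deriv ψ x : ℝ) : ℂ) * Complex.I) * hEE -
      (Complex.exp (-(ψ x * Complex.I)) * ((deriv ψ x : ℝ) : ℂ) * Complex.I) * hH
  rw [e2, Complex.sub_im, Complex.im_ofReal_mul, Complex.I_im, mul_one, sub_eq_zero] at e
  rw [hc, mul_left_comm, Complex.im_ofReal_mul, e]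
  field_simp

section

variable {ν : ℝ} {θ : ℝ → ℝ}

theorem IsHankelPhase.besselJ_eq (h : IsHankelPhase ν θ) (hν : 0 ≤ ν) {x : ℝ} (hx : 0 < x) :
    besselJ ν x = ‖hankelH ν x‖ * Real.cos (θ x) := by
  rw [besselJ_eq_re_hankelH (by linarith) hx, h.eq_exp x hx, Complex.re_ofReal_mul,
    Complex.exp_ofReal_mul_I_re, ← h.eq_exp x hx]

theorem IsHankelPhase.besselY_eq (h : IsHankelPhase ν θ) (hν : 0 ≤ ν) {x : ℝ} (hx : 0 < x) :
    besselY ν x = ‖hankelH ν x‖ * Real.sin (θ x) := by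
  rw [besselY_eq_im_hankelH (by linarith) hx, h.eq_exp x hx, Complex.im_ofReal_mul,
    Complex.exp_ofReal_mul_I_im, ← h.eq_exp x hx]

theorem IsHankelPhase.deriv_pos (h : IsHankelPhase ν θ) (hν : 0 ≤ ν) {x : ℝ} (hx : 0 < x) :
    0 < deriv θ x := by
  have hν' : -(1 / 2) < ν := by linarith
  have h0 := hankelH_ne_zero hν' hx
  rw [deriv_phase (hasDerivAt_hankelH hν' hx) h0
    (by filter_upwards [lt_mem_nhds hx] with y hy using h.eq_exp y hy) (h.differentiableAt x hx)]
  have hp : 0 < x * (hankelD ν x * (starRingEnd ℂ) (hankelH ν x)).im := by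
    rw [im_hankelD_mul_conj hν' hx]; have := Real.pi_pos; positivity
  have := pos_of_mul_pos_right hp hx.le
  have h2 : 0 < ‖hankelH ν x‖ := norm_pos_iff.mpr h0
  positivity

theorem IsHankelPhase.continuousOn (h : IsHankelPhase ν θ) : ContinuousOn θ (Ioi 0) :=
  fun x hx => (h.differentiableAt x hx).continuousAt.continuousWithinAt

theorem IsHankelPhase.strictMonoOn (h : IsHankelPhase ν θ) (hν : 0 ≤ ν) :
    StrictMonoOn θ (Ioi 0) :=
  strictMonoOn_of_deriv_pos (convex_Ioi 0) h.continuousOn fun x hx => by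
    rw [interior_Ioi] at hx
    exact h.deriv_pos hν hx

theorem IsHankelPhase.gt (h : IsHankelPhase ν θ) (hν : 0 ≤ ν) {x : ℝ} (hx : 0 < x) :
    -(Real.pi / 2) < θ x := by
  have h1 : ∀ᶠ y in 𝓝[>] (0 : ℝ), y ∈ Ioo 0 x := Ioo_mem_nhdsGT hx
  obtain ⟨y, hy1, hy2⟩ := (h.near_zero.and h1).exists
  exact hy1.1.trans (h.strictMonoOn hν hy2.1 hx hy2.2)

theorem IsHankelPhase.tendsto_atTop (h : IsHankelPhase ν θ) : Tendsto θ atTop atTop := by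
  have := h.tendsto.add_atTop tendsto_id
  refine this.congr fun x => ?_
  simp

theorem IsHankelPhase.exists_eq (h : IsHankelPhase ν θ) {t : ℝ} (ht : 0 ≤ t) :
    ∃ x : ℝ, 0 < x ∧ θ x = t := by
  have h1 : ∀ᶠ y in 𝓝[>] (0 : ℝ), 0 < y := self_mem_nhdsWithin
  obtain ⟨y, hy1, hy2⟩ := (h.near_zero.and h1).exists
  obtain ⟨z, hz1, hz2⟩ := ((h.tendsto_atTop.eventually_ge_atTop t).and
    (eventually_ge_atTop y)).exists
  obtain ⟨x, hx, hxt⟩ := intermediate_value_Icc hz2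
    (h.continuousOn.mono fun w hw => lt_of_lt_of_le hy2 hw.1) ⟨by linarith [hy1.2], hz1⟩
  exact ⟨x, lt_of_lt_of_le hy2 hx.1, hxt⟩

end

/-! ### The combination xH' − δH and its phase -/

/-- The complex combination `x H' - δ H`, whose real and imaginary parts are, up to the factor
`x ^ (δ + 1)`, the derivatives of the two ultraspherical Bessel functions. -/
noncomputable def ultraHankelD (ν δ x : ℝ) : ℂ := x * hankelD ν x - δ * hankelH ν x

theorem hasDerivAt_ultraHankelD {ν x : ℝ} (hν : -(1 / 2) < ν) (δ : ℝ) (hx : 0 < x) :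
    HasDerivAt (ultraHankelD ν δ)
      (((ν ^ 2 - x ^ 2) / x : ℂ) * hankelH ν x - δ * hankelD ν x) x :=
  (hasDerivAt_mul_hankelD hν hx).sub ((hasDerivAt_hankelH hν hx).const_mul (δ : ℂ))

theorem hasDerivAt_besselJ_re {ν x : ℝ} (hν : -(1 / 2) < ν) (hx : 0 < x) :
    HasDerivAt (besselJ ν) (hankelD ν x).re x := by
  have h : HasDerivAt (fun y : ℝ => (hankelH ν y).re) (hankelD ν x).re x :=
    Complex.reCLM.hasFDerivAt.comp_hasDerivAt x (hasDerivAt_hankelH hν hx)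
  refine h.congr_of_eventuallyEq ?_
  filter_upwards [lt_mem_nhds hx] with y hy using besselJ_eq_re_hankelH hν hy

theorem hasDerivAt_besselY_im {ν x : ℝ} (hν : -(1 / 2) < ν) (hx : 0 < x) :
    HasDerivAt (besselY ν) (hankelD ν x).im x := by
  have h : HasDerivAt (fun y : ℝ => (hankelH ν y).im) (hankelD ν x).im x :=
    Complex.imCLM.hasFDerivAt.comp_hasDerivAt x (hasDerivAt_hankelH hν hx)
  refine h.congr_of_eventuallyEq ?_
  filter_upwards [lt_mem_nhds hx] with y hy using besselY_eq_im_hankelH hν hy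

theorem deriv_rpow_mul_eq_zero_iff {f : ℝ → ℝ} {f' x : ℝ} (δ : ℝ) (hf : HasDerivAt f f' x)
    (hx : 0 < x) : deriv (fun y => y ^ (-δ) * f y) x = 0 ↔ x * f' - δ * f x = 0 := by
  have h := ((Real.hasDerivAt_rpow_const (p := -δ) (Or.inl hx.ne')).fun_mul hf).deriv
  have hp : 0 < x ^ (-δ - 1) := Real.rpow_pos_of_pos hx _
  have e : x ^ (-δ) = x ^ (-δ - 1) * x := by
    rw [← Real.rpow_add_one hx.ne']; ring_nf
  rw [h, e, show -δ * x ^ (-δ - 1) * f x + x ^ (-δ - 1) * x * f' =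
    x ^ (-δ - 1) * (x * f' - δ * f x) by ring, mul_eq_zero]
  simp [hp.ne']

theorem ultraHankelD_re (ν δ x : ℝ) :
    (ultraHankelD ν δ x).re = x * (hankelD ν x).re - δ * (hankelH ν x).re := by
  simp [ultraHankelD]

theorem ultraHankelD_im (ν δ x : ℝ) :
    (ultraHankelD ν δ x).im = x * (hankelD ν x).im - δ * (hankelH ν x).im := by
  simp [ultraHankelD]

theorem deriv_ultraJ_eq_zero_iff {ν x : ℝ} (hν : -(1 / 2) < ν) (δ : ℝ) (hx : 0 < x) :
    deriv (ultraJ ν δ) x = 0 ↔ (ultraHankelD ν δ x).re = 0 := by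
  rw [ultraHankelD_re, ← besselJ_eq_re_hankelH hν hx]
  exact deriv_rpow_mul_eq_zero_iff δ (hasDerivAt_besselJ_re hν hx) hx

theorem deriv_ultraY_eq_zero_iff {ν x : ℝ} (hν : -(1 / 2) < ν) (δ : ℝ) (hx : 0 < x) :
    deriv (ultraY ν δ) x = 0 ↔ (ultraHankelD ν δ x).im = 0 := by
  rw [ultraHankelD_im, ← besselY_eq_im_hankelH hν hx]
  exact deriv_rpow_mul_eq_zero_iff δ (hasDerivAt_besselY_im hν hx) hx

theorem ultraHankelD_re_eq {ν x : ℝ} (hν : -(1 / 2) < ν) (δ : ℝ) (hx : 0 < x) :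
    (ultraHankelD ν δ x).re = (ν - δ) * besselJ ν x - x * besselJ (ν + 1) x := by
  rw [ultraHankelD_re, ← besselJ_eq_re_hankelH hν hx,
    (hasDerivAt_besselJ_re hν hx).unique (hasDerivAt_besselJ hx)]
  field_simp
  ring

/-- In (ν − δ)J_ν − xJ_{ν+1} the first term is nonpositive and the second strictly negative, so the
borderline δ = ν belongs to this case, as in the convention that counts 0 as a zero. -/
theorem ultraHankelD_re_neg_near_zero {ν δ : ℝ} (hν : 0 ≤ ν) (hδ : ν ≤ δ) :
    ∀ᶠ x in 𝓝[>] (0 : ℝ), (ultraHankelD ν δ x).re < 0 := by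
  filter_upwards [besselJ_pos_near_zero hν, besselJ_pos_near_zero (show 0 ≤ ν + 1 by linarith),
    self_mem_nhdsWithin] with x h1 h2 hx
  have hx0 : (0 : ℝ) < x := hx
  rw [ultraHankelD_re_eq (by linarith) δ hx0]
  nlinarith [mul_pos hx0 h2]

theorem ultraHankelD_re_pos_near_zero {ν δ : ℝ} (hν : 0 ≤ ν) (hδ : δ < ν) :
    ∀ᶠ x in 𝓝[>] (0 : ℝ), 0 < (ultraHankelD ν δ x).re := by
  have hc : Continuous fun x : ℝ => (ν - δ) * besselE ν ((x / 2) ^ 2) -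
      x ^ 2 / 2 * besselE (ν + 1) ((x / 2) ^ 2) := by
    have h1 := continuous_besselE ν
    have h2 := continuous_besselE (ν + 1)
    fun_prop
  have h0 : 0 < (ν - δ) * besselE ν (((0 : ℝ) / 2) ^ 2) -
      0 ^ 2 / 2 * besselE (ν + 1) ((0 / 2) ^ 2) := by
    have : (0 : ℝ) < Real.Gamma (ν + 1) := Real.Gamma_pos_of_pos (by linarith)
    have h : 0 < ν - δ := by linarith
    rw [show ((0 : ℝ) / 2) ^ 2 = 0 by norm_num, besselE_zero]
    simp only [ne_eq, OfNat.ofNat_ne_zero, not_false_eq_true, zero_pow, zero_div, zero_mul, sub_zero]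
    positivity
  have h := hc.continuousAt.eventually (lt_mem_nhds h0)
  filter_upwards [nhdsWithin_le_nhds h, self_mem_nhdsWithin] with x h1 hx
  have hx0 : (0 : ℝ) < x := hx
  rw [ultraHankelD_re_eq (by linarith) δ hx0, besselJ_eq hx0, besselJ_eq hx0,
    Real.rpow_add_one (by positivity)]
  have hp : 0 < (x / 2) ^ ν := by positivity
  calc (0 : ℝ) < (x / 2) ^ ν * _ := mul_pos hp h1
    _ = _ := by ring

/-- W/H = xH'/H − δ, and the real number δ does not affect the imaginary part. -/
theorem im_ultraHankelD_div {ν x : ℝ} (hν : -(1 / 2) < ν) (δ : ℝ) (hx : 0 < x) :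
    0 < (ultraHankelD ν δ x / hankelH ν x).im := by
  have h0 := hankelH_ne_zero hν hx
  have h := im_hankelD_mul_conj hν hx
  have h1 : (starRingEnd ℂ) (hankelH ν x) ≠ 0 := by simpa using h0
  have e : ultraHankelD ν δ x / hankelH ν x =
      ((‖hankelH ν x‖ ^ 2)⁻¹ : ℝ) * (x * (hankelD ν x * (starRingEnd ℂ) (hankelH ν x))) - (δ : ℝ) := by
    rw [ultraHankelD, ← Complex.normSq_eq_norm_sq, sub_div, Complex.ofReal_inv, ← Complex.mul_conj]
    field_simp
  rw [e, Complex.sub_im, Complex.ofReal_im, Complex.im_ofReal_mul, Complex.im_ofReal_mul, h, sub_zero]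
  have := norm_pos_iff.mpr h0
  have := Real.pi_pos
  positivity

theorem ultraHankelD_ne_zero {ν x : ℝ} (hν : -(1 / 2) < ν) (δ : ℝ) (hx : 0 < x) :
    ultraHankelD ν δ x ≠ 0 := by
  intro h
  have := im_ultraHankelD_div hν δ hx
  simp [h] at this

/-- By Bessel's equation W and W' are real combinations of H and H', so only Im(H'·conj H) survives,
times a determinant. The sign of x² − (ν² − δ²) governs the monotonicity of ψ. -/
theorem im_deriv_ultraHankelD_mul_conj {ν x : ℝ} (hν : -(1 / 2) < ν) (δ : ℝ) (hx : 0 < x) :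
    ((((ν ^ 2 - x ^ 2) / x : ℂ) * hankelH ν x - δ * hankelD ν x) *
      (starRingEnd ℂ) (ultraHankelD ν δ x)).im = (x ^ 2 - (ν ^ 2 - δ ^ 2)) * (2 / Real.pi / x) := by
  have h := im_hankelD_mul_conj hν hx
  rw [← h, mul_div_cancel_left₀ _ hx.ne',
    show ((ν ^ 2 - x ^ 2) / x : ℂ) = (((ν ^ 2 - x ^ 2) / x : ℝ) : ℂ) by push_cast; rfl]
  simp only [ultraHankelD, map_sub, map_mul, Complex.conj_ofReal, Complex.mul_im, Complex.sub_im,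
    Complex.sub_re, Complex.mul_re, Complex.conj_re, Complex.conj_im, Complex.ofReal_re,
    Complex.ofReal_im]
  field_simp
  ring

/-- The continuous phase of `ultraHankelD ν δ` which lies between `θ` and `θ + π`. -/
noncomputable def ultraPhase (ν δ : ℝ) (θ : ℝ → ℝ) (x : ℝ) : ℝ :=
  θ x + (ultraHankelD ν δ x / hankelH ν x).arg

section

variable {ν : ℝ} {θ : ℝ → ℝ}

theorem ultraPhase_gt (hν : -(1 / 2) < ν) (δ : ℝ) {x : ℝ} (hx : 0 < x) :
    θ x < ultraPhase ν δ θ x := by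
  have h := im_ultraHankelD_div hν δ hx
  have h1 : (ultraHankelD ν δ x / hankelH ν x).arg ≠ 0 := by
    intro h0
    rw [Complex.arg_eq_zero_iff] at h0
    linarith [h0.2]
  have h2 := Complex.arg_nonneg_iff.mpr h.le
  have := lt_of_le_of_ne h2 h1.symm
  unfold ultraPhase
  linarith

theorem ultraPhase_lt (hν : -(1 / 2) < ν) (δ : ℝ) {x : ℝ} (hx : 0 < x) :
    ultraPhase ν δ θ x < θ x + Real.pi := by
  have h := im_ultraHankelD_div hν δ hx
  have := Complex.arg_lt_pi_iff.mpr (Or.inr h.ne')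
  unfold ultraPhase
  linarith

theorem IsHankelPhase.ultra_eq_exp (h : IsHankelPhase ν θ) (hν : -(1 / 2) < ν) (δ : ℝ) {x : ℝ}
    (hx : 0 < x) : ultraHankelD ν δ x =
      ‖ultraHankelD ν δ x‖ * Complex.exp (ultraPhase ν δ θ x * Complex.I) := by
  have h0 := hankelH_ne_zero hν hx
  have hn : ((‖hankelH ν x‖ : ℝ) : ℂ) ≠ 0 := by simpa using h0
  calc ultraHankelD ν δ x = ultraHankelD ν δ x / hankelH ν x * hankelH ν x := by field_simp
    _ = (‖ultraHankelD ν δ x / hankelH ν x‖ *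
        Complex.exp ((ultraHankelD ν δ x / hankelH ν x).arg * Complex.I)) *
        (‖hankelH ν x‖ * Complex.exp (θ x * Complex.I)) := by
      rw [Complex.norm_mul_exp_arg_mul_I, ← h.eq_exp x hx]
    _ = _ := by
      rw [ultraPhase, norm_div, Complex.ofReal_add, add_mul, Complex.exp_add, Complex.ofReal_div]
      field_simp

theorem IsHankelPhase.ultra_re (h : IsHankelPhase ν θ) (hν : -(1 / 2) < ν) (δ : ℝ) {x : ℝ}
    (hx : 0 < x) : (ultraHankelD ν δ x).re =
      ‖ultraHankelD ν δ x‖ * Real.cos (ultraPhase ν δ θ x) := by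
  have := congrArg Complex.re (h.ultra_eq_exp hν δ hx)
  rwa [Complex.re_ofReal_mul, Complex.exp_ofReal_mul_I_re] at this

theorem IsHankelPhase.ultra_im (h : IsHankelPhase ν θ) (hν : -(1 / 2) < ν) (δ : ℝ) {x : ℝ}
    (hx : 0 < x) : (ultraHankelD ν δ x).im =
      ‖ultraHankelD ν δ x‖ * Real.sin (ultraPhase ν δ θ x) := by
  have := congrArg Complex.im (h.ultra_eq_exp hν δ hx)
  rwa [Complex.im_ofReal_mul, Complex.exp_ofReal_mul_I_im] at this

theorem IsHankelPhase.differentiableAt_ultraPhase (h : IsHankelPhase ν θ) (hν : -(1 / 2) < ν)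
    (δ : ℝ) {x : ℝ} (hx : 0 < x) : DifferentiableAt ℝ (ultraPhase ν δ θ) x := by
  have d := ((hasDerivAt_ultraHankelD hν δ hx).fun_div (hasDerivAt_hankelH hν hx)
    (hankelH_ne_zero hν hx)).clog_real (Or.inr (im_ultraHankelD_div hν δ hx).ne')
  have d2 : DifferentiableAt ℝ
      (fun x => (Complex.log (ultraHankelD ν δ x / hankelH ν x)).im) x :=
    Complex.imCLM.differentiableAt.comp x d.differentiableAt
  simp only [Complex.log_im] at d2
  exact (h.differentiableAt x hx).add d2

theorem IsHankelPhase.deriv_ultraPhase (h : IsHankelPhase ν θ) (hν : -(1 / 2) < ν)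
    (δ : ℝ) {x : ℝ} (hx : 0 < x) : deriv (ultraPhase ν δ θ) x =
      (x ^ 2 - (ν ^ 2 - δ ^ 2)) * (2 / Real.pi / x) / ‖ultraHankelD ν δ x‖ ^ 2 := by
  rw [deriv_phase (hasDerivAt_ultraHankelD hν δ hx) (ultraHankelD_ne_zero hν δ hx)
    (by filter_upwards [lt_mem_nhds hx] with y hy using h.ultra_eq_exp hν δ hy)
    (h.differentiableAt_ultraPhase hν δ hx), im_deriv_ultraHankelD_mul_conj hν δ hx]

theorem IsHankelPhase.continuousOn_ultraPhase (h : IsHankelPhase ν θ) (hν : -(1 / 2) < ν)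
    (δ : ℝ) : ContinuousOn (ultraPhase ν δ θ) (Ioi 0) :=
  fun _ hx => (h.differentiableAt_ultraPhase hν δ hx).continuousAt.continuousWithinAt

/-- `Real.sqrt` is 0 on negative numbers, so for |δ| ≥ ν this covers the whole half-line. -/
theorem IsHankelPhase.strictMonoOn_ultraPhase (h : IsHankelPhase ν θ) (hν : -(1 / 2) < ν)
    (δ : ℝ) : StrictMonoOn (ultraPhase ν δ θ) (Ioi 0 ∩ Ici √(ν ^ 2 - δ ^ 2)) := by
  refine strictMonoOn_of_deriv_pos ((convex_Ioi 0).inter (convex_Ici _))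
    ((h.continuousOn_ultraPhase hν δ).mono inter_subset_left) fun x hx => ?_
  rw [interior_inter, interior_Ioi, interior_Ici] at hx
  have hx0 : (0 : ℝ) < x := hx.1
  have h1 : ν ^ 2 - δ ^ 2 < x ^ 2 := (Real.sqrt_lt' hx0).mp hx.2
  rw [h.deriv_ultraPhase hν δ hx0]
  have := norm_pos_iff.mpr (ultraHankelD_ne_zero hν δ hx0)
  have := Real.pi_pos
  have : 0 < x ^ 2 - (ν ^ 2 - δ ^ 2) := by linarith
  positivity

theorem IsHankelPhase.strictAntiOn_ultraPhase (h : IsHankelPhase ν θ) (hν : -(1 / 2) < ν)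
    (δ : ℝ) : StrictAntiOn (ultraPhase ν δ θ) (Ioi 0 ∩ Iic √(ν ^ 2 - δ ^ 2)) := by
  refine strictAntiOn_of_deriv_neg ((convex_Ioi 0).inter (convex_Iic _))
    ((h.continuousOn_ultraPhase hν δ).mono inter_subset_left) fun x hx => ?_
  rw [interior_inter, interior_Ioi, interior_Iic] at hx
  have hx0 : (0 : ℝ) < x := hx.1
  have h1 : x ^ 2 < ν ^ 2 - δ ^ 2 := (Real.lt_sqrt hx0.le).mp hx.2
  rw [h.deriv_ultraPhase hν δ hx0]
  have := norm_pos_iff.mpr (ultraHankelD_ne_zero hν δ hx0)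
  have := Real.pi_pos
  have h2 : x ^ 2 - (ν ^ 2 - δ ^ 2) < 0 := by linarith
  exact div_neg_of_neg_of_pos (mul_neg_of_neg_of_pos h2 (by positivity)) (by positivity)

theorem IsHankelPhase.ultraPhase_lt_pi_near_zero (hν : -(1 / 2) < ν) (h : IsHankelPhase ν θ)
    (δ : ℝ) : ∀ᶠ x in 𝓝[>] (0 : ℝ), ultraPhase ν δ θ x ∈ Ioo (-(Real.pi / 2)) Real.pi := by
  filter_upwards [h.near_zero, self_mem_nhdsWithin] with x h1 hx
  exact ⟨h1.1.trans (ultraPhase_gt hν δ hx), (ultraPhase_lt hν δ hx).trans (by linarith [h1.2])⟩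

theorem IsHankelPhase.ultraPhase_lt_near_zero (h : IsHankelPhase ν θ) (hν : 0 ≤ ν) {δ : ℝ}
    (hδ : δ < ν) : ∀ᶠ x in 𝓝[>] (0 : ℝ), ultraPhase ν δ θ x < Real.pi / 2 := by
  have hν' : -(1 / 2) < ν := by linarith
  filter_upwards [h.ultraPhase_lt_pi_near_zero hν' δ, ultraHankelD_re_pos_near_zero hν hδ,
    self_mem_nhdsWithin] with x h1 h2 hx
  rw [h.ultra_re hν' δ hx] at h2
  have h3 := pos_of_mul_pos_right h2 (norm_nonneg _)
  by_contra hc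
  push Not at hc
  linarith [Real.cos_nonpos_of_pi_div_two_le_of_le hc (by linarith [h1.2, Real.pi_pos])]

theorem IsHankelPhase.ultraPhase_gt_near_zero (h : IsHankelPhase ν θ) (hν : 0 ≤ ν) {δ : ℝ}
    (hδ : ν ≤ δ) : ∀ᶠ x in 𝓝[>] (0 : ℝ), Real.pi / 2 < ultraPhase ν δ θ x := by
  have hν' : -(1 / 2) < ν := by linarith
  filter_upwards [h.ultraPhase_lt_pi_near_zero hν' δ, ultraHankelD_re_neg_near_zero hν hδ,
    self_mem_nhdsWithin] with x h1 h2 hx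
  rw [h.ultra_re hν' δ hx] at h2
  by_contra hc
  push Not at hc
  have := Real.cos_nonneg_of_neg_pi_div_two_le_of_le h1.1.le hc
  linarith [mul_nonneg (norm_nonneg (ultraHankelD ν δ x)) this]

/-- Where the phase is at least `π / 2` it is increasing. -/
theorem IsHankelPhase.sqrt_le_of_le_ultraPhase (h : IsHankelPhase ν θ) (hν : 0 ≤ ν) (δ : ℝ) {x : ℝ}
    (hx : 0 < x) (hψ : Real.pi / 2 ≤ ultraPhase ν δ θ x) :
    x ∈ Ioi 0 ∩ Ici √(ν ^ 2 - δ ^ 2) := by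
  refine ⟨hx, ?_⟩
  by_contra hc
  simp only [mem_Ici, not_le] at hc
  rcases lt_or_ge δ ν with hδ | hδ
  · obtain ⟨y, hy1, hy2⟩ := ((h.ultraPhase_lt_near_zero hν hδ).and (Ioo_mem_nhdsGT hx)).exists
    have := h.strictAntiOn_ultraPhase (by linarith) δ ⟨hy2.1, (hy2.2.trans hc).le⟩ ⟨hx, hc.le⟩ hy2.2
    linarith
  · rw [Real.sqrt_eq_zero_of_nonpos (by nlinarith)] at hc
    exact absurd hc (not_lt.mpr hx.le)

theorem IsHankelPhase.half_pi_lt_ultraPhase (h : IsHankelPhase ν θ) (hν : 0 ≤ ν) {δ : ℝ}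
    (hδ : ν ≤ δ) {x : ℝ} (hx : 0 < x) : Real.pi / 2 < ultraPhase ν δ θ x := by
  have h0 : √(ν ^ 2 - δ ^ 2) = 0 := Real.sqrt_eq_zero_of_nonpos (by nlinarith)
  obtain ⟨y, hy1, hy2⟩ := ((h.ultraPhase_gt_near_zero hν hδ).and (Ioo_mem_nhdsGT hx)).exists
  refine hy1.trans (h.strictMonoOn_ultraPhase (by linarith) δ ⟨hy2.1, ?_⟩ ⟨hx, ?_⟩ hy2.2)
  · rw [h0]; exact hy2.1.le
  · rw [h0]; exact hx.le

theorem IsHankelPhase.neg_half_pi_lt_ultraPhase (h : IsHankelPhase ν θ) (hν : 0 ≤ ν) (δ : ℝ)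
    {x : ℝ} (hx : 0 < x) : -(Real.pi / 2) < ultraPhase ν δ θ x :=
  (h.gt hν hx).trans (ultraPhase_gt (by linarith) δ hx)

theorem IsHankelPhase.tendsto_ultraPhase_atTop (h : IsHankelPhase ν θ) (hν : -(1 / 2) < ν)
    (δ : ℝ) : Tendsto (ultraPhase ν δ θ) atTop atTop := by
  refine tendsto_atTop_mono' _ ?_ h.tendsto_atTop
  filter_upwards [eventually_gt_atTop 0] with x hx using (ultraPhase_gt hν δ hx).le

theorem IsHankelPhase.exists_ultraPhase_eq (h : IsHankelPhase ν θ) (hν : -(1 / 2) < ν) (δ : ℝ)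
    {t : ℝ} (ht : ∀ᶠ x in 𝓝[>] (0 : ℝ), ultraPhase ν δ θ x < t) :
    ∃ x : ℝ, 0 < x ∧ ultraPhase ν δ θ x = t := by
  have h1 : ∀ᶠ y in 𝓝[>] (0 : ℝ), 0 < y := self_mem_nhdsWithin
  obtain ⟨y, hy1, hy2⟩ := (ht.and h1).exists
  obtain ⟨z, hz1, hz2⟩ := (((h.tendsto_ultraPhase_atTop hν δ).eventually_ge_atTop t).and
    (eventually_ge_atTop y)).exists
  obtain ⟨x, hx, hxt⟩ := intermediate_value_Icc hz2
    ((h.continuousOn_ultraPhase hν δ).mono fun w hw => lt_of_lt_of_le hy2 hw.1) ⟨hy1.le, hz1⟩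
  exact ⟨x, lt_of_lt_of_le hy2 hx.1, hxt⟩

/-- H'/H − δ/x tends to i, so an argument of π/2 is added to the limit of θ − x. This fixes the
constant in β'. -/
theorem IsHankelPhase.tendsto_ultraPhase (h : IsHankelPhase ν θ) (hν : -(1 / 2) < ν)
    (δ : ℝ) : Tendsto (fun x => ultraPhase ν δ θ x - (x - ν * Real.pi / 2 + Real.pi / 4))
      atTop (𝓝 0) := by
  have hP : hankelPhase ν ≠ 0 := by
    unfold hankelPhase
    refine mul_ne_zero ?_ (Complex.exp_ne_zero _)
    exact_mod_cast (Real.sqrt_pos.mpr (by have := Real.pi_pos; positivity)).ne'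
  have t1 := (tendsto_hankelD hν).div (tendsto_hankelH hν) hP
  have t0 : Tendsto (fun x : ℝ => ((δ / x : ℝ) : ℂ)) atTop (𝓝 ((0 : ℝ) : ℂ)) :=
    (Complex.continuous_ofReal.tendsto 0).comp (tendsto_const_nhds.div_atTop tendsto_id)
  have t2 := t1.sub t0
  rw [mul_div_cancel_right₀ _ hP, Complex.ofReal_zero, sub_zero] at t2
  have hsl : Complex.I ∈ Complex.slitPlane := by right; simp
  have t3 := (Complex.continuousAt_arg hsl).tendsto.comp t2
  rw [Complex.arg_I] at t3
  have t4 := (h.tendsto.add t3).add_const (ν * Real.pi / 2 - Real.pi / 4)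
  rw [show -(ν * Real.pi / 2 + Real.pi / 4) + Real.pi / 2 + (ν * Real.pi / 2 - Real.pi / 4) = 0 by
    ring] at t4
  refine t4.congr' ?_
  filter_upwards [eventually_gt_atTop 0] with x hx
  have hq : ((√x : ℝ) : ℂ) ≠ 0 := by exact_mod_cast (Real.sqrt_pos.mpr hx).ne'
  have hx0 : (x : ℂ) ≠ 0 := by exact_mod_cast hx.ne'
  have h0 := hankelH_ne_zero hν hx
  have e : hankelD ν x / hankelH ν x - ((δ / x : ℝ) : ℂ) =
      ((x⁻¹ : ℝ) : ℂ) * (ultraHankelD ν δ x / hankelH ν x) := by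
    rw [ultraHankelD]
    push_cast
    field_simp
  simp only [Function.comp_apply, Pi.div_apply]
  rw [mul_div_mul_left _ _ hq, mul_div_mul_left _ _ (Complex.exp_ne_zero _), e,
    Complex.arg_real_mul _ (by positivity), ultraPhase]
  ring

end

/-! ### Enumeration of the zeros by the levels of the phase -/

theorem isKth_of_strictMono {u : ℕ → ℝ} (hu : StrictMono u) (n : ℕ) :
    IsKth (range u) (n + 1) (u n) := by
  have e : {t | t ∈ range u ∧ t < u n} = u '' (Finset.range n : Set ℕ) := by
    ext t
    constructor
    · rintro ⟨⟨m, rfl⟩, hm⟩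
      exact ⟨m, by simpa using hu.lt_iff_lt.mp hm, rfl⟩
    · rintro ⟨m, hm, rfl⟩
      exact ⟨⟨m, rfl⟩, hu (by simpa using hm)⟩
  refine ⟨⟨n, rfl⟩, ?_, ?_⟩
  · rw [e]
    exact (Finset.finite_toSet _).image u
  · rw [e, ncard_image_of_injective _ hu.injective, ncard_coe_finset, Finset.card_range]

/-- The sequence `u` with a new first term `a`. -/
def consSeq (a : ℝ) (u : ℕ → ℝ) : ℕ → ℝ
  | 0 => a
  | n + 1 => u n

theorem strictMono_consSeq {a : ℝ} {u : ℕ → ℝ} (hu : StrictMono u) (ha : a < u 0) :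
    StrictMono (consSeq a u) := by
  refine strictMono_nat_of_lt_succ fun n => ?_
  cases n with
  | zero => exact ha
  | succ n => exact hu n.lt_succ_self

theorem range_consSeq (a : ℝ) (u : ℕ → ℝ) : range (consSeq a u) = insert a (range u) := by
  ext t
  constructor
  · rintro ⟨n, rfl⟩
    cases n with
    | zero => exact mem_insert _ _
    | succ n => exact mem_insert_of_mem _ ⟨n, rfl⟩
  · rintro (rfl | ⟨n, rfl⟩)
    · exact ⟨0, rfl⟩
    · exact ⟨n + 1, rfl⟩

theorem exists_strictMono_range_union (F : Finset ℝ) {x : ℕ → ℝ} (hx : StrictMono x)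
    (hF : ∀ f ∈ F, f < x 0) : ∃ u : ℕ → ℝ, StrictMono u ∧ range u = (F : Set ℝ) ∪ range x ∧
      ∀ n, u (n + F.card) = x n := by
  induction F using Finset.induction_on_min with
  | empty => exact ⟨x, hx, by simp, by simp⟩
  | insert a s has ih =>
    obtain ⟨u, hu, hr, hc⟩ := ih fun f hf => hF f (Finset.mem_insert_of_mem hf)
    have hau : a < u 0 := by
      have : u 0 ∈ (s : Set ℝ) ∪ range x := hr ▸ mem_range_self 0
      rcases this with h | ⟨n, h⟩
      · exact has _ h
      · rw [← h]
        exact (hF a (Finset.mem_insert_self _ _)).trans_le (hx.monotone n.zero_le)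
    refine ⟨consSeq a u, strictMono_consSeq hu hau, ?_, fun n => ?_⟩
    · rw [range_consSeq, hr, Finset.coe_insert, insert_union]
    · rw [Finset.card_insert_of_notMem fun h => (has a h).false, ← add_assoc]
      exact hc n

section

variable {ν : ℝ} {θ : ℝ → ℝ}

/-- Levels of at least π/2 are met only where ψ increases, hence at most once; those above the
values near 0 are met at all, since ψ tends to infinity. -/
theorem IsHankelPhase.exists_ultraPhase_seq (h : IsHankelPhase ν θ) (hν : 0 ≤ ν) (δ : ℝ)
    {t : ℕ → ℝ} (ht : StrictMono t) (ht0 : Real.pi / 2 ≤ t 0)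
    (hnear : ∀ᶠ x in 𝓝[>] (0 : ℝ), ultraPhase ν δ θ x < t 0) :
    ∃ x : ℕ → ℝ, StrictMono x ∧ ∀ n y, 0 < y ∧ ultraPhase ν δ θ y = t n ↔ y = x n := by
  have hν' : -(1 / 2) < ν := by linarith
  have hex : ∀ n, ∃ y : ℝ, 0 < y ∧ ultraPhase ν δ θ y = t n := fun n =>
    h.exists_ultraPhase_eq hν' δ (hnear.mono fun x hx => hx.trans_le (ht.monotone n.zero_le))
  choose x hx0 hx using hex
  have hmem : ∀ n y, 0 < y → ultraPhase ν δ θ y = t n → y ∈ Ioi 0 ∩ Ici √(ν ^ 2 - δ ^ 2) :=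
    fun n y hy he => h.sqrt_le_of_le_ultraPhase hν δ hy
      (by rw [he]; exact ht0.trans (ht.monotone n.zero_le))
  have hm := h.strictMonoOn_ultraPhase hν' δ
  refine ⟨x, fun i j hij => ?_, fun n y => ⟨fun hy => ?_, ?_⟩⟩
  · rw [← hm.lt_iff_lt (hmem i _ (hx0 i) (hx i)) (hmem j _ (hx0 j) (hx j)), hx, hx]
    exact ht hij
  · exact hm.injOn (hmem n _ hy.1 hy.2) (hmem n _ (hx0 n) (hx n)) (hy.2.trans (hx n).symm)
  · rintro rfl
    exact ⟨hx0 n, hx n⟩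

theorem IsHankelPhase.ultraHankelD_re_eq_zero_iff (h : IsHankelPhase ν θ) (hν : 0 ≤ ν) (δ : ℝ)
    {x : ℝ} (hx : 0 < x) : (ultraHankelD ν δ x).re = 0 ↔
      ∃ n : ℕ, ultraPhase ν δ θ x = (n + 1 / 2) * Real.pi := by
  have hν' : -(1 / 2) < ν := by linarith
  have h0 := ultraHankelD_ne_zero hν' δ hx
  rw [h.ultra_re hν' δ hx, mul_eq_zero, norm_eq_zero, or_iff_right h0, Real.cos_eq_zero_iff]
  constructor
  · rintro ⟨k, hk⟩
    have h1 := h.neg_half_pi_lt_ultraPhase hν δ hx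
    have hk0 : (-1 : ℝ) < k := by
      rw [hk] at h1
      have : 0 < ((k : ℝ) + 1) * Real.pi := by linarith
      linarith [pos_of_mul_pos_left this Real.pi_pos.le]
    have hk1 : 0 ≤ k := by
      have : (-1 : ℤ) < k := by exact_mod_cast hk0
      lia
    lift k to ℕ using hk1
    exact ⟨k, by rw [hk]; push_cast; ring⟩
  · rintro ⟨n, hn⟩
    exact ⟨n, by rw [hn]; push_cast; ring⟩

theorem IsHankelPhase.ultraHankelD_im_eq_zero_iff (h : IsHankelPhase ν θ) (hν : 0 ≤ ν) (δ : ℝ)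
    {x : ℝ} (hx : 0 < x) : (ultraHankelD ν δ x).im = 0 ↔
      ∃ n : ℕ, ultraPhase ν δ θ x = n * Real.pi := by
  have hν' : -(1 / 2) < ν := by linarith
  have h0 := ultraHankelD_ne_zero hν' δ hx
  rw [h.ultra_im hν' δ hx, mul_eq_zero, norm_eq_zero, or_iff_right h0, Real.sin_eq_zero_iff]
  constructor
  · rintro ⟨k, hk⟩
    have h1 := h.neg_half_pi_lt_ultraPhase hν δ hx
    have hk0 : (-1 : ℝ) < k := by
      rw [← hk] at h1
      have : 0 < ((k : ℝ) + 1 / 2) * Real.pi := by linarith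
      linarith [pos_of_mul_pos_left this Real.pi_pos.le]
    have hk1 : 0 ≤ k := by
      have : (-1 : ℤ) < k := by exact_mod_cast hk0
      lia
    lift k to ℕ using hk1
    exact ⟨k, by rw [← hk]; push_cast; ring⟩
  · rintro ⟨n, hn⟩
    exact ⟨n, by rw [hn]; push_cast; ring⟩

theorem IsHankelPhase.mem_zerosJ'_iff (h : IsHankelPhase ν θ) (hν : 0 ≤ ν) (δ x : ℝ) :
    x ∈ zerosJ' ν δ ↔ (∃ n : ℕ, 0 < x ∧ ultraPhase ν δ θ x = (n + 1 / 2) * Real.pi) ∨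
      (x = 0 ∧ ν ≤ δ) := by
  have : ∀ hx : 0 < x, _ := fun hx => (deriv_ultraJ_eq_zero_iff (by linarith) δ hx).trans
    (h.ultraHankelD_re_eq_zero_iff hν δ hx)
  simp only [zerosJ', mem_union, mem_ofPred_eq, exists_and_left]
  rw [and_congr_right this]

theorem IsHankelPhase.mem_zerosY'_iff (h : IsHankelPhase ν θ) (hν : 0 ≤ ν) (δ x : ℝ) :
    x ∈ zerosY' ν δ ↔ ∃ n : ℕ, 0 < x ∧ ultraPhase ν δ θ x = n * Real.pi := by
  have : ∀ hx : 0 < x, _ := fun hx => (deriv_ultraY_eq_zero_iff (by linarith) δ hx).trans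
    (h.ultraHankelD_im_eq_zero_iff hν δ hx)
  simp only [zerosY', mem_ofPred_eq, exists_and_left]
  rw [and_congr_right this]

/-- For δ < ν each level (n + 1/2)π with n ≥ 0 occurs once. For δ ≥ ν the phase always exceeds π/2,
so n = 0 is missing and the conventional zero x = 0 takes its place. Either way the k-th zero is at
level (k − 1/2)π, apart from k = 1. -/
theorem IsHankelPhase.exists_zerosJ' (h : IsHankelPhase ν θ) (hν : 0 ≤ ν) (δ : ℝ) :
    ∃ a : ℕ → ℝ, (∀ k : ℕ, 1 ≤ k → IsKth (zerosJ' ν δ) k (a k)) ∧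
      ∀ k : ℕ, 2 ≤ k → 0 < a k ∧ ultraPhase ν δ θ (a k) = ((k : ℝ) - 1 / 2) * Real.pi := by
  have hν' : -(1 / 2) < ν := by linarith
  have hpi := Real.pi_pos
  rcases lt_or_ge δ ν with hδ | hδ
  · obtain ⟨x, hx, hxu⟩ := h.exists_ultraPhase_seq hν δ (t := fun n : ℕ => (n + 1 / 2) * Real.pi)
      (fun i j hij => by
        have : (i : ℝ) < j := by exact_mod_cast hij
        exact mul_lt_mul_of_pos_right (by linarith) hpi)
      (by simp; linarith)
      (by filter_upwards [h.ultraPhase_lt_near_zero hν hδ] with x hx; simp; linarith)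
    have hr : zerosJ' ν δ = range x := by
      ext y
      rw [h.mem_zerosJ'_iff hν]
      simp only [hxu, not_le.mpr hδ, and_false, or_false, mem_range, eq_comm]
    refine ⟨fun k => x (k - 1), fun k hk => ?_, fun k hk => ?_⟩
    · obtain ⟨n, rfl⟩ := Nat.exists_eq_add_of_le' hk
      rw [hr]
      exact isKth_of_strictMono hx n
    · obtain ⟨n, rfl⟩ := Nat.exists_eq_add_of_le' (show 1 ≤ k by lia)
      have := (hxu n (x n)).mpr rfl
      refine ⟨this.1, this.2.trans ?_⟩
      push_cast
      ring
  · obtain ⟨x, hx, hxu⟩ := h.exists_ultraPhase_seq hν δ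
      (t := fun n : ℕ => ((n + 1 : ℕ) + 1 / 2) * Real.pi)
      (fun i j hij => by
        have : ((i + 1 : ℕ) : ℝ) < (j + 1 : ℕ) := by exact_mod_cast Nat.succ_lt_succ hij
        exact mul_lt_mul_of_pos_right (by linarith) hpi)
      (by simp; linarith)
      (by filter_upwards [h.ultraPhase_lt_pi_near_zero hν' δ] with x hx; simp; linarith [hx.2])
    have hx0 : 0 < x 0 := ((hxu 0 (x 0)).mpr rfl).1
    have hr : zerosJ' ν δ = range (consSeq 0 x) := by
      ext y
      rw [h.mem_zerosJ'_iff hν, range_consSeq, mem_insert_iff, or_comm, and_iff_left hδ]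
      refine or_congr_right ⟨?_, ?_⟩
      · rintro ⟨n, hy, hn⟩
        have h1 := h.half_pi_lt_ultraPhase hν hδ hy
        cases n with
        | zero => rw [hn] at h1; simp at h1; linarith
        | succ n => exact ⟨n, ((hxu n y).mp ⟨hy, hn⟩).symm⟩
      · rintro ⟨n, rfl⟩
        have := (hxu n (x n)).mpr rfl
        exact ⟨n + 1, this⟩
    refine ⟨fun k => consSeq 0 x (k - 1), fun k hk => ?_, fun k hk => ?_⟩
    · obtain ⟨n, rfl⟩ := Nat.exists_eq_add_of_le' hk
      rw [hr]
      exact isKth_of_strictMono (strictMono_consSeq hx hx0) n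
    · obtain ⟨n, rfl⟩ := Nat.exists_eq_add_of_le' hk
      have := (hxu n (x n)).mpr rfl
      refine ⟨this.1, this.2.trans ?_⟩
      push_cast
      ring

/-- The first zero of Y is where θ = 0. If ψ ≥ π then θ > ψ − π ≥ 0, so that zero has been passed;
if ψ = 0 then θ is still in (−π/2, 0) and Y < 0. -/
theorem IsHankelPhase.mem_earlyZerosY'_iff (h : IsHankelPhase ν θ) (hν : 0 ≤ ν) (δ x : ℝ) :
    (x ∈ zerosY' ν δ ∧ ∀ t, 0 < t → t ≤ x → besselY ν t ≠ 0) ↔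
      0 < x ∧ ultraPhase ν δ θ x = 0 := by
  have hν' : -(1 / 2) < ν := by linarith
  have hpi := Real.pi_pos
  rw [h.mem_zerosY'_iff hν]
  constructor
  · rintro ⟨⟨n, hx, hn⟩, hY⟩
    refine ⟨hx, ?_⟩
    rcases n.eq_zero_or_pos with rfl | hn0
    · simpa using hn
    · exfalso
      have h1 := ultraPhase_lt (θ := θ) hν' δ hx
      have h2 : (1 : ℝ) ≤ n := by exact_mod_cast hn0
      obtain ⟨y, hy, hy0⟩ := h.exists_eq le_rfl
      have h3 : θ y < θ x := by rw [hy0]; nlinarith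
      have h4 := (h.strictMonoOn hν).lt_iff_lt hy hx |>.mp h3
      apply hY y hy h4.le
      rw [h.besselY_eq hν hy, hy0, Real.sin_zero, mul_zero]
  · rintro ⟨hx, h0⟩
    refine ⟨⟨0, hx, by simpa using h0⟩, fun t ht htx => ?_⟩
    rw [h.besselY_eq hν ht]
    have h1 := (h.strictMonoOn hν).monotoneOn ht hx htx
    have h2 := ultraPhase_gt (θ := θ) hν' δ hx
    have h3 := Real.sin_neg_of_neg_of_neg_pi_lt (x := θ t) (by linarith) (by linarith [h.gt hν ht])
    exact mul_ne_zero (norm_ne_zero_iff.mpr (hankelH_ne_zero hν' ht)) h3.ne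

/-- At most one solution on the falling branch and one on the rising branch. For level 0 this makes
the `ncard` of the early zeros a true count. -/
theorem IsHankelPhase.finite_ultraPhase_eq (h : IsHankelPhase ν θ) (hν : -(1 / 2) < ν) (δ t : ℝ) :
    {x | 0 < x ∧ ultraPhase ν δ θ x = t}.Finite := by
  have h1 : ((Ioi 0 ∩ Ici √(ν ^ 2 - δ ^ 2)) ∩ {x | ultraPhase ν δ θ x = t}).Finite :=
    Subsingleton.finite fun x hx y hy =>
      (h.strictMonoOn_ultraPhase hν δ).injOn hx.1 hy.1 (hx.2.trans hy.2.symm)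
  have h2 : ((Ioi 0 ∩ Iic √(ν ^ 2 - δ ^ 2)) ∩ {x | ultraPhase ν δ θ x = t}).Finite :=
    Subsingleton.finite fun x hx y hy =>
      (h.strictAntiOn_ultraPhase hν δ).injOn hx.1 hy.1 (hx.2.trans hy.2.symm)
  refine (h1.union h2).subset fun x hx => ?_
  rcases le_total √(ν ^ 2 - δ ^ 2) x with hr | hr
  · exact Or.inl ⟨⟨hx.1, hr⟩, hx.2⟩
  · exact Or.inr ⟨⟨hx.1, hr⟩, hx.2⟩

/-- Early zeros have θ < 0, while ψ ≥ π forces θ > 0. So they precede all the others and merely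
shift the index. -/
theorem IsHankelPhase.exists_zerosY' (h : IsHankelPhase ν θ) (hν : 0 ≤ ν) (δ : ℝ) :
    ∃ b : ℕ → ℝ, (∀ k : ℕ, 1 ≤ k → IsKth (zerosY' ν δ) k (b k)) ∧
      ∀ k : ℕ, 1 ≤ k → 0 < b (k + earlyZerosY' ν δ) ∧
        ultraPhase ν δ θ (b (k + earlyZerosY' ν δ)) = k * Real.pi := by
  have hν' : -(1 / 2) < ν := by linarith
  have hpi := Real.pi_pos
  obtain ⟨x, hx, hxu⟩ := h.exists_ultraPhase_seq hν δ (t := fun n : ℕ => (n + 1 : ℕ) * Real.pi)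
    (fun i j hij => by
      have : ((i + 1 : ℕ) : ℝ) < (j + 1 : ℕ) := by exact_mod_cast Nat.succ_lt_succ hij
      exact mul_lt_mul_of_pos_right (by linarith) hpi)
    (by simp; linarith)
    (by filter_upwards [h.ultraPhase_lt_pi_near_zero hν' δ] with x hx; simpa using hx.2)
  have hfin := h.finite_ultraPhase_eq hν' δ 0
  have hx0 := (hxu 0 (x 0)).mpr rfl
  obtain ⟨u, hu, hr, hc⟩ := exists_strictMono_range_union hfin.toFinset hx (by
    intro f hf
    rw [Finite.mem_toFinset] at hf
    rw [← (h.strictMonoOn hν).lt_iff_lt hf.1 hx0.1]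
    have h1 := ultraPhase_gt (θ := θ) hν' δ hf.1
    have h2 := ultraPhase_lt (θ := θ) hν' δ hx0.1
    have h3 := hf.2
    have h4 := hx0.2
    simp at h4
    linarith)
  have hm : earlyZerosY' ν δ = hfin.toFinset.card := by
    rw [earlyZerosY', ← ncard_eq_toFinset_card _ hfin]
    congr 1
    ext y
    exact h.mem_earlyZerosY'_iff hν δ y
  have hrZ : zerosY' ν δ = range u := by
    ext y
    rw [h.mem_zerosY'_iff hν, hr, mem_union, Finite.coe_toFinset]
    constructor
    · rintro ⟨n, hy, hn⟩
      cases n with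
      | zero => exact Or.inl ⟨hy, by simpa using hn⟩
      | succ n => exact Or.inr ⟨n, ((hxu n y).mp ⟨hy, hn⟩).symm⟩
    · rintro (hy | ⟨n, rfl⟩)
      · exact ⟨0, hy.1, by simpa using hy.2⟩
      · exact ⟨n + 1, (hxu n (x n)).mpr rfl⟩
  refine ⟨fun k => u (k - 1), fun k hk => ?_, fun k hk => ?_⟩
  · obtain ⟨n, rfl⟩ := Nat.exists_eq_add_of_le' hk
    rw [hrZ]
    exact isKth_of_strictMono hu n
  · obtain ⟨n, rfl⟩ := Nat.exists_eq_add_of_le' hk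
    have e : u (n + 1 + earlyZerosY' ν δ - 1) = x n := by
      rw [← hc n, hm]
      congr 1
      lia
    simp only [e]
    exact (hxu n (x n)).mpr rfl

/-- If the phase of `x H'` is positive at `x = ν`, then no zero of `y'_{ν,δ}` with `δ ≥ 0` lies below the first
zero of `Y_ν`. -/
theorem IsHankelPhase.earlyZerosY'_eq_zero (h : IsHankelPhase ν θ) (hν : 0 ≤ ν) {δ : ℝ}
    (hδ : 0 ≤ δ) (hpos : 0 < ν → 0 < ultraPhase ν 0 θ ν) : earlyZerosY' ν δ = 0 := by
  have hν' : -(1 / 2) < ν := by linarith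
  have hpi := Real.pi_pos
  -- For δ = 0 and ν > 0 the phase falls up to x = ν and rises afterwards, so its value at ν is the
  -- minimum. For ν = 0 it exceeds π/2 throughout.
  have key : ∀ x, 0 < x → 0 < ultraPhase ν 0 θ x := by
    intro x hx
    rcases hν.eq_or_lt with h0 | h0
    · linarith [h.half_pi_lt_ultraPhase hν h0.symm.le hx]
    · have h1 := hpos h0
      have hs : √(ν ^ 2 - 0 ^ 2) = ν := by
        rw [zero_pow two_ne_zero, sub_zero, Real.sqrt_sq hν]
      rcases le_total x ν with hx1 | hx1
      · exact h1.trans_le ((h.strictAntiOn_ultraPhase hν' 0).antitoneOn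
          ⟨hx, hs.symm ▸ hx1⟩ ⟨h0, hs.ge⟩ hx1)
      · exact h1.trans_le ((h.strictMonoOn_ultraPhase hν' 0).monotoneOn
          ⟨h0, hs.le⟩ ⟨hx, hs.symm ▸ hx1⟩ hx1)
  rw [earlyZerosY', ncard_eq_zero (by
    convert h.finite_ultraPhase_eq hν' δ 0 using 3 with x
    exact (h.mem_earlyZerosY'_iff hν δ x))]
  refine eq_empty_of_forall_notMem fun x hx => ?_
  obtain ⟨hx0, hx1⟩ := (h.mem_earlyZerosY'_iff hν δ x).mp hx
  have h1 := key x hx0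
  have h2 := ultraPhase_gt (θ := θ) hν' δ hx0
  have h3 := ultraPhase_lt (θ := θ) hν' 0 hx0
  have h4 := h.gt hν hx0
  have h5 := h.ultra_im hν' 0 hx0
  have h6 := h.ultra_im hν' δ hx0
  -- At an early zero Y < 0 and Y' > 0, whereas xY' = δY ≤ 0 for δ ≥ 0: a contradiction.
  have h7 : 0 < Real.sin (ultraPhase ν 0 θ x) := Real.sin_pos_of_pos_of_lt_pi h1 (by linarith)
  have h8 : Real.sin (θ x) < 0 := Real.sin_neg_of_neg_of_neg_pi_lt (by linarith) (by linarith)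
  rw [hx1, Real.sin_zero, mul_zero, ultraHankelD_im, ← besselY_eq_im_hankelH hν' hx0,
    h.besselY_eq hν hx0] at h6
  rw [ultraHankelD_im, zero_mul, sub_zero] at h5
  have h9 := norm_pos_iff.mpr (ultraHankelD_ne_zero hν' 0 hx0)
  have h10 := mul_pos h9 h7
  have h11 := mul_nonneg hδ (mul_nonneg (norm_nonneg (hankelH ν x)) (neg_nonneg.mpr h8.le))
  nlinarith

end

/-! ### Formal and asymptotic reversion of the series -/

open PowerSeries in
/-- A contracting self-map of the formal power series has a fixed point. -/
theorem PowerSeries.exists_fixedPoint {F : ℝ⟦X⟧ → ℝ⟦X⟧}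
    (hF : ∀ (n : ℕ) (P Q : ℝ⟦X⟧), X ^ n ∣ P - Q → X ^ (n + 1) ∣ F P - F Q) : ∃ P, F P = P := by
  set T : ℕ → ℝ⟦X⟧ := fun n => F^[n] 0
  have hT : ∀ n, T (n + 1) = F (T n) := fun n => Function.iterate_succ_apply' F n 0
  have h1 : ∀ n, (X : ℝ⟦X⟧) ^ n ∣ T n - T (n + 1) := by
    intro n
    induction n with
    | zero => simp
    | succ n ih => rw [hT, hT]; exact hF n _ _ ih
  have h2 : ∀ n m, (X : ℝ⟦X⟧) ^ n ∣ T n - T (n + m) := by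
    intro n m
    induction m with
    | zero => simp
    | succ m ih =>
      have := dvd_add ih ((pow_dvd_pow X (Nat.le_add_right n m)).trans (h1 (n + m)))
      simpa [add_assoc] using this
  -- The coefficient of index i no longer changes from the iterate i + 1 on.
  set P : ℝ⟦X⟧ := PowerSeries.mk fun i => coeff i (T (i + 1))
  have h3 : ∀ n, (X : ℝ⟦X⟧) ^ n ∣ T n - P := by
    intro n
    rw [X_pow_dvd_iff]
    intro i hi
    obtain ⟨m, rfl⟩ := Nat.exists_eq_add_of_le (Nat.succ_le_of_lt hi)
    have := X_pow_dvd_iff.mp (h2 (i + 1) m) i i.lt_succ_self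
    simp only [map_sub, P, coeff_mk] at this ⊢
    linarith
  refine ⟨P, ?_⟩
  ext i
  have h4 := hF i _ _ (h3 i)
  rw [← hT] at h4
  have := X_pow_dvd_iff.mp (dvd_sub (h3 (i + 1)) h4) i i.lt_succ_self
  simp only [map_sub] at this
  linarith

open PowerSeries in
theorem PowerSeries.dvd_inv_sub_inv {d : ℝ⟦X⟧} {P Q : ℝ⟦X⟧} (hP : constantCoeff P ≠ 0)
    (hQ : constantCoeff Q ≠ 0) (h : d ∣ P - Q) : d ∣ P⁻¹ - Q⁻¹ := by
  have e : P⁻¹ - Q⁻¹ = -(P⁻¹ * Q⁻¹) * (P - Q) := by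
    have h1 := PowerSeries.mul_inv_cancel P hP
    have h2 := PowerSeries.mul_inv_cancel Q hQ
    linear_combination Q⁻¹ * h1 - P⁻¹ * h2
  rw [e]
  exact h.mul_left _

open PowerSeries in
/-- Formal reversion of `β = x + ∑ e_j x ^ -(2 j + 1)`: with `σ = β ^ -2`, one has
`x = β (1 + σ R(σ))` and `1 / x = W(σ) / β`. -/
theorem exists_formal_reversion (e : ℕ → ℝ) : ∃ R W : ℝ⟦X⟧, (1 + X * R) * W = 1 ∧
    ∀ n, X ^ n ∣ R + ∑ j ∈ Finset.range n, C (e j) * X ^ j * W ^ (2 * j + 1) := by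
  have hU : ∀ R : ℝ⟦X⟧, constantCoeff (1 + X * R) ≠ 0 := by intro R; simp
  set S : ℕ → ℝ⟦X⟧ → ℝ⟦X⟧ := fun n R =>
    ∑ j ∈ Finset.range n, C (e j) * X ^ j * ((1 + X * R)⁻¹) ^ (2 * j + 1)
  -- F is minus the full infinite sum: terms with j > i do not reach the coefficient of index i, so
  -- the partial sum with i + 1 terms suffices there. It contracts because R enters only through X *
  -- R.
  set F : ℝ⟦X⟧ → ℝ⟦X⟧ := fun R => PowerSeries.mk fun i => -coeff i (S (i + 1) R)
  have hS : ∀ n m R, (X : ℝ⟦X⟧) ^ n ∣ S (n + m) R - S n R := by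
    intro n m R
    simp only [S, Finset.sum_range_add, add_sub_cancel_left]
    refine Finset.dvd_sum fun j _ => ?_
    rw [pow_add, mul_left_comm, mul_assoc]
    exact dvd_mul_right _ _
  have hFS : ∀ n R, (X : ℝ⟦X⟧) ^ n ∣ F R + S n R := by
    intro n R
    rw [X_pow_dvd_iff]
    intro i hi
    obtain ⟨m, rfl⟩ := Nat.exists_eq_add_of_le (Nat.succ_le_of_lt hi)
    have := X_pow_dvd_iff.mp (hS (i + 1) m R) i i.lt_succ_self
    simp only [map_sub, map_add, F, coeff_mk, Nat.succ_eq_add_one] at this ⊢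
    linarith
  obtain ⟨R, hR⟩ := PowerSeries.exists_fixedPoint (F := F) (by
    intro n P Q h
    have h1 : (X : ℝ⟦X⟧) ^ (n + 1) ∣ S (n + 1) P - S (n + 1) Q := by
      simp only [S, ← Finset.sum_sub_distrib, ← mul_sub]
      refine Finset.dvd_sum fun j _ => Dvd.dvd.mul_left ?_ _
      refine Dvd.dvd.trans ?_ (sub_dvd_pow_sub_pow _ _ _)
      refine PowerSeries.dvd_inv_sub_inv (hU P) (hU Q) ?_
      rw [add_sub_add_left_eq_sub, ← mul_sub, pow_succ']
      exact mul_dvd_mul_left _ h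
    have h2 := dvd_sub (dvd_sub (hFS (n + 1) P) (hFS (n + 1) Q)) h1
    have e : F P + S (n + 1) P - (F Q + S (n + 1) Q) - (S (n + 1) P - S (n + 1) Q) = F P - F Q := by
      ring
    rwa [e] at h2)
  refine ⟨R, (1 + X * R)⁻¹, PowerSeries.mul_inv_cancel _ (hU R), fun n => ?_⟩
  have := hFS n R
  rwa [hR] at this

/-- The function `f` agrees with the formal power series `P` in `σ` up to `O(σ ^ n)`. -/
def PSExpands (l : Filter ℕ) (σ : ℕ → ℝ) (n : ℕ) (f : ℕ → ℝ) (P : PowerSeries ℝ) : Prop :=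
  ∃ p : Polynomial ℝ, PowerSeries.X ^ n ∣ P - (p : PowerSeries ℝ) ∧
    (fun k => f k - p.eval (σ k)) =O[l] fun k => σ k ^ n

section

variable {l : Filter ℕ} {σ : ℕ → ℝ} {n : ℕ} {f g : ℕ → ℝ} {P Q : PowerSeries ℝ}

theorem PSExpands.congr (h : PSExpands l σ n f P) (hPQ : PowerSeries.X ^ n ∣ Q - P) :
    PSExpands l σ n f Q := by
  obtain ⟨p, hp, hf⟩ := h
  exact ⟨p, by simpa using dvd_add hPQ hp, hf⟩

theorem PSExpands.add_isBigO (h : PSExpands l σ n f P) (hg : g =O[l] fun k => σ k ^ n) :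
    PSExpands l σ n (fun k => f k + g k) P := by
  obtain ⟨p, hp, hf⟩ := h
  exact ⟨p, hp, (hf.add hg).congr_left fun k => by ring⟩

theorem PSExpands.congr' (h : PSExpands l σ n f P) (hfg : f =ᶠ[l] g) : PSExpands l σ n g P := by
  obtain ⟨p, hp, hf⟩ := h
  exact ⟨p, hp, hf.congr' (by filter_upwards [hfg] with k hk; rw [hk]) EventuallyEq.rfl⟩

theorem psExpands_polynomial (p : Polynomial ℝ) :
    PSExpands l σ n (fun k => p.eval (σ k)) (p : PowerSeries ℝ) :=
  ⟨p, by simp, by simpa using isBigO_zero _ _⟩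

theorem PSExpands.add (hf : PSExpands l σ n f P) (hg : PSExpands l σ n g Q) :
    PSExpands l σ n (fun k => f k + g k) (P + Q) := by
  obtain ⟨p, hp, hf⟩ := hf
  obtain ⟨q, hq, hg⟩ := hg
  refine ⟨p + q, ?_, (hf.add hg).congr_left fun k => by simp; ring⟩
  have := dvd_add hp hq
  rwa [Polynomial.coe_add, add_sub_add_comm]

theorem PSExpands.sum {ι : Type*} (s : Finset ι) {f : ι → ℕ → ℝ} {P : ι → PowerSeries ℝ}
    (h : ∀ i ∈ s, PSExpands l σ n (f i) (P i)) :
    PSExpands l σ n (fun k => ∑ i ∈ s, f i k) (∑ i ∈ s, P i) := by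
  classical
  induction s using Finset.induction_on with
  | empty => simpa using psExpands_polynomial (l := l) (σ := σ) (n := n) 0
  | insert i s hi ih =>
    simp only [Finset.sum_insert hi]
    exact (h i (Finset.mem_insert_self _ _)).add
      (ih fun j hj => h j (Finset.mem_insert_of_mem hj))

theorem isBigO_polynomial_eval (hσ : Tendsto σ l (𝓝 0)) (p : Polynomial ℝ) :
    (fun k => p.eval (σ k)) =O[l] fun _ => (1 : ℝ) :=
  ((p.continuous.tendsto 0).comp hσ).isBigO_one ℝ

theorem isBigO_eval_of_dvd (hσ : Tendsto σ l (𝓝 0)) {p : Polynomial ℝ}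
    (h : (PowerSeries.X : PowerSeries ℝ) ^ n ∣ p) :
    (fun k => p.eval (σ k)) =O[l] fun k => σ k ^ n := by
  have h' : Polynomial.X ^ n ∣ p := by
    rw [Polynomial.X_pow_dvd_iff]
    intro d hd
    have := PowerSeries.X_pow_dvd_iff.mp h d hd
    rwa [Polynomial.coeff_coe] at this
  obtain ⟨q, rfl⟩ := h'
  have := (isBigO_refl (fun k => σ k ^ n) l).mul (isBigO_polynomial_eval hσ q)
  simpa using this

theorem PSExpands.isBigO_one (hσ : Tendsto σ l (𝓝 0)) (hf : PSExpands l σ n f P) :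
    f =O[l] fun _ => (1 : ℝ) := by
  obtain ⟨p, -, hf⟩ := hf
  have h1 : (fun k => σ k ^ n) =O[l] fun _ => (1 : ℝ) := (hσ.pow n).isBigO_one ℝ
  exact ((hf.trans h1).add (isBigO_polynomial_eval hσ p)).congr_left fun k => by ring

theorem PSExpands.mul (hσ : Tendsto σ l (𝓝 0)) (hf : PSExpands l σ n f P)
    (hg : PSExpands l σ n g Q) : PSExpands l σ n (fun k => f k * g k) (P * Q) := by
  have hf1 := hf.isBigO_one hσ
  obtain ⟨p, hp, hf⟩ := hf
  obtain ⟨q, hq, hg⟩ := hg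
  refine ⟨p * q, ?_, ?_⟩
  · have := dvd_add (hp.mul_right Q) (hq.mul_left (p : PowerSeries ℝ))
    rw [Polynomial.coe_mul]
    convert this using 1
    ring
  · have h1 := hf1.mul hg
    have h2 := hf.mul (isBigO_polynomial_eval hσ q)
    simp only [one_mul, mul_one] at h1 h2
    exact (h1.add h2).congr_left fun k => by simp; ring

theorem PSExpands.pow (hσ : Tendsto σ l (𝓝 0)) (hf : PSExpands l σ n f P) (m : ℕ) :
    PSExpands l σ n (fun k => f k ^ m) (P ^ m) := by
  induction m with
  | zero => simpa using psExpands_polynomial (l := l) (σ := σ) (n := n) 1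
  | succ m ih => simpa only [pow_succ] using ih.mul hσ hf

theorem PSExpands.mul_var (hf : PSExpands l σ n f P) :
    PSExpands l σ (n + 1) (fun k => σ k * f k) (PowerSeries.X * P) := by
  obtain ⟨p, hp, hf⟩ := hf
  refine ⟨Polynomial.X * p, ?_, ?_⟩
  · rw [Polynomial.coe_mul, Polynomial.coe_X, ← mul_sub, pow_succ']
    exact mul_dvd_mul_left _ hp
  · refine ((isBigO_refl σ l).mul hf).congr (fun k => ?_) fun k => by ring
    simp
    ring

/-- With w the truncation of Q evaluated at σ, 1/f = w + (1 − f·w)/f, and 1 − f·w is of order σ^n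
because P * Q = 1. -/
theorem PSExpands.inv (hσ : Tendsto σ l (𝓝 0)) (hf : PSExpands l σ n f P)
    (hlim : Tendsto f l (𝓝 1)) (hPQ : P * Q = 1) : PSExpands l σ n (fun k => (f k)⁻¹) Q := by
  have hw : PSExpands l σ n (fun k => (Q.trunc n).eval (σ k)) Q :=
    (psExpands_polynomial _).congr (by
      rw [PowerSeries.X_pow_dvd_iff]
      intro d hd
      simp [PowerSeries.coeff_trunc, hd])
  obtain ⟨p, hp, h1⟩ := hf.mul hσ hw
  rw [hPQ] at hp
  have h2 : (fun k => (1 - p).eval (σ k)) =O[l] fun k => σ k ^ n :=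
    isBigO_eval_of_dvd hσ (by simpa using hp)
  have h3 : (fun k => (f k)⁻¹) =O[l] fun _ => (1 : ℝ) := (hlim.inv₀ one_ne_zero).isBigO_one ℝ
  have h4 := (h2.sub h1).mul h3
  simp only [mul_one] at h4
  refine (hw.add_isBigO h4).congr' ?_
  filter_upwards [hlim.eventually_ne one_ne_zero] with k hk
  simp only [Polynomial.eval_sub, Polynomial.eval_one]
  field_simp
  ring

theorem PSExpands.isBigO_sub_sum (hσ : Tendsto σ l (𝓝 0)) (hf : PSExpands l σ n f P) :
    (fun k => f k - ∑ i ∈ Finset.range n, PowerSeries.coeff i P * σ k ^ i)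
      =O[l] fun k => σ k ^ n := by
  obtain ⟨p, hp, hf⟩ := hf
  set q : Polynomial ℝ := ∑ i ∈ Finset.range n, Polynomial.monomial i (PowerSeries.coeff i P)
  have h2 : (fun k => (p - q).eval (σ k)) =O[l] fun k => σ k ^ n := by
    refine isBigO_eval_of_dvd hσ ?_
    rw [PowerSeries.X_pow_dvd_iff] at hp ⊢
    intro d hd
    have := hp d hd
    simp only [map_sub, Polynomial.coeff_coe, Polynomial.coeff_sub, q, Polynomial.finsetSum_coeff,
      Polynomial.coeff_monomial, Finset.sum_ite_eq', Finset.mem_range, hd, if_true] at this ⊢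
    linarith
  refine (hf.add h2).congr_left fun k => ?_
  rw [Polynomial.eval_sub, Polynomial.eval_finsetSum]
  simp only [Polynomial.eval_monomial]
  ring

end

/-- Asymptotic reversion: if `E(x)` has the asymptotic expansion `∑ e_j x ^ -(2 j + 1)`, then
solutions of `x + E(x) = β` are expanded in powers of `1 / β` by the formal reversion. -/
theorem isBigO_reversion {E : ℝ → ℝ} {e : ℕ → ℝ}
    (hE : ∀ n, (fun x => E x - ∑ j ∈ Finset.range n, e j * (x⁻¹) ^ (2 * j + 1)) =O[atTop]
      fun x => (x⁻¹) ^ (2 * n + 1))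
    {R W : PowerSeries ℝ} (hW : (1 + PowerSeries.X * R) * W = 1)
    (hR : ∀ n, PowerSeries.X ^ n ∣
      R + ∑ j ∈ Finset.range n, PowerSeries.C (e j) * PowerSeries.X ^ j * W ^ (2 * j + 1))
    {x β : ℕ → ℝ} (hx : Tendsto x atTop atTop) (hβ : Tendsto β atTop atTop)
    (hxβ : ∀ᶠ k in atTop, x k + E (x k) = β k) (n : ℕ) :
    (fun k => x k - (β k + ∑ i ∈ Finset.range n, PowerSeries.coeff i R / β k ^ (2 * i + 1)))
      =O[atTop] fun k => 1 / β k ^ (2 * n + 1) := by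
  set σ : ℕ → ℝ := fun k => ((β k)⁻¹) ^ 2
  have hσ : Tendsto σ atTop (𝓝 0) := by
    have := (tendsto_inv_atTop_zero.comp hβ).pow 2
    simpa [σ, Function.comp_def] using this
  have hxi : Tendsto (fun k => (x k)⁻¹) atTop (𝓝 0) := tendsto_inv_atTop_zero.comp hx
  have hE0 : (fun k => E (x k)) =O[atTop] fun k => (x k)⁻¹ := by
    have := (hE 0).comp_tendsto hx
    simpa [Function.comp_def] using this
  have hEt : Tendsto (fun k => E (x k)) atTop (𝓝 0) := hE0.trans_tendsto hxi
  have hpos : ∀ᶠ k in atTop, 0 < x k ∧ 0 < β k :=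
    (hx.eventually_gt_atTop 0).and (hβ.eventually_gt_atTop 0)
  have hq : Tendsto (fun k => x k / β k) atTop (𝓝 1) := by
    have h1 := (hEt.mul (tendsto_inv_atTop_zero.comp hβ)).const_sub 1
    simp only [Function.comp_def, mul_zero, sub_zero] at h1
    refine h1.congr' ?_
    filter_upwards [hpos, hxβ] with k hk hk2
    have := hk.2.ne'
    field_simp
    linarith
  have hv : (fun k => β k / x k) =O[atTop] fun _ => (1 : ℝ) := by
    have := (hq.inv₀ one_ne_zero).isBigO_one ℝ
    simpa using this
  -- Bootstrap: knowing (x − β)β to order σ^n gives x/β = 1 + σ(x − β)β to order σ^(n+1), hence β/x.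
  -- Then (x − β)β = −βE(x) = −Σ e_j σ^j (β/x)^(2j+1) is known to order σ^(n+1).
  have key : ∀ n, PSExpands atTop σ n (fun k => (x k - β k) * β k) R := by
    intro n
    induction n with
    | zero =>
      refine ⟨0, by simp, ?_⟩
      have h1 : (fun k => E (x k) * β k) =O[atTop] fun k => (x k)⁻¹ * β k :=
        hE0.mul (isBigO_refl _ _)
      have h2 : (fun k => (x k)⁻¹ * β k) =O[atTop] fun _ => (1 : ℝ) :=
        hv.congr_left fun k => by rw [div_eq_inv_mul]
      refine ((h1.trans h2).neg_left).congr' ?_ (by simp)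
      filter_upwards [hxβ] with k hk
      rw [← hk]
      simp
    | succ n ih =>
      have hu : PSExpands atTop σ (n + 1) (fun k => x k / β k) (1 + PowerSeries.X * R) := by
        have h1 : PSExpands atTop σ (n + 1) (fun _ => (1 : ℝ)) 1 := by
          simpa using psExpands_polynomial (l := atTop) (σ := σ) (n := n + 1) 1
        refine (h1.add ih.mul_var).congr' ?_
        filter_upwards [hpos] with k hk
        have := hk.2.ne'
        simp only [σ]
        field_simp
        ring
      have hvv := hu.inv hσ hq hW
      simp only [inv_div] at hvv
      have hs : PSExpands atTop σ (n + 1)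
          (fun k => ∑ j ∈ Finset.range (n + 1), -(e j * σ k ^ j * (β k / x k) ^ (2 * j + 1)))
          (∑ j ∈ Finset.range (n + 1),
            PowerSeries.C (-e j) * PowerSeries.X ^ j * W ^ (2 * j + 1)) := by
        refine PSExpands.sum _ fun j _ => ?_
        have h1 := psExpands_polynomial (l := atTop) (σ := σ) (n := n + 1)
          (Polynomial.C (-e j) * Polynomial.X ^ j)
        simp only [Polynomial.coe_mul, Polynomial.coe_C, Polynomial.coe_pow, Polynomial.coe_X,
          Polynomial.eval_mul, Polynomial.eval_C, Polynomial.eval_pow, Polynomial.eval_X] at h1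
        refine (h1.mul hσ (hvv.pow hσ (2 * j + 1))).congr' (Eventually.of_forall fun k => ?_)
        ring
      have hrem : (fun k => -((E (x k) - ∑ j ∈ Finset.range (n + 1),
          e j * ((x k)⁻¹) ^ (2 * j + 1)) * β k)) =O[atTop] fun k => σ k ^ (n + 1) := by
        have h1 := ((hE (n + 1)).comp_tendsto hx).mul (isBigO_refl β atTop)
        have h2 := (hv.pow (2 * (n + 1) + 1)).mul (isBigO_refl (fun k => σ k ^ (n + 1)) atTop)
        simp only [one_pow, one_mul] at h2
        refine (h1.neg_left.trans ?_)
        refine h2.congr' ?_ EventuallyEq.rfl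
        filter_upwards [hpos] with k hk
        have := hk.1.ne'
        have := hk.2.ne'
        simp only [σ, Function.comp_apply]
        rw [div_pow, inv_pow, inv_pow, inv_pow, ← pow_mul, pow_succ (β k)]
        field_simp
      refine ((hs.add_isBigO hrem).congr' ?_).congr ?_
      · filter_upwards [hpos, hxβ] with k hk hk2
        have hb := hk.2.ne'
        have hxk := hk.1.ne'
        rw [Finset.sum_neg_distrib, ← neg_add, sub_mul, Finset.sum_mul]
        have : ∀ j ∈ Finset.range (n + 1), e j * ((x k)⁻¹) ^ (2 * j + 1) * β k =
            e j * σ k ^ j * (β k / x k) ^ (2 * j + 1) := by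
          intro j _
          simp only [σ]
          rw [div_pow, ← pow_mul, inv_pow, inv_pow, pow_succ (β k)]
          field_simp
        rw [Finset.sum_congr rfl this, ← hk2]
        ring
      · convert hR (n + 1) using 1
        rw [sub_eq_add_neg, ← Finset.sum_neg_distrib]
        congr 1
        refine Finset.sum_congr rfl fun j _ => ?_
        rw [map_neg]
        ring
  have h1 := ((key n).isBigO_sub_sum hσ).mul (isBigO_refl (fun k => (β k)⁻¹) atTop)
  refine h1.congr' ?_ ?_
  · filter_upwards [hpos] with k hk
    have hb := hk.2.ne'
    rw [sub_mul, mul_assoc, mul_inv_cancel₀ hb, mul_one, Finset.sum_mul, ← sub_sub]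
    congr 1
    refine Finset.sum_congr rfl fun i _ => ?_
    simp only [σ]
    rw [← pow_mul, mul_assoc, ← pow_succ, inv_pow, div_eq_mul_inv]
  · refine Eventually.of_forall fun k => ?_
    simp only [σ]
    rw [← pow_mul, ← pow_succ, inv_pow, one_div]

/-! ### From the series of xH' − δH to the expansion of its phase -/

theorem isBigO_sub_of_hasDerivAt {F F' : ℂ → ℂ} {K : ℕ} (hF : ∀ z, HasDerivAt F (F' z) z)
    (hF' : F' =O[𝓝 0] fun z => z ^ K) :
    (fun z => F z - F 0) =O[𝓝 0] fun z => z ^ (K + 1) := by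
  obtain ⟨C, hC0, hC⟩ := hF'.exists_nonneg
  obtain ⟨r, hr, hball⟩ := Metric.eventually_nhds_iff_ball.mp hC.bound
  refine IsBigO.of_bound C ?_
  filter_upwards [Metric.ball_mem_nhds 0 hr] with w hw
  rw [mem_ball_zero_iff] at hw
  have := (convex_closedBall (0 : ℂ) ‖w‖).norm_image_sub_le_of_norm_hasDerivWithin_le
    (C := C * ‖w‖ ^ K) (f := F) (f' := F') (x := 0) (y := w)
    (fun z _ => (hF z).hasDerivWithinAt) ?_ (by simp) (by simp)
  · rw [sub_zero, mul_assoc, ← pow_succ] at this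
    rwa [norm_pow]
  · intro z hz
    rw [mem_closedBall_zero_iff] at hz
    have h1 := hball z (by rw [mem_ball_zero_iff]; linarith)
    rw [norm_pow] at h1
    exact h1.trans (by gcongr)

/-- The logarithm of `∑ d_k w ^ k` is `∑ q_k w ^ (k + 1) / (k + 1)` if `q` is the logarithmic
derivative. -/
theorem isBigO_mul_exp_neg_sub_one {d q : ℕ → ℝ} (hd : d 0 = 1)
    (hq : ∀ n, ∑ ij ∈ Finset.HasAntidiagonal.antidiagonal n, d ij.1 * q ij.2 = (n + 1) * d (n + 1)) (K : ℕ) :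
    (fun w : ℂ => (∑ k ∈ Finset.range (K + 1), (d k : ℂ) * w ^ k) *
      Complex.exp (-∑ k ∈ Finset.range K, ((q k / (k + 1) : ℝ) : ℂ) * w ^ (k + 1)) - 1)
      =O[𝓝 0] fun w => w ^ (K + 1) := by
  set D : Polynomial ℂ := ∑ k ∈ Finset.range (K + 1), Polynomial.monomial k (d k : ℂ) with hD
  set S : Polynomial ℂ := ∑ k ∈ Finset.range K,
    Polynomial.monomial (k + 1) ((q k / (k + 1) : ℝ) : ℂ) with hS
  have hDc : ∀ n, D.coeff n = if n < K + 1 then (d n : ℂ) else 0 := by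
    intro n
    simp [hD, Polynomial.finsetSum_coeff, Polynomial.coeff_monomial]
  have hSc : ∀ n, S.derivative.coeff n = if n < K then (q n : ℂ) else 0 := by
    intro n
    have : ((n : ℂ) + 1) ≠ 0 := by exact_mod_cast Nat.succ_ne_zero n
    rw [Polynomial.coeff_derivative]
    simp only [hS, Polynomial.finsetSum_coeff, Polynomial.coeff_monomial, add_left_inj,
      Finset.sum_ite_eq', Finset.mem_range]
    split_ifs
    · push_cast
      field_simp
    · simp
  -- The derivative of D·e^(-S) is P·e^(-S), and the recursion for q cancels all coefficients of P
  -- below degree K.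
  set P : Polynomial ℂ := D.derivative - D * S.derivative with hP
  have hdvd : Polynomial.X ^ K ∣ P := by
    rw [Polynomial.X_pow_dvd_iff]
    intro n hn
    rw [hP, Polynomial.coeff_sub, Polynomial.coeff_derivative, hDc, Polynomial.coeff_mul, sub_eq_zero,
      if_pos (by lia)]
    have h1 : ∀ ij ∈ Finset.HasAntidiagonal.antidiagonal n, D.coeff ij.1 * S.derivative.coeff ij.2 =
        ((d ij.1 * q ij.2 : ℝ) : ℂ) := by
      intro ij hij
      have := Finset.HasAntidiagonal.mem_antidiagonal.mp hij
      rw [hDc, hSc, if_pos (by lia), if_pos (by lia), Complex.ofReal_mul]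
    rw [Finset.sum_congr rfl h1, ← Complex.ofReal_sum, hq]
    push_cast
    ring
  obtain ⟨Q, hQ⟩ := hdvd
  have hFd : ∀ z : ℂ, HasDerivAt (fun w : ℂ => D.eval w * Complex.exp (-S.eval w))
      (P.eval z * Complex.exp (-S.eval z)) z := by
    intro z
    have := (D.hasDerivAt z).fun_mul ((S.hasDerivAt z).fun_neg.cexp)
    refine this.congr_deriv ?_
    rw [hP, Polynomial.eval_sub, Polynomial.eval_mul]
    ring
  have hb : (fun z : ℂ => P.eval z * Complex.exp (-S.eval z)) =O[𝓝 0] fun z => z ^ K := by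
    have hc : Continuous fun z : ℂ => Q.eval z * Complex.exp (-S.eval z) :=
      Q.continuous.mul (Complex.continuous_exp.comp S.continuous.neg)
    have := (isBigO_refl (fun z : ℂ => z ^ K) (𝓝 0)).mul ((hc.tendsto 0).isBigO_one ℂ)
    refine this.congr (fun z => ?_) fun z => by ring
    rw [hQ, Polynomial.eval_mul, Polynomial.eval_pow, Polynomial.eval_X]
    ring
  have h := isBigO_sub_of_hasDerivAt hFd hb
  have hD0 : D.eval 0 = 1 := by
    rw [← Polynomial.coeff_zero_eq_eval_zero, hDc, if_pos K.succ_pos, hd, Complex.ofReal_one]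
  have hS0 : S.eval 0 = 0 := by
    rw [hS, Polynomial.eval_finsetSum]
    simp
  rw [hD0, hS0, neg_zero, Complex.exp_zero, mul_one] at h
  refine h.congr_left fun z => ?_
  simp only [hD, hS, Polynomial.eval_finsetSum, Polynomial.eval_monomial]

/-- The coefficients of the asymptotic series of `x H' - δ H`. -/
noncomputable def ultraCoeff (ν δ : ℝ) : ℕ → ℝ
  | 0 => 1
  | k + 1 => (laplaceCoeff (ν - 1 / 2) (ν - 1 / 2) (k + 1) +
      (δ - ν) * laplaceCoeff (ν - 1 / 2) (ν - 1 / 2) k +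
      laplaceCoeff (ν - 1 / 2) (ν - 1 / 2 + 1) k) / Real.Gamma (ν + 1 / 2)

/-- The slowly varying factor of `x H' - δ H`. -/
noncomputable def ultraAmplitude (ν δ x : ℝ) : ℂ :=
  (((x ^ (ν - 1 / 2 + 1) : ℝ) : ℂ) * laplaceInt (ν - 1 / 2) (ν - 1 / 2) x +
    Complex.I / x * ((δ - ν) * (((x ^ (ν - 1 / 2 + 1) : ℝ) : ℂ) *
      laplaceInt (ν - 1 / 2) (ν - 1 / 2) x) + ((x ^ (ν - 1 / 2 + 1 + 1) : ℝ) : ℂ) *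
      laplaceInt (ν - 1 / 2) (ν - 1 / 2 + 1) x)) / (Real.Gamma (ν + 1 / 2) : ℝ)

/-- The remaining factor has an expansion in powers of i/x with real coefficients and leading term
1, so the exponential carries the whole leading phase. -/
theorem ultraHankelD_eq_amplitude {ν x : ℝ} (hν : -(1 / 2) < ν) (δ : ℝ) (hx : 0 < x) :
    ultraHankelD ν δ x = ((√(2 / Real.pi) * √x : ℝ) : ℂ) *
      Complex.exp ((x - ν * Real.pi / 2 + Real.pi / 4 : ℝ) * Complex.I) * ultraAmplitude ν δ x := by
  have hG : (0 : ℝ) < Real.Gamma (ν + 1 / 2) := Real.Gamma_pos_of_pos (by linarith)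
  have hG0 : ((Real.Gamma (ν + 1 / 2) : ℝ) : ℂ) ≠ 0 := by exact_mod_cast hG.ne'
  have hx0 : (x : ℂ) ≠ 0 := by exact_mod_cast hx.ne'
  have e1 : Complex.exp ((x - ν * Real.pi / 2 + Real.pi / 4 : ℝ) * Complex.I) =
      Complex.I * (Complex.exp (-((ν * Real.pi / 2 + Real.pi / 4 : ℝ) : ℂ) * Complex.I) *
        Complex.exp (x * Complex.I)) := by
    rw [← Complex.exp_add, show ((x - ν * Real.pi / 2 + Real.pi / 4 : ℝ) : ℂ) * Complex.I =
      Real.pi / 2 * Complex.I + (-((ν * Real.pi / 2 + Real.pi / 4 : ℝ) : ℂ) * Complex.I +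
        x * Complex.I) by push_cast; ring, Complex.exp_add, Complex.exp_pi_div_two_mul_I]
  have e2 : ((x ^ (ν - 1 / 2 + 1) : ℝ) : ℂ) * (√x : ℝ) = ((x ^ ν : ℝ) : ℂ) * x := by
    rw [Real.sqrt_eq_rpow]
    norm_cast
    rw [← Real.rpow_add hx, ← Real.rpow_add_one hx.ne']
    ring_nf
  have e3 : ((x ^ (ν - 1 / 2 + 1 + 1) : ℝ) : ℂ) = ((x ^ (ν - 1 / 2 + 1) : ℝ) : ℂ) * x := by
    rw [Real.rpow_add_one hx.ne', Complex.ofReal_mul]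
  rw [ultraHankelD, hankelD, hankelH, hankelConst, ultraAmplitude, e1, e3, Complex.ofReal_mul,
    Complex.ofReal_div, show ν - 1 / 2 + 1 = ν + 1 / 2 by ring] at *
  generalize laplaceInt (ν - 1 / 2) (ν - 1 / 2) x = L
  generalize laplaceInt (ν - 1 / 2) (ν + 1 / 2) x = L1
  generalize Complex.exp (-((ν * Real.pi / 2 + Real.pi / 4 : ℝ) : ℂ) * Complex.I) = E'
  generalize ((x ^ (ν + 1 / 2) : ℝ) : ℂ) = xa at *
  generalize ((Real.Gamma (ν + 1 / 2) : ℝ) : ℂ) = G at *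
  generalize ((x ^ ν : ℝ) : ℂ) = xn at *
  generalize ((√x : ℝ) : ℂ) = r at *
  have h1 : r * (xa * L + Complex.I / x * ((δ - ν) * (xa * L) + xa * x * L1)) =
      x * xn * (L + Complex.I / x * ((δ - ν) * L + x * L1)) := by
    linear_combination (L + Complex.I / x * ((δ - ν) * L + x * L1)) * e2
  rw [show ∀ a e c : ℂ, a * r * e * (c / G) = a * e / G * (r * c) by intros; ring, h1]
  field_simp
  linear_combination (-(E' * xn * ((δ - ν) * L + x * L1))) * Complex.I_mul_I

theorem ultraAmplitude_expansion {ν : ℝ} (hν : -(1 / 2) < ν) (δ : ℝ) (K : ℕ) :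
    (fun x : ℝ => ultraAmplitude ν δ x -
      ∑ k ∈ Finset.range (K + 1), (ultraCoeff ν δ k : ℂ) * (Complex.I / x) ^ k)
      =O[atTop] fun x : ℝ => (x⁻¹) ^ (K + 1) := by
  have ha : -1 < ν - 1 / 2 := by linarith
  have hG : (0 : ℝ) < Real.Gamma (ν + 1 / 2) := Real.Gamma_pos_of_pos (by linarith)
  have hG0 : ((Real.Gamma (ν + 1 / 2) : ℝ) : ℂ) ≠ 0 := by exact_mod_cast hG.ne'
  have h1 := laplaceInt_expansion (ν - 1 / 2) ha (K + 1)
  have h2 := laplaceInt_expansion (ν - 1 / 2) ha K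
  have h3 := laplaceInt_expansion (ν - 1 / 2) (show -1 < ν - 1 / 2 + 1 by linarith) K
  have h4 : (fun x : ℝ => Complex.I / (x : ℂ)) =O[atTop] fun x : ℝ => x⁻¹ := by
    refine IsBigO.of_bound 1 (Eventually.of_forall fun x => ?_)
    simp
  have h5 := (h1.add ((h4.mul ((h2.const_mul_left ((δ : ℂ) - ν)).add h3)).congr_right
    fun x => (pow_succ' _ _).symm)).const_mul_left (((Real.Gamma (ν + 1 / 2) : ℝ) : ℂ)⁻¹)
  refine h5.congr_left fun x => ?_
  have hz : laplaceCoeff (ν - 1 / 2) (ν - 1 / 2) 0 = Real.Gamma (ν + 1 / 2) := by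
    simp only [laplaceCoeff, binomCoeff]
    norm_num
    ring_nf
  have hs : ∑ k ∈ Finset.range (K + 1), (ultraCoeff ν δ k : ℂ) * (Complex.I / x) ^ k =
      ((Real.Gamma (ν + 1 / 2) : ℝ) : ℂ)⁻¹ * (∑ k ∈ Finset.range (K + 1),
        (laplaceCoeff (ν - 1 / 2) (ν - 1 / 2) k : ℂ) * (Complex.I / x) ^ k +
      Complex.I / x * ((δ - ν) * ∑ k ∈ Finset.range K,
        (laplaceCoeff (ν - 1 / 2) (ν - 1 / 2) k : ℂ) * (Complex.I / x) ^ k +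
        ∑ k ∈ Finset.range K,
        (laplaceCoeff (ν - 1 / 2) (ν - 1 / 2 + 1) k : ℂ) * (Complex.I / x) ^ k)) := by
    rw [Finset.sum_range_succ', Finset.sum_range_succ' _ K, hz]
    simp only [ultraCoeff, Finset.mul_sum, ← Finset.sum_add_distrib, pow_zero, mul_one, mul_add,
      inv_mul_cancel₀ hG0, Complex.ofReal_one]
    rw [add_right_comm, ← Finset.sum_add_distrib]
    congr 1
    refine Finset.sum_congr rfl fun k _ => ?_
    push_cast
    rw [pow_succ]
    ring
  rw [hs, ultraAmplitude]
  field_simp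
  ring

/-- Even powers of i/x are real. This is why the phase contains only odd powers of 1/x and involves
only the even-indexed q. -/
theorem im_sum_I_div_pow (l : ℕ → ℝ) (M : ℕ) (x : ℝ) :
    (∑ k ∈ Finset.range (2 * M), ((l k : ℝ) : ℂ) * (Complex.I / x) ^ (k + 1)).im =
      ∑ j ∈ Finset.range M, (-1) ^ j * l (2 * j) * (x⁻¹) ^ (2 * j + 1) := by
  induction M with
  | zero => simp
  | succ M ih =>
    have e1 : ((l (2 * M) : ℝ) : ℂ) * (Complex.I / x) ^ (2 * M + 1) =
        (((-1) ^ M * l (2 * M) * (x⁻¹) ^ (2 * M + 1) : ℝ) : ℂ) * Complex.I := by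
      rw [div_pow, pow_succ, pow_mul, Complex.I_sq]
      push_cast
      rw [inv_pow]
      ring
    have e2 : ((l (2 * M + 1) : ℝ) : ℂ) * (Complex.I / x) ^ (2 * M + 1 + 1) =
        (((-1) ^ (M + 1) * l (2 * M + 1) * (x⁻¹) ^ (2 * M + 2) : ℝ) : ℂ) := by
      rw [div_pow, show 2 * M + 1 + 1 = 2 * (M + 1) by ring, pow_mul, Complex.I_sq]
      push_cast
      rw [inv_pow]
      ring
    rw [show 2 * (M + 1) = 2 * M + 1 + 1 by ring, Finset.sum_range_succ, Finset.sum_range_succ,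
      Finset.sum_range_succ, Complex.add_im, Complex.add_im, ih, e1, e2, Complex.ofReal_im, add_zero,
      Complex.im_ofReal_mul, Complex.I_im, mul_one]

/-- Jordan's inequality |f| ≤ (π/2)|sin f|, valid once f is small. -/
theorem isBigO_of_sin {f : ℝ → ℝ} {g : ℝ → ℝ} (hf : Tendsto f atTop (𝓝 0))
    (h : (fun x => Real.sin (f x)) =O[atTop] g) : f =O[atTop] g := by
  refine IsBigO.trans (IsBigO.of_bound (Real.pi / 2) ?_) h
  have hpi := Real.pi_pos
  have h1 : ∀ᶠ x in atTop, |f x| < Real.pi / 2 := by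
    have := hf.abs
    rw [abs_zero] at this
    exact this.eventually (gt_mem_nhds (by positivity))
  filter_upwards [h1] with x hx
  have := Real.mul_abs_le_abs_sin hx.le
  rw [Real.norm_eq_abs, Real.norm_eq_abs]
  calc |f x| = Real.pi / 2 * (2 / Real.pi * |f x|) := by field_simp
    _ ≤ _ := by gcongr

/-- Dividing the amplitude by the exponential of its truncated logarithm leaves 1 + O(x^(-2M-1)),
whose argument is the error f up to a multiple of 2π. Its imaginary part bounds sin f, and f → 0
removes the ambiguity. -/
theorem IsHankelPhase.ultraPhase_expansion {ν : ℝ} {θ : ℝ → ℝ} (h : IsHankelPhase ν θ)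
    (hν : -(1 / 2) < ν) (δ : ℝ) {q : ℕ → ℝ} (hq : ∀ n, ∑ ij ∈ Finset.HasAntidiagonal.antidiagonal n,
      ultraCoeff ν δ ij.1 * q ij.2 = (n + 1) * ultraCoeff ν δ (n + 1)) (M : ℕ) :
    (fun x => (ultraPhase ν δ θ x - (x - ν * Real.pi / 2 + Real.pi / 4)) -
      ∑ j ∈ Finset.range M, (-1) ^ j * (q (2 * j) / ((2 * j : ℕ) + 1)) * (x⁻¹) ^ (2 * j + 1))
      =O[atTop] fun x => (x⁻¹) ^ (2 * M + 1) := by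
  set S : ℂ → ℂ := fun w => ∑ k ∈ Finset.range (2 * M), ((q k / (k + 1) : ℝ) : ℂ) * w ^ (k + 1)
    with hS
  have hScont : Continuous S := by fun_prop
  have hS0 : S 0 = 0 := by simp [hS]
  have hw : Tendsto (fun x : ℝ => Complex.I / (x : ℂ)) atTop (𝓝 0) := by
    have h1 : Tendsto (fun x : ℝ => Complex.I * ((x⁻¹ : ℝ) : ℂ)) atTop (𝓝 (Complex.I * (0 : ℝ))) :=
      (((Complex.continuous_ofReal.tendsto 0).comp tendsto_inv_atTop_zero)).const_mul _
    rw [Complex.ofReal_zero, mul_zero] at h1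
    refine h1.congr fun x => ?_
    push_cast
    rw [div_eq_mul_inv]
  have hSt : Tendsto (fun x : ℝ => S (Complex.I / x)) atTop (𝓝 0) := by
    have := (hScont.tendsto 0).comp hw
    rwa [hS0] at this
  have hexp : Tendsto (fun x : ℝ => Complex.exp (-S (Complex.I / x))) atTop (𝓝 1) := by
    have := (Complex.continuous_exp.tendsto _).comp hSt.neg
    rwa [neg_zero, Complex.exp_zero] at this
  have h1 := (isBigO_mul_exp_neg_sub_one (d := ultraCoeff ν δ) rfl hq (2 * M)).comp_tendsto hw
  have h2 := (ultraAmplitude_expansion hν δ (2 * M)).mul (hexp.isBigO_one ℝ)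
  have h1' : (fun x : ℝ => (∑ k ∈ Finset.range (2 * M + 1), (ultraCoeff ν δ k : ℂ) *
      (Complex.I / x) ^ k) * Complex.exp (-S (Complex.I / x)) - 1) =O[atTop]
      fun x => (x⁻¹) ^ (2 * M + 1) := by
    refine IsBigO.trans h1 (IsBigO.of_bound 1 (Eventually.of_forall fun x => ?_))
    simp
  have h3 : (fun x : ℝ => ultraAmplitude ν δ x * Complex.exp (-S (Complex.I / x)) - 1)
      =O[atTop] fun x => (x⁻¹) ^ (2 * M + 1) := by
    refine ((h2.congr_right fun x => mul_one _).add h1').congr_left fun x => ?_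
    ring
  have h0 : Tendsto (fun x : ℝ => (x⁻¹) ^ (2 * M + 1)) atTop (𝓝 0) := by
    have := tendsto_inv_atTop_zero (𝕜 := ℝ) |>.pow (2 * M + 1)
    rwa [zero_pow (Nat.succ_ne_zero _)] at this
  have h4 : Tendsto (fun x : ℝ => ‖ultraAmplitude ν δ x * Complex.exp (-S (Complex.I / x))‖) atTop
      (𝓝 1) := by
    have := (h3.trans_tendsto h0).add_const 1
    simp only [sub_add_cancel, zero_add] at this
    have := this.norm
    rwa [norm_one] at this
  set f : ℝ → ℝ := fun x => (ultraPhase ν δ θ x - (x - ν * Real.pi / 2 + Real.pi / 4)) -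
    (S (Complex.I / x)).im with hf
  have hft : Tendsto f atTop (𝓝 0) := by
    have := (h.tendsto_ultraPhase hν δ).sub ((Complex.continuous_im.tendsto 0).comp hSt)
    simpa using this
  have hpolar : ∀ᶠ x in atTop, ultraAmplitude ν δ x * Complex.exp (-S (Complex.I / x)) =
      ‖ultraAmplitude ν δ x * Complex.exp (-S (Complex.I / x))‖ * Complex.exp (f x * Complex.I) := by
    filter_upwards [eventually_gt_atTop 0] with x hx
    have hc : 0 < √(2 / Real.pi) * √x := by have := Real.pi_pos; positivity
    have hc0 : ((√(2 / Real.pi) * √x : ℝ) : ℂ) ≠ 0 := by exact_mod_cast hc.ne'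
    have e1 := ultraHankelD_eq_amplitude hν δ hx
    have e2 := h.ultra_eq_exp hν δ hx
    rw [e1, norm_mul, norm_mul, Complex.norm_exp_ofReal_mul_I, mul_one, Complex.norm_real,
      Real.norm_of_nonneg hc.le, Complex.ofReal_mul (√(2 / Real.pi) * √x), mul_assoc, mul_assoc] at e2
    have e3 := mul_left_cancel₀ hc0 e2
    have e4 : ultraAmplitude ν δ x = ‖ultraAmplitude ν δ x‖ *
        Complex.exp ((ultraPhase ν δ θ x - (x - ν * Real.pi / 2 + Real.pi / 4) : ℝ) * Complex.I) := by
      apply mul_left_cancel₀ (Complex.exp_ne_zero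
        ((x - ν * Real.pi / 2 + Real.pi / 4 : ℝ) * Complex.I))
      rw [e3, mul_left_comm, ← Complex.exp_add]
      congr 2
      push_cast
      ring
    have e5 : Complex.exp (-S (Complex.I / x)) = ‖Complex.exp (-S (Complex.I / x))‖ *
        Complex.exp (-((S (Complex.I / x)).im * Complex.I)) := by
      rw [Complex.norm_exp, Complex.ofReal_exp, ← Complex.exp_add]
      congr 1
      conv_lhs => rw [← Complex.re_add_im (S (Complex.I / x))]
      rw [Complex.neg_re]
      push_cast
      ring
    conv_lhs => rw [e4, e5]
    rw [norm_mul, Complex.ofReal_mul, mul_mul_mul_comm, ← Complex.exp_add]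
    congr 2
    simp only [hf]
    push_cast
    ring
  have h5 : (fun x => Real.sin (f x)) =O[atTop] fun x => (x⁻¹) ^ (2 * M + 1) := by
    have h6 : (fun x : ℝ => (ultraAmplitude ν δ x * Complex.exp (-S (Complex.I / x)) - 1).im)
        =O[atTop] fun x => (x⁻¹) ^ (2 * M + 1) :=
      IsBigO.trans (IsBigO.of_bound 1 (Eventually.of_forall fun x => by
        rw [one_mul, Real.norm_eq_abs]; exact Complex.abs_im_le_norm _)) h3
    have h7 := h6.mul ((h4.inv₀ one_ne_zero).isBigO_one ℝ)
    refine h7.congr' ?_ (by simp)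
    filter_upwards [hpolar, h4.eventually_ne one_ne_zero] with x hx hx0
    rw [Complex.sub_im, Complex.one_im, sub_zero]
    have := congrArg Complex.im hx
    rw [Complex.im_ofReal_mul, Complex.exp_ofReal_mul_I_im] at this
    rw [this]
    field_simp
  refine (isBigO_of_sin hft h5).congr_left fun x => ?_
  simp only [hf, hS]
  rw [im_sum_I_div_pow (fun k => q k / (k + 1))]

/-! ### Explicit coefficients -/

theorem binomCoeff_succ (k : ℕ) (a : ℝ) :
    binomCoeff (k + 1) a = (a - k) / (k + 1) * binomCoeff k a := by
  induction k generalizing a with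
  | zero => simp [binomCoeff]
  | succ k ih =>
    have e1 : ∀ m a, binomCoeff (m + 1) a = a / ((m : ℝ) + 1) * binomCoeff m (a - 1) :=
      fun _ _ => rfl
    rw [e1 (k + 1), ih (a - 1), e1 k]
    push_cast
    have : (k : ℝ) + 1 ≠ 0 := by positivity
    have : (k : ℝ) + 1 + 1 ≠ 0 := by positivity
    field_simp
    ring

/-- The coefficients of Hankel's asymptotic series, with `μ = 4 ν ^ 2`. -/
noncomputable def hankelCoeff (μ : ℝ) : ℕ → ℝ
  | 0 => 1
  | k + 1 => hankelCoeff μ k * ((μ - (2 * k + 1) ^ 2) / (8 * (k + 1)))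

theorem laplaceCoeff_eq_hankelCoeff {ν : ℝ} (hν : -(1 / 2) < ν) (k : ℕ) :
    laplaceCoeff (ν - 1 / 2) (ν - 1 / 2) k =
      Real.Gamma (ν + 1 / 2) * hankelCoeff (4 * ν ^ 2) k := by
  induction k with
  | zero =>
    simp only [laplaceCoeff, binomCoeff, hankelCoeff]
    norm_num
    ring_nf
  | succ k ih =>
    have h1 : ν - 1 / 2 + k + 1 ≠ 0 := by
      have : (0 : ℝ) ≤ k := k.cast_nonneg
      linarith
    rw [hankelCoeff, ← mul_assoc, ← ih, laplaceCoeff, laplaceCoeff, binomCoeff_succ, pow_succ,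
      show ν - 1 / 2 + ((k + 1 : ℕ) : ℝ) + 1 = ν - 1 / 2 + k + 1 + 1 by push_cast; ring,
      Real.Gamma_add_one h1]
    have : (k : ℝ) + 1 ≠ 0 := by positivity
    field_simp
    ring

theorem ultraCoeff_succ {ν : ℝ} (hν : -(1 / 2) < ν) (δ : ℝ) (k : ℕ) :
    ultraCoeff ν δ (k + 1) = hankelCoeff (4 * ν ^ 2) k *
      ((4 * ν ^ 2 - (2 * k + 1) ^ 2) / (8 * (k + 1)) + δ + k + 1 / 2) := by
  have hG : (0 : ℝ) < Real.Gamma (ν + 1 / 2) := Real.Gamma_pos_of_pos (by linarith)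
  have h1 : ν - 1 / 2 + k + 1 ≠ 0 := by
    have : (0 : ℝ) ≤ k := k.cast_nonneg
    linarith
  have h2 : laplaceCoeff (ν - 1 / 2) (ν - 1 / 2 + 1) k =
      laplaceCoeff (ν - 1 / 2) (ν - 1 / 2) k * (ν - 1 / 2 + k + 1) := by
    rw [laplaceCoeff, laplaceCoeff,
      show ν - 1 / 2 + 1 + (k : ℝ) + 1 = ν - 1 / 2 + k + 1 + 1 by ring, Real.Gamma_add_one h1]
    ring
  rw [ultraCoeff, h2, laplaceCoeff_eq_hankelCoeff hν, laplaceCoeff_eq_hankelCoeff hν, hankelCoeff]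
  generalize Real.Gamma (ν + 1 / 2) = G at *
  field_simp
  ring

open PowerSeries in
theorem exists_logarithmic_derivative {d : ℕ → ℝ} (hd : d 0 = 1) : ∃ q : ℕ → ℝ,
    ∀ n, ∑ ij ∈ Finset.HasAntidiagonal.antidiagonal n, d ij.1 * q ij.2 = (n + 1) * d (n + 1) := by
  set D : ℝ⟦X⟧ := PowerSeries.mk d with hD
  set N : ℝ⟦X⟧ := PowerSeries.mk fun n => (n + 1) * d (n + 1) with hN
  have h0 : constantCoeff D ≠ 0 := by
    rw [← coeff_zero_eq_constantCoeff_apply, hD, coeff_mk, hd]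
    exact one_ne_zero
  refine ⟨fun n => coeff n (D⁻¹ * N), fun n => ?_⟩
  have h1 : D * (D⁻¹ * N) = N := by
    rw [← mul_assoc, PowerSeries.mul_inv_cancel D h0, one_mul]
  have h2 := congrArg (coeff n) h1
  rw [coeff_mul, hN, coeff_mk] at h2
  rw [← h2]
  refine Finset.sum_congr rfl fun ij _ => ?_
  rw [hD, coeff_mk]

open PowerSeries in
-- W is first expressed through R from their product, and then each coefficient of R is obtained in
-- turn from the defining relation modulo X^4.
theorem formal_reversion_coeffs {e : ℕ → ℝ} {R W : ℝ⟦X⟧} (hW : (1 + X * R) * W = 1)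
    (hR : ∀ n, X ^ n ∣ R + ∑ j ∈ Finset.range n, C (e j) * X ^ j * W ^ (2 * j + 1)) :
    coeff 0 R = -e 0 ∧ coeff 1 R = -(e 1 + e 0 ^ 2) ∧
    coeff 2 R = -(e 2 + 4 * e 0 * e 1 + 2 * e 0 ^ 3) ∧
    coeff 3 R = -(e 3 + 6 * e 0 * e 2 + 3 * e 1 ^ 2 + 15 * e 0 ^ 2 * e 1 + 5 * e 0 ^ 4) := by
  have hW' : W + X * (R * W) = 1 := by rw [← hW]; ring
  have w0 : coeff 0 W = 1 := by
    have := congrArg (coeff 0) hW'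
    simpa using this
  have w1 : coeff 1 W = -coeff 0 R := by
    have := congrArg (coeff 1) hW'
    rw [map_add, coeff_succ_X_mul, coeff_mul, coeff_one] at this
    simp at this w0 ⊢
    rw [w0] at this
    linarith
  have w2 : coeff 2 W = coeff 0 R ^ 2 - coeff 1 R := by
    have := congrArg (coeff 2) hW'
    rw [map_add, coeff_succ_X_mul, coeff_mul, coeff_one] at this
    simp [Finset.Nat.antidiagonal_succ] at this w0 w1 ⊢
    rw [w0, w1] at this
    linarith
  have w3 : coeff 3 W = -coeff 0 R ^ 3 + 2 * coeff 0 R * coeff 1 R - coeff 2 R := by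
    have := congrArg (coeff 3) hW'
    rw [map_add, coeff_succ_X_mul, coeff_mul, coeff_one] at this
    simp [Finset.Nat.antidiagonal_succ] at this w0 w1 w2 ⊢
    rw [w0, w1, w2] at this
    linarith
  have key : ∀ i < 4, coeff i R + ∑ j ∈ Finset.range 4,
      e j * (if j ≤ i then coeff (i - j) (W ^ (2 * j + 1)) else 0) = 0 := by
    intro i hi
    have := X_pow_dvd_iff.mp (hR 4) i hi
    rw [map_add, map_sum] at this
    refine Eq.trans ?_ this
    congr 1
    refine Finset.sum_congr rfl fun j _ => ?_
    rw [mul_assoc, coeff_C_mul, coeff_X_pow_mul']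
  have k0 := key 0 (by norm_num)
  have k1 := key 1 (by norm_num)
  have k2 := key 2 (by norm_num)
  have k3 := key 3 (by norm_num)
  simp [Finset.sum_range_succ, pow_succ, coeff_mul, Finset.Nat.antidiagonal_succ] at k0 k1 k2 k3 w0 w1 w2 w3 ⊢
  have r0 : constantCoeff R = -e 0 := by
    rw [w0] at k0
    linear_combination k0
  have r1 : coeff 1 R = -(e 0 * e 0) + -e 1 := by
    rw [w0, w1, r0] at k1
    linear_combination k1
  have r2 : coeff 2 R = -(2 * (e 0 * e 0 * e 0)) + (-(4 * e 0 * e 1) + -e 2) := by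
    rw [w0, w1, w2, r0, r1] at k2
    linear_combination k2
  refine ⟨r0, r1, r2, ?_⟩
  rw [w0, w1, w2, w3, r0, r1, r2] at k3
  linear_combination k3

/-- As the zeroth amplitude coefficient is 1, the recursion determines each q n from the earlier
ones. The odd-indexed values are computed only to reach the next even ones; q 0, q 2, q 4 and q 6
are those that enter c_0 to c_3. -/
theorem logarithmic_derivative_coeffs {ν δ μ : ℝ} (hν : -(1 / 2) < ν) (hμ : μ = 4 * ν ^ 2)
    {q : ℕ → ℝ} (hq : ∀ n, ∑ ij ∈ Finset.HasAntidiagonal.antidiagonal n,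
      ultraCoeff ν δ ij.1 * q ij.2 = (n + 1) * ultraCoeff ν δ (n + 1)) :
    q 0 = (μ + 8 * δ + 3) / 8 ∧
    q 2 = (-μ ^ 2 - 48 * μ * δ - 46 * μ + 128 * δ ^ 3 + 192 * δ ^ 2 + 144 * δ + 63) / 128 ∧
    q 4 = (μ ^ 3 + 120 * μ ^ 2 * δ + 185 * μ ^ 2 - 640 * μ * δ ^ 3 - 1600 * μ * δ ^ 2 -
      2320 * μ * δ - 2053 * μ + 1024 * δ ^ 5 + 2560 * δ ^ 4 + 3200 * δ ^ 3 + 2880 * δ ^ 2 +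
      2520 * δ + 1899) / 1024 ∧
    q 6 = (-5 * μ ^ 4 - 1120 * μ ^ 3 * δ - 2380 * μ ^ 3 + 8960 * μ ^ 2 * δ ^ 3 +
      31360 * μ ^ 2 * δ ^ 2 + 67424 * μ ^ 2 * δ + 88354 * μ ^ 2 - 28672 * μ * δ ^ 5 -
      100352 * μ * δ ^ 4 - 189952 * μ * δ ^ 3 - 292096 * μ * δ ^ 2 - 488096 * μ * δ - 629196 * μ +
      32768 * δ ^ 7 + 114688 * δ ^ 6 + 200704 * δ ^ 5 + 243712 * δ ^ 4 + 252672 * δ ^ 3 +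
      282240 * δ ^ 2 + 425376 * δ + 543483) / 32768 := by
  have d0 : ultraCoeff ν δ 0 = 1 := rfl
  have hd : ∀ k : ℕ, ultraCoeff ν δ (k + 1) = hankelCoeff μ k *
      ((μ - (2 * k + 1) ^ 2) / (8 * (k + 1)) + δ + k + 1 / 2) := by
    rw [hμ]
    exact ultraCoeff_succ hν δ
  have d1 := hd 0
  have d2 := hd 1
  have d3 := hd 2
  have d4 := hd 3
  have d5 := hd 4
  have d6 := hd 5
  have d7 := hd 6
  simp only [hankelCoeff] at d1 d2 d3 d4 d5 d6 d7
  norm_num at d1 d2 d3 d4 d5 d6 d7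
  have q0 : q 0 = (μ + 8 * δ + 3) / 8 := by
    have := hq 0
    rw [Finset.Nat.sum_antidiagonal_eq_sum_range_succ_mk] at this
    norm_num [Finset.sum_range_succ, d0, d1] at this
    linear_combination this
  have q1 : q 1 = (μ - 8 * δ ^ 2 - 8 * δ - 3) / 8 := by
    have := hq 1
    rw [Finset.Nat.sum_antidiagonal_eq_sum_range_succ_mk] at this
    norm_num [Finset.sum_range_succ, d0, d1, d2, q0] at this
    linear_combination this
  have q2 : q 2 = (-μ ^ 2 - 48 * μ * δ - 46 * μ + 128 * δ ^ 3 + 192 * δ ^ 2 + 144 * δ + 63) / 128 := by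
    have := hq 2
    rw [Finset.Nat.sum_antidiagonal_eq_sum_range_succ_mk] at this
    norm_num [Finset.sum_range_succ, d0, d1, d2, d3, q0, q1] at this
    linear_combination this
  have q3 : q 3 = (-μ ^ 2 + 16 * μ * δ ^ 2 + 32 * μ * δ + 26 * μ - 32 * δ ^ 4 - 64 * δ ^ 3 -
      64 * δ ^ 2 - 48 * δ - 27) / 32 := by
    have := hq 3
    rw [Finset.Nat.sum_antidiagonal_eq_sum_range_succ_mk] at this
    norm_num [Finset.sum_range_succ, d0, d1, d2, d3, d4, q0, q1, q2] at this
    linear_combination this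
  have q4 : q 4 = (μ ^ 3 + 120 * μ ^ 2 * δ + 185 * μ ^ 2 - 640 * μ * δ ^ 3 - 1600 * μ * δ ^ 2 -
      2320 * μ * δ - 2053 * μ + 1024 * δ ^ 5 + 2560 * δ ^ 4 + 3200 * δ ^ 3 + 2880 * δ ^ 2 +
      2520 * δ + 1899) / 1024 := by
    have := hq 4
    rw [Finset.Nat.sum_antidiagonal_eq_sum_range_succ_mk] at this
    norm_num [Finset.sum_range_succ, d0, d1, d2, d3, d4, d5, q0, q1, q2, q3] at this
    linear_combination this
  have q5 : q 5 = (μ ^ 3 - 24 * μ ^ 2 * δ ^ 2 - 72 * μ ^ 2 * δ - 90 * μ ^ 2 + 96 * μ * δ ^ 4 +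
      288 * μ * δ ^ 3 + 480 * μ * δ ^ 2 + 696 * μ * δ + 735 * μ - 128 * δ ^ 6 - 384 * δ ^ 5 -
      576 * δ ^ 4 - 608 * δ ^ 3 - 576 * δ ^ 2 - 648 * δ - 648) / 128 := by
    have := hq 5
    rw [Finset.Nat.sum_antidiagonal_eq_sum_range_succ_mk] at this
    norm_num [Finset.sum_range_succ, d0, d1, d2, d3, d4, d5, d6, q0, q1, q2, q3, q4] at this
    linear_combination this
  have q6 : q 6 = (-5 * μ ^ 4 - 1120 * μ ^ 3 * δ - 2380 * μ ^ 3 + 8960 * μ ^ 2 * δ ^ 3 +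
      31360 * μ ^ 2 * δ ^ 2 + 67424 * μ ^ 2 * δ + 88354 * μ ^ 2 - 28672 * μ * δ ^ 5 -
      100352 * μ * δ ^ 4 - 189952 * μ * δ ^ 3 - 292096 * μ * δ ^ 2 - 488096 * μ * δ - 629196 * μ +
      32768 * δ ^ 7 + 114688 * δ ^ 6 + 200704 * δ ^ 5 + 243712 * δ ^ 4 + 252672 * δ ^ 3 +
      282240 * δ ^ 2 + 425376 * δ + 543483) / 32768 := by
    have := hq 6
    rw [Finset.Nat.sum_antidiagonal_eq_sum_range_succ_mk] at this
    norm_num [Finset.sum_range_succ, d0, d1, d2, d3, d4, d5, d6, d7, q0, q1, q2, q3, q4,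
      q5] at this
    linear_combination this
  exact ⟨q0, q2, q4, q6⟩

/-- Since ψ < θ + π, large values of ψ force large values of θ, and θ is increasing. -/
theorem IsHankelPhase.tendsto_zeros {ν : ℝ} {θ : ℝ → ℝ} (h : IsHankelPhase ν θ) (hν : 0 ≤ ν)
    (δ : ℝ) {x t : ℕ → ℝ} (ht : Tendsto t atTop atTop)
    (hx : ∀ᶠ k in atTop, 0 < x k ∧ ultraPhase ν δ θ (x k) = t k) : Tendsto x atTop atTop := by
  rw [Filter.tendsto_atTop]
  intro B
  have hB : 0 < max B 1 := lt_max_of_lt_right one_pos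
  filter_upwards [hx, ht.eventually_ge_atTop (θ (max B 1) + Real.pi)] with k hk hkt
  have h1 := ultraPhase_lt (θ := θ) (by linarith : -(1 / 2) < ν) δ hk.1
  have h2 : θ (max B 1) < θ (x k) := by linarith [hk.2]
  exact (le_max_left _ _).trans ((h.strictMonoOn hν).lt_iff_lt hB hk.1 |>.mp h2).le

/-! ### Sturm comparison for xH' beyond the turning point x = ν -/

/-- The Liouville variable `∫ √(x² - ν²) dx / x` from `ν`. -/
noncomputable def liouvilleVar (ν x : ℝ) : ℝ :=
  √(x ^ 2 - ν ^ 2) - ν * Real.arctan (√(x ^ 2 - ν ^ 2) / ν)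

theorem hasDerivAt_liouvilleVar {ν x : ℝ} (hν : 0 < ν) (hx : ν < x) :
    HasDerivAt (liouvilleVar ν) (√(x ^ 2 - ν ^ 2) / x) x := by
  have hx0 : 0 < x := hν.trans hx
  have h1 : 0 < x ^ 2 - ν ^ 2 := by nlinarith
  have hs : HasDerivAt (fun y : ℝ => √(y ^ 2 - ν ^ 2)) (2 * x / (2 * √(x ^ 2 - ν ^ 2))) x := by
    have : HasDerivAt (fun y : ℝ => y ^ 2 - ν ^ 2) (2 * x) x := by
      simpa using (hasDerivAt_pow 2 x).sub_const (ν ^ 2)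
    exact this.sqrt h1.ne'
  have h2 := hs.sub (((hs.div_const ν).arctan).const_mul ν)
  refine h2.congr_deriv ?_
  have hw : 0 < √(x ^ 2 - ν ^ 2) := Real.sqrt_pos.mpr h1
  have hsq : √(x ^ 2 - ν ^ 2) ^ 2 = x ^ 2 - ν ^ 2 := Real.sq_sqrt h1.le
  generalize √(x ^ 2 - ν ^ 2) = w at *
  have e : 1 + (w / ν) ^ 2 = x ^ 2 / ν ^ 2 := by
    rw [div_pow, hsq]
    field_simp
    ring
  rw [e]
  field_simp
  linear_combination -hsq

theorem liouvilleVar_pos {ν x : ℝ} (hν : 0 < ν) (hx : ν < x) : 0 < liouvilleVar ν x := by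
  have hw : 0 < √(x ^ 2 - ν ^ 2) / ν :=
    div_pos (Real.sqrt_pos.mpr (by nlinarith)) hν
  have h := Real.lt_tan (Real.arctan_pos.mpr hw) (Real.arctan_lt_pi_div_two _)
  rw [Real.tan_arctan] at h
  have h2 := mul_lt_mul_of_pos_left h hν
  rw [mul_div_cancel₀ _ hν.ne'] at h2
  exact sub_pos.mpr h2

theorem tendsto_liouvilleVar {ν : ℝ} (hν : 0 < ν) :
    Tendsto (fun x => liouvilleVar ν x - (x - ν * Real.pi / 2)) atTop (𝓝 0) := by
  have h1 : Tendsto (fun x : ℝ => √(x ^ 2 - ν ^ 2) - x) atTop (𝓝 0) := by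
    have h2 : Tendsto (fun x : ℝ => -(ν ^ 2 / x)) atTop (𝓝 0) := by
      simpa using ((tendsto_const_nhds (x := ν ^ 2)).div_atTop (tendsto_id (α := ℝ))).neg
    refine tendsto_of_tendsto_of_tendsto_of_le_of_le' h2 tendsto_const_nhds ?_ ?_
    · filter_upwards [eventually_gt_atTop ν] with x hx
      have hx0 : 0 < x := hν.trans hx
      have : x - ν ^ 2 / x ≤ √(x ^ 2 - ν ^ 2) := by
        refine Real.le_sqrt_of_sq_le ?_
        have h3 : ν ^ 2 / x * x = ν ^ 2 := by field_simp
        have h4 : 0 ≤ ν ^ 2 / x := by positivity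
        have h5 : ν ^ 2 / x ≤ x := by
          rw [div_le_iff₀ hx0]
          nlinarith
        nlinarith
      linarith
    · filter_upwards [eventually_gt_atTop ν] with x hx
      have hx0 : 0 < x := hν.trans hx
      have : √(x ^ 2 - ν ^ 2) ≤ x := Real.sqrt_le_iff.mpr ⟨hx0.le, by nlinarith⟩
      linarith
  have h3 : Tendsto (fun x : ℝ => √(x ^ 2 - ν ^ 2)) atTop atTop := by
    refine (h1.add_atTop tendsto_id).congr fun x => ?_
    simp
  have h4 : Tendsto (fun x : ℝ => Real.arctan (√(x ^ 2 - ν ^ 2) / ν)) atTop (𝓝 (Real.pi / 2)) :=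
    (Real.tendsto_arctan_atTop.mono_right nhdsWithin_le_nhds).comp (h3.atTop_div_const hν)
  have h5 := h1.sub ((h4.const_mul ν).sub_const (ν * Real.pi / 2))
  rw [show (0 : ℝ) - (ν * (Real.pi / 2) - ν * Real.pi / 2) = 0 by ring] at h5
  refine h5.congr fun x => ?_
  rw [liouvilleVar]
  ring

section

variable {ν : ℝ} {θ : ℝ → ℝ}

theorem hasDerivAt_rotated_im {f : ℝ → ℂ} {f' : ℂ} {x : ℝ} (α : ℝ) (hf : HasDerivAt f f' x) :
    HasDerivAt (fun y => (f y).im * Real.cos α - (f y).re * Real.sin α)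
      (f'.im * Real.cos α - f'.re * Real.sin α) x := by
  have h1 : HasDerivAt (fun y => (f y).im) f'.im x := Complex.imCLM.hasFDerivAt.comp_hasDerivAt x hf
  have h2 : HasDerivAt (fun y => (f y).re) f'.re x := Complex.reCLM.hasFDerivAt.comp_hasDerivAt x hf
  exact (h1.mul_const _).sub (h2.mul_const _)

/-- The Sturm comparison: beyond `x = ν` the phase of `x H'` increases by `π` only if the Liouville
variable increases by at least `π`. -/
theorem IsHankelPhase.pi_le_liouvilleVar_sub (h : IsHankelPhase ν θ) (hν : 0 < ν) {x₁ x₂ : ℝ}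
    (h1 : ν < x₁) (h12 : x₁ < x₂)
    (hψ : ultraPhase ν 0 θ x₂ = ultraPhase ν 0 θ x₁ + Real.pi) :
    Real.pi ≤ liouvilleVar ν x₂ - liouvilleVar ν x₁ := by
  by_contra hlt
  push Not at hlt
  have hν' : -(1 / 2) < ν := by linarith
  set α := ultraPhase ν 0 θ x₁ with hα
  set ζ := liouvilleVar ν with hζ
  set ε := Real.pi - (ζ x₂ - ζ x₁) with hε
  have hε0 : 0 < ε := by simp only [ε]; linarith
  -- Centres the interval: ζ − c stays in [ε/2, π − ε/2], so the comparison function sin(ζ − c) is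
  -- positive up to and including the endpoints.
  set c := ζ x₁ - ε / 2 with hc
  have hpos : ∀ x ∈ Icc x₁ x₂, 0 < x := fun x hx => hν.trans (h1.trans_le hx.1)
  have hgt : ∀ x ∈ Icc x₁ x₂, ν < x := fun x hx => h1.trans_le hx.1
  have hr : ∀ x ∈ Icc x₁ x₂, 0 < x ^ 2 - ν ^ 2 := fun x hx => by nlinarith [hgt x hx]
  have hmono : MonotoneOn ζ (Icc x₁ x₂) := by
    refine monotoneOn_of_deriv_nonneg (convex_Icc _ _)
      (fun x hx => (hasDerivAt_liouvilleVar hν (hgt x hx)).continuousAt.continuousWithinAt)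
      (fun x hx => ?_) fun x hx => ?_
    · exact (hasDerivAt_liouvilleVar hν (hgt x (interior_subset hx))).differentiableAt.differentiableWithinAt
    · rw [(hasDerivAt_liouvilleVar hν (hgt x (interior_subset hx))).deriv]
      exact div_nonneg (Real.sqrt_nonneg _) (hpos x (interior_subset hx)).le
  have hsin : ∀ x ∈ Icc x₁ x₂, 0 < Real.sin (ζ x - c) := by
    intro x hx
    have ha := hmono (left_mem_Icc.mpr h12.le) hx hx.1
    have hb := hmono hx (right_mem_Icc.mpr h12.le) hx.2
    exact Real.sin_pos_of_pos_of_lt_pi (by simp only [c]; linarith)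
      (by simp only [c, ε] at *; linarith)
  set m : ℝ → ℝ := fun x => √√(x ^ 2 - ν ^ 2) with hm
  have hmpos : ∀ x ∈ Icc x₁ x₂, 0 < m x := fun x hx =>
    Real.sqrt_pos.mpr (Real.sqrt_pos.mpr (hr x hx))
  have hm2 : ∀ x ∈ Icc x₁ x₂, m x ^ 2 = √(x ^ 2 - ν ^ 2) := fun x hx =>
    Real.sq_sqrt (Real.sqrt_nonneg _)
  have hm4 : ∀ x ∈ Icc x₁ x₂, m x ^ 4 = x ^ 2 - ν ^ 2 := fun x hx => by
    rw [show m x ^ 4 = (m x ^ 2) ^ 2 by ring, hm2 x hx, Real.sq_sqrt (hr x hx).le]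
  have hmd : ∀ x ∈ Icc x₁ x₂, HasDerivAt m (x / (2 * m x ^ 3)) x := by
    intro x hx
    have : HasDerivAt (fun y : ℝ => y ^ 2 - ν ^ 2) (2 * x) x := by
      simpa using (hasDerivAt_pow 2 x).sub_const (ν ^ 2)
    have h3 := (this.sqrt (hr x hx).ne').sqrt (Real.sqrt_pos.mpr (hr x hx)).ne'
    refine h3.congr_deriv ?_
    change 2 * x / (2 * √(x ^ 2 - ν ^ 2)) / (2 * m x) = _
    rw [← hm2 x hx]
    have := hmpos x hx
    field_simp
  -- The solution rotated by α, so that z vanishes at both endpoints and is nonnegative between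
  -- them. With g the same rotation of H, z = xg' and z' = −(m⁴/x)g.
  set z : ℝ → ℝ := fun x => (ultraHankelD ν 0 x).im * Real.cos α -
    (ultraHankelD ν 0 x).re * Real.sin α with hz
  set g : ℝ → ℝ := fun x => (hankelH ν x).im * Real.cos α - (hankelH ν x).re * Real.sin α with hg
  have hzd : ∀ x ∈ Icc x₁ x₂, HasDerivAt z (-(m x ^ 4 / x) * g x) x := by
    intro x hx
    have := hasDerivAt_rotated_im α (hasDerivAt_ultraHankelD hν' 0 (hpos x hx))
    refine this.congr_deriv ?_
    rw [hm4 x hx, show ((ν ^ 2 - x ^ 2) / x : ℂ) = (((ν ^ 2 - x ^ 2) / x : ℝ) : ℂ) by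
      push_cast; rfl, Complex.ofReal_zero, zero_mul, sub_zero, Complex.im_ofReal_mul,
      Complex.re_ofReal_mul]
    simp only [hg]
    ring
  have hgd : ∀ x ∈ Icc x₁ x₂, HasDerivAt g (z x / x) x := by
    intro x hx
    have := hasDerivAt_rotated_im α (hasDerivAt_hankelH hν' (hpos x hx))
    refine this.congr_deriv ?_
    have hx0 := (hpos x hx).ne'
    simp only [hz, ultraHankelD_im, ultraHankelD_re]
    field_simp
    ring
  have hzeq : ∀ x ∈ Icc x₁ x₂, z x = ‖ultraHankelD ν 0 x‖ *
      Real.sin (ultraPhase ν 0 θ x - α) := by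
    intro x hx
    simp only [hz]
    rw [h.ultra_re hν' 0 (hpos x hx), h.ultra_im hν' 0 (hpos x hx), Real.sin_sub]
    ring
  have hgeq : ∀ x ∈ Icc x₁ x₂, g x = ‖hankelH ν x‖ * Real.sin (θ x - α) := by
    intro x hx
    simp only [hg]
    rw [← besselJ_eq_re_hankelH hν' (hpos x hx), ← besselY_eq_im_hankelH hν' (hpos x hx),
      h.besselJ_eq hν.le (hpos x hx), h.besselY_eq hν.le (hpos x hx), Real.sin_sub]
    ring
  have hsq : √(ν ^ 2 - 0 ^ 2) = ν := by
    rw [zero_pow two_ne_zero, sub_zero, Real.sqrt_sq hν.le]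
  have hψmono := h.strictMonoOn_ultraPhase hν' 0
  rw [hsq] at hψmono
  have hmem : ∀ x ∈ Icc x₁ x₂, x ∈ Ioi 0 ∩ Ici ν := fun x hx => ⟨hpos x hx, (hgt x hx).le⟩
  have hl := left_mem_Icc.mpr h12.le
  have hrr := right_mem_Icc.mpr h12.le
  have hz0 : ∀ x ∈ Icc x₁ x₂, 0 ≤ z x := by
    intro x hx
    rw [hzeq x hx]
    have ha := hψmono.monotoneOn (hmem _ hl) (hmem _ hx) hx.1
    have hb := hψmono.monotoneOn (hmem _ hx) (hmem _ hrr) hx.2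
    exact mul_nonneg (norm_nonneg _) (Real.sin_nonneg_of_nonneg_of_le_pi (by linarith) (by linarith))
  -- F is the Wronskian in the variable ζ of v = z/m and sin(ζ − c), namely v_ζ sin(ζ − c) − v cos(ζ
  -- − c). Its derivative is a positive multiple of z sin(ζ − c): v oscillates more slowly than the
  -- sine. But F is positive at x₁ and negative at x₂, where z = 0 and only the sign of g matters.
  set F : ℝ → ℝ := fun x => (-(m x * g x) - x ^ 2 * z x / (2 * m x ^ 7)) * Real.sin (ζ x - c) -
    z x / m x * Real.cos (ζ x - c) with hF
  have hFd : ∀ x ∈ Icc x₁ x₂, HasDerivAt F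
      (z x * Real.sin (ζ x - c) * (x * (3 * x ^ 2 + 4 * ν ^ 2) / (4 * m x ^ 11))) x := by
    intro x hx
    have hm0 := hmpos x hx
    have hx0 := hpos x hx
    have dm := hmd x hx
    have dz := hzd x hx
    have dζ : HasDerivAt (fun y => ζ y - c) (m x ^ 2 / x) x := by
      rw [hm2 x hx]
      exact (hasDerivAt_liouvilleVar hν (hgt x hx)).sub_const c
    have d2 : HasDerivAt (fun y : ℝ => y ^ 2) (2 * x) x := by simpa using hasDerivAt_pow 2 x
    have d7 : HasDerivAt (fun y => 2 * m y ^ 7) (2 * (7 * m x ^ 6 * (x / (2 * m x ^ 3)))) x := by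
      simpa using (dm.fun_pow 7).const_mul 2
    have d := ((((dm.fun_mul (hgd x hx)).fun_neg.fun_sub
      ((d2.fun_mul dz).fun_div d7 (by positivity))).fun_mul dζ.sin).fun_sub
      ((dz.fun_div dm hm0.ne').fun_mul dζ.cos))
    refine d.congr_deriv ?_
    have e := hm4 x hx
    have e2 : 3 * x ^ 2 + 4 * ν ^ 2 = 7 * x ^ 2 - 4 * m x ^ 4 := by rw [e]; ring
    rw [e2]
    generalize Real.sin (ζ x - c) = S
    generalize Real.cos (ζ x - c) = K
    generalize m x = M at *
    generalize z x = Z at *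
    generalize g x = G at *
    field_simp
    ring
  have hFm : MonotoneOn F (Icc x₁ x₂) := by
    refine monotoneOn_of_deriv_nonneg (convex_Icc _ _)
      (fun x hx => (hFd x hx).continuousAt.continuousWithinAt)
      (fun x hx => (hFd x (interior_subset hx)).differentiableAt.differentiableWithinAt)
      fun x hx => ?_
    have hx := interior_subset hx
    rw [(hFd x hx).deriv]
    have := hmpos x hx
    have := hpos x hx
    exact mul_nonneg (mul_nonneg (hz0 x hx) (hsin x hx).le) (by positivity)
  have hend := hFm hl hrr h12.le
  have hz1 : z x₁ = 0 := by rw [hzeq x₁ hl, ← hα, sub_self, Real.sin_zero, mul_zero]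
  have hz2 : z x₂ = 0 := by rw [hzeq x₂ hrr, hψ, add_sub_cancel_left, Real.sin_pi, mul_zero]
  have hg1 : g x₁ < 0 := by
    rw [hgeq x₁ hl]
    have ha := ultraPhase_gt (θ := θ) hν' 0 (hpos x₁ hl)
    have hb := ultraPhase_lt (θ := θ) hν' 0 (hpos x₁ hl)
    exact mul_neg_of_pos_of_neg (norm_pos_iff.mpr (hankelH_ne_zero hν' (hpos x₁ hl)))
      (Real.sin_neg_of_neg_of_neg_pi_lt (by linarith) (by linarith))
  have hg2 : 0 < g x₂ := by
    rw [hgeq x₂ hrr]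
    have ha := ultraPhase_gt (θ := θ) hν' 0 (hpos x₂ hrr)
    have hb := ultraPhase_lt (θ := θ) hν' 0 (hpos x₂ hrr)
    exact mul_pos (norm_pos_iff.mpr (hankelH_ne_zero hν' (hpos x₂ hrr)))
      (Real.sin_pos_of_pos_of_lt_pi (by linarith) (by linarith))
  simp only [hF, hz1, hz2, mul_zero, zero_div, zero_mul, sub_zero] at hend
  have p1 := mul_pos (mul_pos (hmpos x₁ hl) (neg_pos.mpr hg1)) (hsin x₁ hl)
  have p2 := mul_pos (mul_pos (hmpos x₂ hrr) hg2) (hsin x₂ hrr)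
  linarith

/-- If the phase at ν were nonpositive, it would take each value π/8 + kπ at some x_k > ν, and the
comparison would give ζ(x_k) > kπ by induction. At infinity, however, ζ − ψ → −π/4, so ζ(x_k) − kπ →
−π/8. Any offset strictly between 0 and π/4 would serve in place of π/8. -/
theorem IsHankelPhase.ultraPhase_self_pos (h : IsHankelPhase ν θ) (hν : 0 < ν) :
    0 < ultraPhase ν 0 θ ν := by
  by_contra hneg
  push Not at hneg
  have hν' : -(1 / 2) < ν := by linarith
  have hpi := Real.pi_pos
  have hsq : √(ν ^ 2 - 0 ^ 2) = ν := by
    rw [zero_pow two_ne_zero, sub_zero, Real.sqrt_sq hν.le]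
  have hmono := h.strictMonoOn_ultraPhase hν' 0
  rw [hsq] at hmono
  have hex : ∀ k : ℕ, ∃ x, ν < x ∧ ultraPhase ν 0 θ x = Real.pi / 8 + k * Real.pi := by
    intro k
    have ht : 0 < Real.pi / 8 + k * Real.pi := by positivity
    obtain ⟨b, hb1, hb2⟩ := (((h.tendsto_ultraPhase_atTop hν' 0).eventually_ge_atTop
      (Real.pi / 8 + k * Real.pi)).and (eventually_ge_atTop ν)).exists
    obtain ⟨x, hx, hxt⟩ := intermediate_value_Icc hb2
      ((h.continuousOn_ultraPhase hν' 0).mono fun w hw => hν.trans_le hw.1)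
      ⟨hneg.trans ht.le, hb1⟩
    refine ⟨x, lt_of_le_of_ne hx.1 ?_, hxt⟩
    rintro rfl
    linarith
  choose x hx hxψ using hex
  have hstep : ∀ k, k * Real.pi < liouvilleVar ν (x k) := by
    intro k
    induction k with
    | zero => simpa using liouvilleVar_pos hν (hx 0)
    | succ k ih =>
      have h1 : ultraPhase ν 0 θ (x (k + 1)) = ultraPhase ν 0 θ (x k) + Real.pi := by
        rw [hxψ, hxψ]; push_cast; ring
      have h2 : x k < x (k + 1) :=
        (hmono.lt_iff_lt ⟨hν.trans (hx k), (hx k).le⟩ ⟨hν.trans (hx (k + 1)), (hx (k + 1)).le⟩).mp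
          (by linarith)
      have := h.pi_le_liouvilleVar_sub hν (hx k) h2 h1
      push_cast
      linarith
  have ht : Tendsto (fun k : ℕ => Real.pi / 8 + k * Real.pi) atTop atTop :=
    tendsto_atTop_add_const_left _ _ (tendsto_natCast_atTop_atTop.atTop_mul_const hpi)
  have hxt : Tendsto x atTop atTop := h.tendsto_zeros hν.le 0 ht
    (Eventually.of_forall fun k => ⟨hν.trans (hx k), hxψ k⟩)
  have hlim := ((tendsto_liouvilleVar hν).sub (h.tendsto_ultraPhase hν' 0)).comp hxt
  rw [sub_zero] at hlim
  obtain ⟨k, hk⟩ := (hlim.eventually (gt_mem_nhds (show (0 : ℝ) < Real.pi / 8 by positivity))).exists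
  simp only [Function.comp_apply, hxψ] at hk
  linarith [hstep k]

end

/-! ### McMahon expansions and the conclusion -/

/-- The parameter κ treats both families at once: subtracting the constant π/4 − νπ/2 from the level
(k − κ)π gives β'. The powers of 8 only convert expansions in 1/β' into expansions in 1/(8β'). -/
theorem IsHankelPhase.hasMcMahonExpansion {ν : ℝ} {θ : ℝ → ℝ} (h : IsHankelPhase ν θ)
    (hν : 0 ≤ ν) (δ : ℝ) {q : ℕ → ℝ} (hq : ∀ n, ∑ ij ∈ Finset.HasAntidiagonal.antidiagonal n,
      ultraCoeff ν δ ij.1 * q ij.2 = (n + 1) * ultraCoeff ν δ (n + 1))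
    {R W : PowerSeries ℝ} (hW : (1 + PowerSeries.X * R) * W = 1)
    (hR : ∀ n, PowerSeries.X ^ n ∣ R + ∑ j ∈ Finset.range n,
      PowerSeries.C ((-1) ^ j * (q (2 * j) / ((2 * j : ℕ) + 1))) * PowerSeries.X ^ j *
        W ^ (2 * j + 1))
    {x : ℕ → ℝ} {κ : ℝ} (hx : ∀ᶠ k : ℕ in atTop,
      0 < x k ∧ ultraPhase ν δ θ (x k) = ((k : ℝ) - κ) * Real.pi) :
    HasMcMahonExpansion x (fun k : ℕ => ((k : ℝ) + ν / 2 - κ - 1 / 4) * Real.pi)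
      (fun i => 8 ^ (2 * i + 1) * PowerSeries.coeff i R) := by
  have hlin : ∀ c : ℝ, Tendsto (fun k : ℕ => ((k : ℝ) + c) * Real.pi) atTop atTop := fun c =>
    (tendsto_atTop_add_const_right _ c tendsto_natCast_atTop_atTop).atTop_mul_const Real.pi_pos
  have hβ : Tendsto (fun k : ℕ => ((k : ℝ) + ν / 2 - κ - 1 / 4) * Real.pi) atTop atTop :=
    (hlin (ν / 2 - κ - 1 / 4)).congr fun k => by ring
  have hxt : Tendsto x atTop atTop := h.tendsto_zeros hν δ ((hlin (-κ)).congr fun k => by ring) hx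
  intro n
  have key := isBigO_reversion (h.ultraPhase_expansion (by linarith) δ hq) hW hR hxt hβ
    (hx.mono fun k hk => by rw [hk.2]; ring) n
  have hc : (fun k : ℕ => 1 / (((k : ℝ) + ν / 2 - κ - 1 / 4) * Real.pi) ^ (2 * n + 1))
      =O[atTop] fun k : ℕ => 1 / (8 * (((k : ℝ) + ν / 2 - κ - 1 / 4) * Real.pi)) ^ (2 * n + 1) := by
    refine IsBigO.of_bound (8 ^ (2 * n + 1)) (Eventually.of_forall fun k => le_of_eq ?_)
    rw [mul_pow 8, norm_div, norm_div, norm_mul, Real.norm_of_nonneg (by positivity : (0 : ℝ) ≤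
      8 ^ (2 * n + 1))]
    field_simp
  refine (key.trans hc).congr_left fun k => ?_
  congr 2
  refine Finset.sum_congr rfl fun i _ => ?_
  rw [mul_pow 8]
  field_simp

theorem theorem1p1 (ν δ μ : ℝ) (hν : 0 ≤ ν) (hμ : μ = 4 * ν ^ 2) :
    ∃ a b : ℕ → ℝ,
      (∀ k : ℕ, 1 ≤ k → IsKth (zerosJ' ν δ) k (a k)) ∧
      (∀ k : ℕ, 1 ≤ k → IsKth (zerosY' ν δ) k (b k)) ∧
      (0 ≤ δ → earlyZerosY' ν δ = 0) ∧
      ∃ c : ℕ → ℝ,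
        c 0 = -(μ + 3 + 8 * δ) ∧
        c 1 = -(4 * (7 * μ ^ 2 + (82 + 144 * δ) * μ - 9 + 144 * δ + 192 * δ ^ 2
          - 128 * δ ^ 3) / 3) ∧
        c 2 = coeffC μ δ ∧
        c 3 = coeffCTilde μ δ ∧
        HasMcMahonExpansion a (fun k : ℕ => ((k : ℝ) + ν / 2 - 3 / 4) * Real.pi) c ∧
        HasMcMahonExpansion (fun k : ℕ => b (k + earlyZerosY' ν δ))
          (fun k : ℕ => ((k : ℝ) + ν / 2 - 1 / 4) * Real.pi) c := by
  have hν' : -(1 / 2) < ν := by linarith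
  obtain ⟨θ, h⟩ := exists_hankelPhase hν
  obtain ⟨a, ha, haθ⟩ := h.exists_zerosJ' hν δ
  obtain ⟨b, hb, hbθ⟩ := h.exists_zerosY' hν δ
  obtain ⟨q, hq⟩ := exists_logarithmic_derivative (d := ultraCoeff ν δ) rfl
  obtain ⟨R, W, hW, hR⟩ :=
    exists_formal_reversion fun j => (-1) ^ j * (q (2 * j) / ((2 * j : ℕ) + 1))
  obtain ⟨q0, q2, q4, q6⟩ := logarithmic_derivative_coeffs hν' hμ hq
  obtain ⟨r0, r1, r2, r3⟩ := formal_reversion_coeffs hW hR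
  norm_num [q0, q2, q4, q6] at r0 r1 r2 r3
  refine ⟨a, b, ha, hb, fun hδ => h.earlyZerosY'_eq_zero hν hδ h.ultraPhase_self_pos,
    fun i => 8 ^ (2 * i + 1) * PowerSeries.coeff i R, ?_, ?_, ?_, ?_, ?_, ?_⟩
  · norm_num [r0]
    ring
  · norm_num [r1]
    ring
  · norm_num [r2, coeffC]
    ring
  · norm_num [r3, coeffCTilde]
    ring
  -- The phase equation is available only from k = 2, since the first zero may be the conventional x
  -- = 0.
  · have := h.hasMcMahonExpansion hν δ hq hW hR (x := a) (κ := 1 / 2)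
      ((eventually_ge_atTop 2).mono haθ)
    convert this using 3
    ring
  · have := h.hasMcMahonExpansion hν δ hq hW hR (x := fun k => b (k + earlyZerosY' ν δ)) (κ := 0)
      ((eventually_ge_atTop 1).mono fun k hk => by simpa using hbθ k hk)
    simpa using this
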